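/- **Theorem (Adapted Conformal Identity).** Let $n\ge 0$ and let $V:\mathbb R^n\to\mathbb R$ be bounded and differentiable with bounded gradient. Let $W:\mathbb R^n\times(0,\infty)\to\mathbb R$ be differentiable in $x$ and in $t$, with $W,\nabla_xW,\partial_tW$ bounded on $\mathbb R^n\times(0,T]$ for every $T$. Write $p=-i\nabla_x$, $A=\tfrac12(x\cdot p+p\cdot x)$, $H=-\Delta+V$, $C(t)=|x-2pt|^2$, $\langle x\rangle=(1+|x|^2)^{1/2}$, and let $X=H^1(\mathbb R^n)\cap\langle x\rangle^{-1}L^2(\mathbb R^n)$ with its natural norm. For a real function $f$ put $[f]_\pm=f$ where $\pm f\ge 0$ and $[f]_\pm=0$ elsewhere (so $[f]_-\le 0$ and $f=[f]_++[f]_-$). Let $B_V$ be a symmetric operator on $L^2(\mathbb R^n)$ (for instance a bounded self-adjoint one) whose domain contains $X$ and which satisfies $$ i[-\Delta+V,B_V]=-[4x\cdot\nabla V+4V]_+ $$ in the sense of sesquilinear forms on $\mathcal S\times\mathcal S$, where $\mathcal S$ is the Schwartz space. Let $\psi\in C([0,\infty);L^2(\mathbb R^n))$ solve $i\partial_t\psi=(-\Delta+V+W(\cdot,t))\psi$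 for $t>0$ in the weak sense (tested against Schwartz functions of $x$), with $\psi(0)\in X$. Then $\psi(t)\in X$ for all $t\ge 0$, and for every $t>0$ the functions $V\psi(t)$ and $W(\cdot,t)\psi(t)$ lie in $X$, all the expressions below are well defined, and $t\mapsto\langle\psi(t),[C(t)/t+4t(V+W)+B_V]\psi(t)\rangle$ is differentiable with $$ \begin{aligned} \partial_t\big\langle\psi(t),&\big[\tfrac1t|x-2pt|^2+4t(V+W)+B_V\big]\psi(t)\big\rangle\\ &=\Big\langle\psi(t),\Big[-\tfrac1t\big(\tfrac1t|x-2pt|^2-4t(V+W)\big)+i[V,-4A]+i[W,-4A+B_V]+4t\,\partial_tW+i[H,B_V]\Big]\psi(t)\Big\rangle\\ &=\Big\langle\psi(t),\Big[-\tfrac1{t^2}C(t)+[4x\cdot\nabla V+4V]_-+4x\cdot\nabla_xW+4W+4t\,\partial_tW+i[W,B_V]\Big]\psi(t)\Big\rangle . \end{aligned} $$ Here $\langle u,C(t)u\rangle=\sum_j\|(x_j-2tp_j)u\|^2$, the commutators with $V$ and $W$ are understood as forms on $X$, and $\langle\psi(t),i[H,B_V]\psi(t)\rangle$ is the value at $\psi(t)$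 of the continuous extension, in the norm of $X$, of $\varphi\mapsto\langle\varphi,i[H,B_V]\varphi\rangle$ from $\mathcal S$. -/

import Mathlib

open MeasureTheory Filter Topology Set
open scoped SchwartzMap LineDeriv Laplacian ENNReal ComplexConjugate

noncomputable section

namespace AdaptedConformal

/-- The configuration space `ℝⁿ` with its Euclidean norm. -/
abbrev Rn (n : ℕ) : Type := EuclideanSpace ℝ (Fin n)

/-- The Hilbert space `L²(ℝⁿ; ℂ)`. Inner products are conjugate-linear in the first variable. -/
abbrev L2 (n : ℕ) : Type := Lp ℂ 2 (volume : Measure (Rn n))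

/-- The `L²` class of a Schwartz function. -/
abbrev sch {n : ℕ} (φ : 𝓢(Rn n, ℂ)) : L2 n := φ.toLp 2 volume

/-! ### Unbounded operators on `L²(ℝⁿ)` -/

open Classical in
/-- The value `T u` of a partially defined operator, with the convention that it is `0` when `u`
is not in the domain of `T`. -/
def ap {n : ℕ} (T : L2 n →ₗ.[ℂ] L2 n) (u : L2 n) : L2 n :=
  if h : u ∈ T.domain then T ⟨u, h⟩ else 0

/-- The domain `{u ∈ L² : f u ∈ L²}` of multiplication by a real function `f`. -/
def mulDomain {n : ℕ} (f : Rn n → ℝ) : Submodule ℂ (L2 n) where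
  carrier := {u | MemLp (fun x => (f x : ℂ) * u x) 2 volume}
  add_mem' := by
    intro u v hu hv
    refine (MemLp.add hu hv).ae_eq ?_
    filter_upwards [Lp.coeFn_add u v] with x hx
    rw [hx, Pi.add_apply, Pi.add_apply, mul_add]
  zero_mem' := by
    refine (MemLp.zero (p := 2) (μ := volume) (ε := ℂ)).ae_eq ?_
    filter_upwards [Lp.coeFn_zero ℂ 2 (volume : Measure (Rn n))] with x hx
    rw [hx, Pi.zero_apply, mul_zero]
  smul_mem' := by
    intro c u hu
    refine (MemLp.const_smul hu c).ae_eq ?_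
    filter_upwards [Lp.coeFn_smul c u] with x hx
    rw [hx, Pi.smul_apply, Pi.smul_apply, smul_eq_mul, smul_eq_mul]
    ring

theorem mulDomain_memLp {n : ℕ} {f : Rn n → ℝ} {u : L2 n} (hu : u ∈ mulDomain f) :
    MemLp (fun x => (f x : ℂ) * u x) 2 volume := hu

theorem mulToLp_add {n : ℕ} {f : Rn n → ℝ} {u v : L2 n} (hu : u ∈ mulDomain f)
    (hv : v ∈ mulDomain f) (huv : u + v ∈ mulDomain f) :
    (mulDomain_memLp huv).toLp = (mulDomain_memLp hu).toLp + (mulDomain_memLp hv).toLp := by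
  rw [← MemLp.toLp_add, MemLp.toLp_eq_toLp_iff]
  filter_upwards [Lp.coeFn_add u v] with x hx
  rw [hx, Pi.add_apply, Pi.add_apply, mul_add]

theorem mulToLp_smul {n : ℕ} {f : Rn n → ℝ} (c : ℂ) {u : L2 n} (hu : u ∈ mulDomain f)
    (hcu : c • u ∈ mulDomain f) :
    (mulDomain_memLp hcu).toLp = c • (mulDomain_memLp hu).toLp := by
  rw [← MemLp.toLp_const_smul, MemLp.toLp_eq_toLp_iff]
  filter_upwards [Lp.coeFn_smul c u] with x hx
  rw [hx, Pi.smul_apply, Pi.smul_apply, smul_eq_mul, smul_eq_mul]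
  ring

/-- Multiplication by a real function `f`, with its maximal domain `{u ∈ L² : f u ∈ L²}`. -/
def mulOp {n : ℕ} (f : Rn n → ℝ) : L2 n →ₗ.[ℂ] L2 n where
  domain := mulDomain f
  toFun :=
    { toFun := fun u => (mulDomain_memLp u.2).toLp
      map_add' := fun u v => mulToLp_add u.2 v.2 (u + v).2
      map_smul' := fun c u => mulToLp_smul c u.2 (c • u).2 }

/-- The tempered distribution defined by an element of `L²`. -/
abbrev dist {n : ℕ} : L2 n →L[ℂ] 𝓢'(Rn n, ℂ) :=
  Lp.toTemperedDistributionCLM ℂ (volume : Measure (Rn n)) 2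

theorem dist_injective {n : ℕ} : Function.Injective (dist (n := n)) :=
  LinearMap.ker_eq_bot.mp Lp.ker_toTemperedDistributionCLM_eq_bot

/-- The distribution `-i ∂ⱼ u`. -/
def momDist {n : ℕ} (j : Fin n) (u : L2 n) : 𝓢'(Rn n, ℂ) :=
  (-Complex.I) • ∂_{(EuclideanSpace.single j (1 : ℝ) : Rn n)} (dist u)

theorem momDist_add {n : ℕ} (j : Fin n) (u v : L2 n) :
    momDist j (u + v) = momDist j u + momDist j v := by
  simp only [momDist, map_add, LineDeriv.lineDerivOp_add, smul_add]

theorem momDist_smul {n : ℕ} (j : Fin n) (c : ℂ) (u : L2 n) :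
    momDist j (c • u) = c • momDist j u := by
  simp only [momDist, map_smul, LineDeriv.lineDerivOp_smul]
  rw [smul_comm]

/-- The domain `{u ∈ L² : ∂ⱼ u ∈ L²}` of the momentum operator. -/
def momDomain {n : ℕ} (j : Fin n) : Submodule ℂ (L2 n) where
  carrier := {u | ∃ v : L2 n, dist v = momDist j u}
  add_mem' := by
    rintro u v ⟨u', hu⟩ ⟨v', hv⟩
    exact ⟨u' + v', by rw [map_add, hu, hv, momDist_add]⟩
  zero_mem' := by
    refine ⟨0, ?_⟩
    have h := momDist_smul j 0 (0 : L2 n)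
    rw [zero_smul] at h
    rw [h, map_zero]
    exact (zero_smul ℂ (momDist j (0 : L2 n))).symm
  smul_mem' := by
    rintro c u ⟨u', hu⟩
    exact ⟨c • u', by rw [map_smul, hu, momDist_smul]⟩

theorem exists_of_mem_momDomain {n : ℕ} {j : Fin n} {u : L2 n} (hu : u ∈ momDomain j) :
    ∃ v : L2 n, dist v = momDist j u := hu

/-- The element `-i ∂ⱼ u` of `L²`, for `u` in the domain of the momentum operator. -/
def momVal {n : ℕ} {j : Fin n} {u : L2 n} (hu : u ∈ momDomain j) : L2 n :=
  (exists_of_mem_momDomain hu).choose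

theorem dist_momVal {n : ℕ} {j : Fin n} {u : L2 n} (hu : u ∈ momDomain j) :
    dist (momVal hu) = momDist j u :=
  (exists_of_mem_momDomain hu).choose_spec

theorem momVal_add {n : ℕ} {j : Fin n} {u v : L2 n} (hu : u ∈ momDomain j)
    (hv : v ∈ momDomain j) (huv : u + v ∈ momDomain j) :
    momVal huv = momVal hu + momVal hv := by
  apply dist_injective
  rw [map_add, dist_momVal, dist_momVal, dist_momVal, momDist_add]

theorem momVal_smul {n : ℕ} {j : Fin n} (c : ℂ) {u : L2 n} (hu : u ∈ momDomain j)
    (hcu : c • u ∈ momDomain j) : momVal hcu = c • momVal hu := by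
  apply dist_injective
  rw [map_smul, dist_momVal, dist_momVal, momDist_smul]

/-- The momentum operator `pⱼ = -i ∂ⱼ` (distributional derivative), with its maximal domain
`{u ∈ L² : ∂ⱼ u ∈ L²}`. -/
def momOp {n : ℕ} (j : Fin n) : L2 n →ₗ.[ℂ] L2 n where
  domain := momDomain j
  toFun :=
    { toFun := fun u => momVal u.2
      map_add' := fun u v => momVal_add u.2 v.2 (u + v).2
      map_smul' := fun c u => momVal_smul c u.2 (c • u).2 }

/-- The position operator `xⱼ`. -/
def posOp {n : ℕ} (j : Fin n) : L2 n →ₗ.[ℂ] L2 n := mulOp (fun x => x j)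

/-- The Japanese bracket `⟨x⟩ = (1 + |x|²)^{1/2}`. -/
def bracket {n : ℕ} (x : Rn n) : ℝ := Real.sqrt (1 + ‖x‖ ^ 2)

/-- The Sobolev space `H¹(ℝⁿ)`, as a subspace of `L²(ℝⁿ)`. -/
def H1 (n : ℕ) : Submodule ℂ (L2 n) where
  carrier := {u | TemperedDistribution.MemSobolev 1 2 (dist u)}
  add_mem' := by
    intro u v hu hv
    show TemperedDistribution.MemSobolev 1 2 (dist (u + v))
    rw [map_add]
    exact TemperedDistribution.MemSobolev.add hu hv
  zero_mem' := by
    show TemperedDistribution.MemSobolev 1 2 (dist (0 : L2 n))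
    rw [map_zero]
    exact TemperedDistribution.memSobolev_fun_zero (E := Rn n) (F := ℂ) (p := 2) 1
  smul_mem' := by
    intro c u hu
    show TemperedDistribution.MemSobolev 1 2 (dist (c • u))
    rw [map_smul]
    exact TemperedDistribution.MemSobolev.smul c hu

/-- The space `X = H¹ ∩ ⟨x⟩⁻¹L²`. -/
def X (n : ℕ) : Submodule ℂ (L2 n) := H1 n ⊓ (mulOp (bracket (n := n))).domain

/-- The natural norm of `X = H¹ ∩ ⟨x⟩⁻¹L²` (for `u ∈ X`). -/
def xNorm {n : ℕ} (u : L2 n) : ℝ := ‖ap (mulOp bracket) u‖ + ∑ j, ‖ap (momOp j) u‖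

/-! ### Potentials -/

/-- `x · ∇ f(x)`. -/
def xGrad {n : ℕ} (f : Rn n → ℝ) (x : Rn n) : ℝ := inner ℝ x (gradient f x)

/-- `[f]₊`: equal to `f` where `f ≥ 0`, and to `0` elsewhere. -/
def plus {n : ℕ} (f : Rn n → ℝ) (x : Rn n) : ℝ := max (f x) 0

/-- `[f]₋`: equal to `f` where `f ≤ 0`, and to `0` elsewhere (so `[f]₋ ≤ 0`). -/
def minus {n : ℕ} (f : Rn n → ℝ) (x : Rn n) : ℝ := min (f x) 0

/-- The function `4 x · ∇V + 4 V`. -/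
def virial {n : ℕ} (V : Rn n → ℝ) (x : Rn n) : ℝ := 4 * xGrad V x + 4 * V x

/-- The partial derivative `∂W/∂t`. -/
def dt {n : ℕ} (W : ℝ → Rn n → ℝ) (t : ℝ) (x : Rn n) : ℝ := deriv (fun s => W s x) t

/-- `V` is bounded and differentiable, with bounded gradient. -/
structure BoundedDiff {n : ℕ} (V : Rn n → ℝ) : Prop where
  differentiable : Differentiable ℝ V
  bounded : ∃ M : ℝ, ∀ x, |V x| ≤ M ∧ ‖gradient V x‖ ≤ M

/-- `W(x,t)`, `t > 0`, is differentiable in `x` and in `t`; `W`, `∇ₓW` and `∂ₜW` are bounded on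
`ℝⁿ × (0,T]` for every `T`. -/
structure BoundedDiffTime {n : ℕ} (W : ℝ → Rn n → ℝ) : Prop where
  differentiable_space : ∀ t > 0, Differentiable ℝ (W t)
  differentiable_time : ∀ t > 0, ∀ x, DifferentiableAt ℝ (fun s => W s x) t
  bounded : ∀ T : ℝ, ∃ M : ℝ, ∀ t, 0 < t → t ≤ T → ∀ x,
    |W t x| ≤ M ∧ ‖gradient (W t) x‖ ≤ M ∧ |dt W t x| ≤ M

/-! ### The Schrödinger equation -/

/-- `(-Δ + U) φ` for a Schwartz function `φ`. -/
def ham {n : ℕ} (U : Rn n → ℝ) (φ : 𝓢(Rn n, ℂ)) : L2 n := -sch (Δ φ) + ap (mulOp U) (sch φ)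

/-- `ψ ∈ C([0,∞); L²)` solves `i ∂ₜψ = (-Δ + V + W(t)) ψ` for `t > 0`, tested against Schwartz
functions in `x`. -/
structure IsSolution {n : ℕ} (V : Rn n → ℝ) (W : ℝ → Rn n → ℝ) (ψ : ℝ → L2 n) : Prop where
  continuousOn : ContinuousOn ψ (Ici 0)
  equation : ∀ φ : 𝓢(Rn n, ℂ), ∀ t > 0,
    HasDerivAt (fun s => inner ℂ (sch φ) (ψ s))
      (-Complex.I * inner ℂ (ham (V + W t) φ) (ψ t)) t

/-! ### Sesquilinear forms and commutators -/

/-- The expectation `⟨u, T u⟩`. -/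
def expect {n : ℕ} (T : L2 n →ₗ.[ℂ] L2 n) (u : L2 n) : ℂ := inner ℂ u (ap T u)

/-- `⟨u, C(t) u⟩ = ∑ⱼ ‖(xⱼ - 2 t pⱼ) u‖²`, where `C(t) = |x - 2pt|²`. -/
def conformal {n : ℕ} (t : ℝ) (u : L2 n) : ℝ :=
  ∑ j, ‖ap (posOp j) u - ((2 * t : ℝ) : ℂ) • ap (momOp j) u‖ ^ 2

/-- The sesquilinear form `⟨u, A v⟩` on `X` of the dilation operator `A = (x·p + p·x)/2`. -/
def dilation {n : ℕ} (u v : L2 n) : ℂ :=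
  (1 / 2) * ∑ j, (inner ℂ (ap (posOp j) u) (ap (momOp j) v) +
    inner ℂ (ap (momOp j) u) (ap (posOp j) v))

/-- The expectation `⟨u, i[f, q] u⟩ = i (q(f u, u) - q(u, f u))` of the commutator of
multiplication by the real function `f` with the operator whose sesquilinear form is `q`. -/
def commMul {n : ℕ} (f : Rn n → ℝ) (q : L2 n → L2 n → ℂ) (u : L2 n) : ℂ :=
  Complex.I * (q (ap (mulOp f) u) u - q u (ap (mulOp f) u))

/-- The sesquilinear form `⟨φ, i[-Δ + V, B] χ⟩ = i (⟨(-Δ+V)φ, Bχ⟩ - ⟨Bφ, (-Δ+V)χ⟩)` on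
`𝓢 × 𝓢`, for a symmetric operator `B`. -/
def commHam {n : ℕ} (V : Rn n → ℝ) (B : L2 n →ₗ.[ℂ] L2 n) (φ χ : 𝓢(Rn n, ℂ)) : ℂ :=
  Complex.I * (inner ℂ (ham V φ) (ap B (sch χ)) - inner ℂ (ap B (sch φ)) (ham V χ))

/-- `c` is the value at `u ∈ X` of the extension by continuity, in the norm of `X`, of the
function `q` on the Schwartz space. -/
def ExtendsTo {n : ℕ} (q : 𝓢(Rn n, ℂ) → ℂ) (u : L2 n) (c : ℂ) : Prop :=
  Tendsto q (comap (fun φ => xNorm (sch φ - u)) (𝓝 0)) (𝓝 c)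

/-- `B` is an adaptor for `V`: a symmetric operator on `L²`, defined at least on
`X = H¹ ∩ ⟨x⟩⁻¹L²`, with `i[-Δ + V, B] = -[4 x·∇V + 4 V]₊` in the sense of sesquilinear forms
on `𝓢 × 𝓢`. -/
structure IsAdaptor {n : ℕ} (V : Rn n → ℝ) (B : L2 n →ₗ.[ℂ] L2 n) : Prop where
  symmetric : B.IsFormalAdjoint B
  domain : X n ≤ B.domain
  commutator : ∀ φ χ : 𝓢(Rn n, ℂ),
    commHam V B φ χ = -inner ℂ (sch φ) (ap (mulOp (plus (virial V))) (sch χ))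

/-- `⟨u, [ |x - 2pt|²/t + 4t(V + W) + B ] u⟩`. -/
def observable {n : ℕ} (V : Rn n → ℝ) (W : ℝ → Rn n → ℝ) (B : L2 n →ₗ.[ℂ] L2 n)
    (t : ℝ) (u : L2 n) : ℂ :=
  (conformal t u : ℂ) / t + 4 * t * expect (mulOp (V + W t)) u + expect B u

/-- The function `4 x·∇ₓW + 4 W + 4 t ∂ₜW` at time `t`. -/
def wTerm {n : ℕ} (W : ℝ → Rn n → ℝ) (t : ℝ) (x : Rn n) : ℝ :=
  4 * xGrad (W t) x + 4 * W t x + 4 * t * dt W t x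

end AdaptedConformal

end

open MeasureTheory Filter Topology Set
open scoped SchwartzMap LineDeriv Laplacian ENNReal ComplexConjugate

noncomputable section

namespace AdaptedConformal

open scoped FourierTransform

variable {n : ℕ}

/-! Formally this is a Heisenberg computation. The free flow carries `x` to `x - 2tp`, that is `C(t)
= e^{itΔ}|x|²e^{-itΔ}`, so the free part of the evolution does not change `⟨C(t)⟩`; only `i[V+W, C]
= t i[V+W, -4A] - 4t² i[-Δ, V+W]` remains. After division by `t` the kinetic commutator is cancelled
by the derivative of `4t⟨V+W⟩`. The virial identity `i[f, -4A] = 4 x·∇f` then produces `4x·∇V + 4V`,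
whose positive part is removed by the commutator of the adaptor.

The work lies in justifying this for data that are only in `X`, with `∇ₓW` bounded but not assumed
continuous in time. `X` is realised as the closed graph `XGraph` of triples `(u, xu, pu)`, in which
Schwartz functions are dense (`denseRange_schX`). In the interaction picture `v(t) = e^{-itΔ}ψ(t)`
the equation becomes `v' = -i e^{-itΔ}(V+W)e^{itΔ}v`, whose generator is bounded on `L²` and on `X`.
As it need not be continuous in time on `X`, no evolution is constructed there. Instead a Gronwall
estimate for the `K`-functional of `(X, L²)`, uniform in its parameter, keeps `v` in `X`
(`exists_fstX_of_hasDerivAt`), and a mean value inequality makes `v` locally Lipschitz with values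
in `X` (`Evolves.exists_lift`).

The conformal energy equals `∑ⱼ‖xⱼ v‖²`, and the squared norm of a Lipschitz, weakly differentiable
curve is differentiable (`hasDerivAt_inner_self_of_lipschitz`). The other terms come from
`hasDerivAt_form`, which differentiates `⟨ψ, Aψ⟩` for a symmetric `A` bounded from `X` to `L²` whose
commutator with `-Δ` extends continuously from Schwartz functions to `X`. For `B`, boundedness is
the closed graph theorem (`symX`), and the continuous extension is what the adaptor equation
supplies. -/

/-! ### Multiplication by bounded complex functions -/

/-- A measurable bounded complex function. -/
structure BddMeas (m : Rn n → ℂ) : Prop where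
  meas : AEStronglyMeasurable m (volume : Measure (Rn n))
  bdd : ∃ C : ℝ, ∀ x, ‖m x‖ ≤ C

theorem BddMeas.memLp {m : Rn n → ℂ} (hm : BddMeas m) (u : L2 n) :
    MemLp (fun x => m x * u x) 2 volume := by
  obtain ⟨C, hC⟩ := hm.bdd
  refine (Lp.memLp u).of_le_mul (c := C) (hm.meas.mul (Lp.aestronglyMeasurable u)) ?_
  filter_upwards with x
  rw [norm_mul]
  exact mul_le_mul_of_nonneg_right (hC x) (norm_nonneg _)

theorem norm_le_of_ae {u v : L2 n} {C : ℝ} (h : ∀ᵐ x, ‖u x‖ ≤ C * ‖v x‖) : ‖u‖ ≤ C * ‖v‖ :=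
  Lp.norm_le_mul_norm_of_ae_le_mul h

theorem norm_toLp_le {m : Rn n → ℂ} {C : ℝ} (u : L2 n) (h : MemLp (fun x => m x * u x) 2 volume)
    (hC : ∀ x, ‖m x‖ ≤ C) : ‖h.toLp‖ ≤ C * ‖u‖ := by
  refine norm_le_of_ae ?_
  filter_upwards [h.coeFn_toLp] with x hx
  rw [hx, norm_mul]
  exact mul_le_mul_of_nonneg_right (hC x) (norm_nonneg _)

open Classical in
/-- Multiplication by a bounded measurable function (`0` for other functions). -/
def mulC (m : Rn n → ℂ) : L2 n →L[ℂ] L2 n :=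
  if hm : BddMeas m then
    LinearMap.mkContinuousOfExistsBound
      { toFun := fun u => (hm.memLp u).toLp
        map_add' := by
          intro u v
          rw [← MemLp.toLp_add, MemLp.toLp_eq_toLp_iff]
          filter_upwards [Lp.coeFn_add u v] with x hx
          rw [hx, Pi.add_apply, Pi.add_apply, mul_add]
        map_smul' := by
          intro c u
          rw [RingHom.id_apply, ← MemLp.toLp_const_smul, MemLp.toLp_eq_toLp_iff]
          filter_upwards [Lp.coeFn_smul c u] with x hx
          rw [hx, Pi.smul_apply, Pi.smul_apply, smul_eq_mul, smul_eq_mul]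
          ring }
      (by
        obtain ⟨C, hC⟩ := hm.bdd
        exact ⟨C, fun u => norm_toLp_le u (hm.memLp u) hC⟩)
  else 0

theorem coeFn_mulC {m : Rn n → ℂ} (hm : BddMeas m) (u : L2 n) :
    ∀ᵐ x, mulC m u x = m x * u x := by
  have : mulC m u = (hm.memLp u).toLp := by
    rw [mulC, dif_pos hm]; rfl
  rw [this]
  exact (hm.memLp u).coeFn_toLp

theorem norm_mulC_le {m : Rn n → ℂ} (hm : BddMeas m) {C : ℝ} (hC : ∀ x, ‖m x‖ ≤ C) (u : L2 n) :
    ‖mulC m u‖ ≤ C * ‖u‖ := by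
  refine norm_le_of_ae ?_
  filter_upwards [coeFn_mulC hm u] with x hx
  rw [hx, norm_mul]
  exact mul_le_mul_of_nonneg_right (hC x) (norm_nonneg _)

theorem BddMeas.mul {m m' : Rn n → ℂ} (hm : BddMeas m) (hm' : BddMeas m') :
    BddMeas (fun x => m x * m' x) := by
  obtain ⟨C, hC⟩ := hm.bdd
  obtain ⟨C', hC'⟩ := hm'.bdd
  refine ⟨hm.meas.mul hm'.meas, C * C', fun x => ?_⟩
  rw [norm_mul]
  exact mul_le_mul (hC x) (hC' x) (norm_nonneg _) ((norm_nonneg _).trans (hC x))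

theorem BddMeas.add {m m' : Rn n → ℂ} (hm : BddMeas m) (hm' : BddMeas m') :
    BddMeas (fun x => m x + m' x) := by
  obtain ⟨C, hC⟩ := hm.bdd
  obtain ⟨C', hC'⟩ := hm'.bdd
  exact ⟨hm.meas.add hm'.meas, C + C', fun x =>
    (norm_add_le _ _).trans (add_le_add (hC x) (hC' x))⟩

theorem BddMeas.conj {m : Rn n → ℂ} (hm : BddMeas m) : BddMeas (fun x => conj (m x)) := by
  obtain ⟨C, hC⟩ := hm.bdd
  exact ⟨hm.meas.star, C, fun x => by rw [RCLike.norm_conj]; exact hC x⟩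

theorem L2_ext {u v : L2 n} (h : ∀ᵐ x, u x = v x) : u = v := Lp.ext h

theorem mulC_mulC {m m' : Rn n → ℂ} (hm : BddMeas m) (hm' : BddMeas m') (u : L2 n) :
    mulC m (mulC m' u) = mulC (fun x => m x * m' x) u := by
  refine L2_ext ?_
  filter_upwards [coeFn_mulC hm (mulC m' u), coeFn_mulC hm' u, coeFn_mulC (hm.mul hm') u]
    with x h1 h2 h3
  rw [h1, h2, h3, mul_assoc]

theorem mulC_add {m m' : Rn n → ℂ} (hm : BddMeas m) (hm' : BddMeas m') (u : L2 n) :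
    mulC (fun x => m x + m' x) u = mulC m u + mulC m' u := by
  refine L2_ext ?_
  filter_upwards [coeFn_mulC (hm.add hm') u, coeFn_mulC hm u, coeFn_mulC hm' u,
    Lp.coeFn_add (mulC m u) (mulC m' u)] with x h1 h2 h3 h4
  rw [h4, Pi.add_apply, h1, h2, h3, add_mul]

theorem inner_eq_integral (u v : L2 n) : inner ℂ u v = ∫ x, conj (u x) * v x := by
  rw [L2.inner_def]
  refine integral_congr_ae ?_
  filter_upwards with x
  rw [RCLike.inner_apply, mul_comm]

theorem inner_mulC_right {m : Rn n → ℂ} (hm : BddMeas m) (u v : L2 n) :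
    inner ℂ u (mulC m v) = inner ℂ (mulC (fun x => conj (m x)) u) v := by
  rw [inner_eq_integral, inner_eq_integral]
  refine integral_congr_ae ?_
  filter_upwards [coeFn_mulC hm v, coeFn_mulC hm.conj u] with x h1 h2
  rw [h1, h2, map_mul, Complex.conj_conj]
  ring

/-! ### Schwartz functions and their weak pairings -/

theorem coeFn_sch (φ : 𝓢(Rn n, ℂ)) : ∀ᵐ x, sch φ x = φ x := φ.coeFn_toLp 2 volume

theorem denseRange_sch : DenseRange (sch (n := n)) :=
  SchwartzMap.denseRange_toLpCLM (F := ℂ) (μ := (volume : Measure (Rn n))) ENNReal.ofNat_ne_top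

theorem sch_add (φ χ : 𝓢(Rn n, ℂ)) : sch (φ + χ) = sch φ + sch χ := rfl

theorem sch_smul (c : ℂ) (φ : 𝓢(Rn n, ℂ)) : sch (c • φ) = c • sch φ := rfl

theorem sch_sum {ι : Type*} (s : Finset ι) (φ : ι → 𝓢(Rn n, ℂ)) :
    sch (∑ i ∈ s, φ i) = ∑ i ∈ s, sch (φ i) :=
  map_sum (SchwartzMap.toLpCLM ℂ ℂ 2 (volume : Measure (Rn n))) φ s

theorem inner_sch_sch (φ χ : 𝓢(Rn n, ℂ)) :
    inner ℂ (sch φ) (sch χ) = ∫ x, conj (φ x) * χ x := by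
  rw [inner_eq_integral]
  refine integral_congr_ae ?_
  filter_upwards [coeFn_sch φ, coeFn_sch χ] with x h1 h2
  rw [h1, h2]

theorem mulC_sch {m : Rn n → ℂ} (hm : BddMeas m) (ht : m.HasTemperateGrowth) (φ : 𝓢(Rn n, ℂ)) :
    mulC m (sch φ) = sch (SchwartzMap.smulLeftCLM ℂ m φ) := by
  refine L2_ext ?_
  filter_upwards [coeFn_mulC hm (sch φ), coeFn_sch φ,
    coeFn_sch (SchwartzMap.smulLeftCLM ℂ m φ)] with x h1 h2 h3
  rw [h1, h2, h3, SchwartzMap.smulLeftCLM_apply_apply ht, smul_eq_mul]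

theorem eq_of_inner_sch {a b : L2 n} (h : ∀ φ : 𝓢(Rn n, ℂ), inner ℂ (sch φ) a = inner ℂ (sch φ) b) :
    a = b := by
  refine ext_inner_left ℂ fun v => ?_
  refine denseRange_sch.induction_on (p := fun v => inner ℂ v a = inner ℂ v b) v ?_ h
  exact isClosed_eq (by fun_prop) (by fun_prop)

/-- By density the bound may be tested on `a` itself. -/
theorem norm_le_of_inner_sch {a : L2 n} {R : ℝ} (hR : 0 ≤ R)
    (h : ∀ φ : 𝓢(Rn n, ℂ), ‖inner ℂ (sch φ) a‖ ≤ R * ‖sch φ‖) : ‖a‖ ≤ R := by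
  have h1 : ‖inner ℂ a a‖ ≤ R * ‖a‖ :=
    denseRange_sch.induction_on (p := fun v => ‖inner ℂ v a‖ ≤ R * ‖v‖) a
      (isClosed_le (by fun_prop) (by fun_prop)) h
  rw [inner_self_eq_norm_sq_to_K] at h1
  simp only [norm_pow, RCLike.norm_ofReal, abs_norm] at h1
  by_contra hlt
  push Not at hlt
  nlinarith

/-- `a = T⁺ u` in the weak sense, tested against Schwartz functions. -/
def WeakOp (T : 𝓢(Rn n, ℂ) →L[ℂ] 𝓢(Rn n, ℂ)) (u a : L2 n) : Prop :=
  ∀ φ, inner ℂ (sch φ) a = inner ℂ (sch (T φ)) u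

section WeakOp

variable {T : 𝓢(Rn n, ℂ) →L[ℂ] 𝓢(Rn n, ℂ)} {u v a b : L2 n}

theorem WeakOp.unique (ha : WeakOp T u a) (hb : WeakOp T u b) : a = b :=
  eq_of_inner_sch fun φ => (ha φ).trans (hb φ).symm

theorem WeakOp.zero : WeakOp T (0 : L2 n) 0 := fun φ => by simp only [inner_zero_right]

theorem WeakOp.add (ha : WeakOp T u a) (hb : WeakOp T v b) : WeakOp T (u + v) (a + b) :=
  fun φ => by rw [inner_add_right, inner_add_right, ha, hb]

theorem WeakOp.smul (c : ℂ) (ha : WeakOp T u a) : WeakOp T (c • u) (c • a) :=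
  fun φ => by rw [inner_smul_right, inner_smul_right, ha]

/-- Closedness carries weak operator identities from Schwartz functions to limits in the graph norm.
-/
theorem isClosed_weakOp (T : 𝓢(Rn n, ℂ) →L[ℂ] 𝓢(Rn n, ℂ)) :
    IsClosed {z : L2 n × L2 n | WeakOp T z.1 z.2} := by
  have : {z : L2 n × L2 n | WeakOp T z.1 z.2} =
      ⋂ φ, {z | inner ℂ (sch φ) z.2 = inner ℂ (sch (T φ)) z.1} := by
    ext z; simp [WeakOp]
  rw [this]
  exact isClosed_iInter fun φ => isClosed_eq (by fun_prop) (by fun_prop)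

/-- Riesz representation: a bound on the weak pairing gives an element of `L²`. -/
theorem exists_weakOp {R : ℝ} (hR : 0 ≤ R)
    (h : ∀ φ, ‖inner ℂ (sch (T φ)) u‖ ≤ R * ‖sch φ‖) : ∃ a, WeakOp T u a ∧ ‖a‖ ≤ R := by
  let ℓ : 𝓢(Rn n, ℂ) →ₗ[ℂ] ℂ :=
    ((innerSL ℂ u) ∘L (SchwartzMap.toLpCLM ℂ ℂ 2 (volume : Measure (Rn n))) ∘L T).toLinearMap
  let e : 𝓢(Rn n, ℂ) →ₗ[ℂ] L2 n := (SchwartzMap.toLpCLM ℂ ℂ 2 (volume : Measure (Rn n))).toLinearMap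
  have hℓ : ∀ φ, ℓ φ = inner ℂ u (sch (T φ)) := fun φ => rfl
  have hb : ∀ φ, ‖ℓ φ‖ ≤ R * ‖e φ‖ := fun φ => by
    rw [hℓ, norm_inner_symm]; exact h φ
  have hd : DenseRange e := denseRange_sch
  let f : L2 n →L[ℂ] ℂ := ℓ.extendOfNorm e
  refine ⟨(InnerProductSpace.toDual ℂ (L2 n)).symm f, ?_, ?_⟩
  · intro φ
    rw [← inner_conj_symm, InnerProductSpace.toDual_symm_apply]
    have : f (sch φ) = ℓ φ := LinearMap.extendOfNorm_eq hd ⟨R, hb⟩ φ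
    rw [this, hℓ, inner_conj_symm]
  · rw [LinearIsometryEquiv.norm_map]
    exact LinearMap.opNorm_extendOfNorm_le hd hR hb

end WeakOp

/-! ### Position and momentum on the Schwartz space -/

/-- The `j`-th coordinate direction. -/
abbrev dir (j : Fin n) : Rn n := EuclideanSpace.single j (1 : ℝ)

/-- Multiplication by `xⱼ` on the Schwartz space. -/
def Xop (j : Fin n) : 𝓢(Rn n, ℂ) →L[ℂ] 𝓢(Rn n, ℂ) :=
  SchwartzMap.smulLeftCLM ℂ (fun x : Rn n => ((x j : ℝ) : ℂ))

/-- The operator `-i ∂ⱼ` on the Schwartz space. -/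
def Pop (j : Fin n) : 𝓢(Rn n, ℂ) →L[ℂ] 𝓢(Rn n, ℂ) :=
  (-Complex.I) • LineDeriv.lineDerivOpCLM ℂ 𝓢(Rn n, ℂ) (dir j)

theorem inner_dir (x : Rn n) (j : Fin n) : inner ℝ x (dir j) = x j := by
  simp [dir, EuclideanSpace.inner_single_right]

theorem temperate_coord (j : Fin n) : (fun x : Rn n => ((x j : ℝ) : ℂ)).HasTemperateGrowth := by
  have : (fun x : Rn n => ((x j : ℝ) : ℂ)) = fun x => ((inner ℝ x (dir j) : ℝ) : ℂ) := by
    ext x; rw [inner_dir]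
  rw [this]
  fun_prop

theorem Xop_apply (j : Fin n) (φ : 𝓢(Rn n, ℂ)) (x : Rn n) : Xop j φ x = (x j : ℂ) * φ x := by
  rw [Xop, SchwartzMap.smulLeftCLM_apply_apply (temperate_coord j), smul_eq_mul]

theorem Pop_eq (j : Fin n) (φ : 𝓢(Rn n, ℂ)) : Pop j φ = (-Complex.I) • ∂_{dir j} φ := rfl

theorem Pop_apply (j : Fin n) (φ : 𝓢(Rn n, ℂ)) (x : Rn n) :
    Pop j φ x = -Complex.I * fderiv ℝ φ x (dir j) := rfl

theorem weakOp_Xop_sch (j : Fin n) (φ : 𝓢(Rn n, ℂ)) : WeakOp (Xop j) (sch φ) (sch (Xop j φ)) := by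
  intro χ
  rw [inner_sch_sch, inner_sch_sch]
  refine integral_congr_ae (Eventually.of_forall fun x => ?_)
  simp only [Xop_apply, map_mul, Complex.conj_ofReal]
  ring

theorem weakOp_Pop_sch (j : Fin n) (φ : 𝓢(Rn n, ℂ)) : WeakOp (Pop j) (sch φ) (sch (Pop j φ)) := by
  intro χ
  rw [inner_sch_sch, inner_sch_sch]
  have h := SchwartzMap.integral_bilinear_lineDerivOp_right_eq_neg_left χ φ
    ((ContinuousLinearMap.mul ℝ ℂ).comp (Complex.conjCLE : ℂ →L[ℝ] ℂ)) (dir j) (μ := volume)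
  simp only [ContinuousLinearMap.comp_apply, ContinuousLinearMap.mul_apply',
    ContinuousLinearEquiv.coe_coe, Complex.conjCLE_apply,
    SchwartzMap.lineDerivOp_apply_eq_fderiv] at h
  simp only [Pop_apply, map_mul, map_neg, Complex.conj_I, neg_neg]
  calc ∫ x, conj (χ x) * (-Complex.I * fderiv ℝ φ x (dir j))
      = -Complex.I * ∫ x, conj (χ x) * fderiv ℝ φ x (dir j) := by
        rw [← integral_const_mul]; congr 1; ext x; ring
    _ = Complex.I * ∫ x, conj (fderiv ℝ χ x (dir j)) * φ x := by rw [h]; ring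
    _ = _ := by rw [← integral_const_mul]; congr 1; ext x; ring

/-! ### The space `X` as a graph -/

/-- The triples `(u, (xⱼ u)ⱼ, (pⱼ u)ⱼ)`, the graph norm being equivalent to the norm of `X`. -/
def XGraph (n : ℕ) : Submodule ℂ (L2 n × (Fin n → L2 n) × (Fin n → L2 n)) where
  carrier := {z | ∀ j, WeakOp (Xop j) z.1 (z.2.1 j) ∧ WeakOp (Pop j) z.1 (z.2.2 j)}
  add_mem' := fun hz hw j => ⟨(hz j).1.add (hw j).1, (hz j).2.add (hw j).2⟩
  zero_mem' := fun _ => ⟨WeakOp.zero, WeakOp.zero⟩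
  smul_mem' := fun c _ hz j => ⟨(hz j).1.smul c, (hz j).2.smul c⟩

theorem isClosed_XGraph : IsClosed (XGraph n : Set (L2 n × (Fin n → L2 n) × (Fin n → L2 n))) := by
  have : (XGraph n : Set (L2 n × (Fin n → L2 n) × (Fin n → L2 n))) =
      ⋂ j, ({z | WeakOp (Xop j) z.1 (z.2.1 j)} ∩ {z | WeakOp (Pop j) z.1 (z.2.2 j)}) := by
    ext z; simp [XGraph]
  rw [this]
  refine isClosed_iInter fun j => IsClosed.inter ?_ ?_
  · exact (isClosed_weakOp (Xop j)).preimage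
      (f := fun z : L2 n × (Fin n → L2 n) × (Fin n → L2 n) => (z.1, z.2.1 j)) (by fun_prop)
  · exact (isClosed_weakOp (Pop j)).preimage
      (f := fun z : L2 n × (Fin n → L2 n) × (Fin n → L2 n) => (z.1, z.2.2 j)) (by fun_prop)

instance : CompleteSpace (XGraph n) := isClosed_XGraph.completeSpace_coe

/-- The element `u` of `L²` underlying a triple. -/
def fstX : XGraph n →L[ℂ] L2 n := (ContinuousLinearMap.fst ℂ _ _) ∘L (XGraph n).subtypeL

/-- The component `xⱼ u`. -/
def posX (j : Fin n) : XGraph n →L[ℂ] L2 n :=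
  ContinuousLinearMap.proj j ∘L (ContinuousLinearMap.fst ℂ _ _) ∘L
    (ContinuousLinearMap.snd ℂ _ _) ∘L (XGraph n).subtypeL

/-- The component `pⱼ u`. -/
def momX (j : Fin n) : XGraph n →L[ℂ] L2 n :=
  ContinuousLinearMap.proj j ∘L (ContinuousLinearMap.snd ℂ _ _) ∘L
    (ContinuousLinearMap.snd ℂ _ _) ∘L (XGraph n).subtypeL

theorem weak_posX (z : XGraph n) (j : Fin n) : WeakOp (Xop j) (fstX z) (posX j z) := (z.2 j).1

theorem weak_momX (z : XGraph n) (j : Fin n) : WeakOp (Pop j) (fstX z) (momX j z) := (z.2 j).2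

/-- Weak components are unique, so equalities in `XGraph n` need only be checked on the first
component. -/
theorem fstX_injective : Function.Injective (fstX (n := n)) := by
  intro z w h
  refine Subtype.ext (Prod.ext h (Prod.ext (funext fun j => ?_) (funext fun j => ?_)))
  · exact (weak_posX z j).unique (h ▸ weak_posX w j)
  · exact (weak_momX z j).unique (h ▸ weak_momX w j)

theorem normX_le {z : XGraph n} {R : ℝ} (hR : 0 ≤ R) (h : ‖fstX z‖ ≤ R) (hp : ∀ j, ‖posX j z‖ ≤ R)
    (hm : ∀ j, ‖momX j z‖ ≤ R) : ‖z‖ ≤ R :=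
  max_le h (max_le ((pi_norm_le_iff_of_nonneg hR).mpr hp) ((pi_norm_le_iff_of_nonneg hR).mpr hm))

theorem norm_fstX_le (z : XGraph n) : ‖fstX z‖ ≤ ‖z‖ := le_max_left _ _

theorem norm_posX_le (z : XGraph n) (j : Fin n) : ‖posX j z‖ ≤ ‖z‖ :=
  (norm_le_pi_norm _ j).trans ((le_max_left _ _).trans (le_max_right _ _))

theorem norm_momX_le (z : XGraph n) (j : Fin n) : ‖momX j z‖ ≤ ‖z‖ :=
  (norm_le_pi_norm _ j).trans ((le_max_right _ _).trans (le_max_right _ _))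

/-- The triple of an element of `L²` with weak position and momentum components. -/
def mkX (u : L2 n) (a b : Fin n → L2 n) (ha : ∀ j, WeakOp (Xop j) u (a j))
    (hb : ∀ j, WeakOp (Pop j) u (b j)) : XGraph n := ⟨(u, a, b), fun j => ⟨ha j, hb j⟩⟩

/-- The triple of a Schwartz function. -/
def schX (φ : 𝓢(Rn n, ℂ)) : XGraph n :=
  mkX (sch φ) (fun j => sch (Xop j φ)) (fun j => sch (Pop j φ)) (fun j => weakOp_Xop_sch j φ)
    (fun j => weakOp_Pop_sch j φ)

@[simp] theorem fstX_schX (φ : 𝓢(Rn n, ℂ)) : fstX (schX φ) = sch φ := rfl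

@[simp] theorem posX_schX (φ : 𝓢(Rn n, ℂ)) (j : Fin n) : posX j (schX φ) = sch (Xop j φ) := rfl

/-- A bounded linear map into `X`, given by its components. -/
def liftX {E : Type*} [NormedAddCommGroup E] [NormedSpace ℂ E] (f : E →L[ℂ] L2 n)
    (g h : Fin n → E →L[ℂ] L2 n) (hg : ∀ j z, WeakOp (Xop j) (f z) (g j z))
    (hh : ∀ j z, WeakOp (Pop j) (f z) (h j z)) : E →L[ℂ] XGraph n :=
  (f.prod ((ContinuousLinearMap.pi g).prod (ContinuousLinearMap.pi h))).codRestrict (XGraph n)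
    fun z j => ⟨hg j z, hh j z⟩

theorem tendsto_XGraph {α : Type*} {l : Filter α} {f : α → XGraph n} {z : XGraph n}
    (h : Tendsto (fun a => fstX (f a)) l (𝓝 (fstX z)))
    (hp : ∀ j, Tendsto (fun a => posX j (f a)) l (𝓝 (posX j z)))
    (hm : ∀ j, Tendsto (fun a => momX j (f a)) l (𝓝 (momX j z))) : Tendsto f l (𝓝 z) := by
  rw [tendsto_subtype_rng]
  exact h.prodMk_nhds ((tendsto_pi_nhds.mpr hp).prodMk_nhds (tendsto_pi_nhds.mpr hm))

/-! ### Multipliers acting on weak positions and momenta -/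

theorem temperate_conj {m : Rn n → ℂ} (ht : m.HasTemperateGrowth) :
    (fun x => conj (m x)).HasTemperateGrowth :=
  ((Complex.conjCLE : ℂ →L[ℝ] ℂ).hasTemperateGrowth).comp ht

theorem temperate_conj_mulI {m : Rn n → ℂ} (ht : m.HasTemperateGrowth) :
    (fun x => conj (-Complex.I * m x)).HasTemperateGrowth :=
  temperate_conj ((Function.HasTemperateGrowth.const (-Complex.I)).mul ht)

theorem weakOp_smulLeft_mulC {m : Rn n → ℂ} (hm : BddMeas m) (ht : m.HasTemperateGrowth)
    (u : L2 n) : WeakOp (SchwartzMap.smulLeftCLM ℂ fun x => conj (m x)) u (mulC m u) := by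
  intro φ
  rw [inner_mulC_right hm, mulC_sch hm.conj (temperate_conj ht)]

/-- The Leibniz rule, carried out on the test function. The term `-i m' u` is supplied as a weak
product `c` because `m'` may be unbounded, as it is for the free phase. -/
theorem WeakOp.mulC_mom {m m' : Rn n → ℂ} {j : Fin n} {u b c : L2 n} (hm : BddMeas m)
    (ht : m.HasTemperateGrowth) (ht' : m'.HasTemperateGrowth)
    (hd : ∀ x, fderiv ℝ m x (dir j) = m' x) (hb : WeakOp (Pop j) u b)
    (hc : WeakOp (SchwartzMap.smulLeftCLM ℂ fun x => conj (-Complex.I * m' x)) u c) :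
    WeakOp (Pop j) (mulC m u) (mulC m b + c) := by
  intro φ
  have key : SchwartzMap.smulLeftCLM ℂ (fun x => conj (m x)) (Pop j φ) =
      Pop j (SchwartzMap.smulLeftCLM ℂ (fun x => conj (m x)) φ) +
        SchwartzMap.smulLeftCLM ℂ (fun x => conj (-Complex.I * m' x)) φ := by
    ext x
    have h1 : HasFDerivAt (fun y => conj (m y))
        ((Complex.conjCLE : ℂ →L[ℝ] ℂ) ∘L fderiv ℝ m x) x :=
      (Complex.conjCLE : ℂ →L[ℝ] ℂ).hasFDerivAt.comp x
        ((ht.1.differentiable (by simp)) x).hasFDerivAt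
    have h2 := h1.mul (φ.hasFDerivAt x)
    have h3 : (SchwartzMap.smulLeftCLM ℂ (fun x => conj (m x)) φ : Rn n → ℂ) =
        fun y => conj (m y) * φ y := SchwartzMap.smulLeftCLM_apply (temperate_conj ht) φ
    rw [SchwartzMap.smulLeftCLM_apply_apply (temperate_conj ht), add_apply,
      SchwartzMap.smulLeftCLM_apply_apply (temperate_conj_mulI ht'), Pop_apply, Pop_apply, h3,
      (show HasFDerivAt (fun y => conj (m y) * φ y) _ x from h2).fderiv]
    simp [hd]
    ring
  rw [inner_mulC_right hm, mulC_sch hm.conj (temperate_conj ht), key, sch_add, inner_add_left,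
    ← hb, ← hc, ← mulC_sch hm.conj (temperate_conj ht), ← inner_mulC_right hm, inner_add_right]

theorem WeakOp.mulC_pos {m : Rn n → ℂ} {j : Fin n} {u a : L2 n} (hm : BddMeas m)
    (ht : m.HasTemperateGrowth) (ha : WeakOp (Xop j) u a) :
    WeakOp (Xop j) (mulC m u) (mulC m a) := by
  intro φ
  rw [inner_mulC_right hm, mulC_sch hm.conj (temperate_conj ht), ha, inner_mulC_right hm,
    mulC_sch hm.conj (temperate_conj ht)]
  congr 2
  ext x
  rw [Xop_apply, SchwartzMap.smulLeftCLM_apply_apply (temperate_conj ht),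
    SchwartzMap.smulLeftCLM_apply_apply (temperate_conj ht), Xop_apply, smul_eq_mul, smul_eq_mul]
  ring

/-- `xⱼ u` as an almost everywhere product. -/
theorem weakOp_Xop_of_ae {j : Fin n} {u a : L2 n} (h : ∀ᵐ x, a x = (x j : ℂ) * u x) :
    WeakOp (Xop j) u a := by
  intro φ
  rw [inner_eq_integral, inner_eq_integral]
  refine integral_congr_ae ?_
  filter_upwards [h, coeFn_sch φ, coeFn_sch (Xop j φ)] with x h1 h2 h3
  rw [h1, h2, h3, Xop_apply, map_mul, Complex.conj_ofReal]
  ring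

theorem weakOp_Xop_mulC {m : Rn n → ℂ} {j : Fin n} (hm : BddMeas m)
    (hxm : BddMeas fun x => (x j : ℂ) * m x) (u : L2 n) :
    WeakOp (Xop j) (mulC m u) (mulC (fun x => (x j : ℂ) * m x) u) := by
  refine weakOp_Xop_of_ae ?_
  filter_upwards [coeFn_mulC hm u, coeFn_mulC hxm u] with x h1 h2
  rw [h1, h2, mul_assoc]

/-! ### The Fourier transform -/

/-- The Fourier transform on `L²(ℝⁿ)`. -/
abbrev FL : L2 n ≃ₗᵢ[ℂ] L2 n := Lp.fourierTransformₗᵢ (Rn n) ℂ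

theorem FL_sch (φ : 𝓢(Rn n, ℂ)) : FL (sch φ) = sch (𝓕 φ) := SchwartzMap.toLp_fourier_eq φ

theorem FL_symm_sch (φ : 𝓢(Rn n, ℂ)) : FL.symm (sch φ) = sch (𝓕⁻ φ) :=
  SchwartzMap.toLp_fourierInv_eq φ

theorem Xop_eq (j : Fin n) (φ : 𝓢(Rn n, ℂ)) :
    Xop j φ = SchwartzMap.smulLeftCLM ℂ (inner ℝ · (dir j)) φ := by
  ext x
  rw [Xop_apply, SchwartzMap.smulLeftCLM_apply_apply (by fun_prop), inner_dir]
  rfl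

theorem fourier_Pop (j : Fin n) (φ : 𝓢(Rn n, ℂ)) :
    𝓕 (Pop j φ) = ((2 * Real.pi : ℝ) : ℂ) • Xop j (𝓕 φ) := by
  rw [Pop_eq, FourierTransform.fourier_smul, SchwartzMap.fourier_lineDerivOp_eq, ← Xop_eq, smul_smul]
  congr 1
  push_cast
  linear_combination (-2 * (Real.pi : ℂ)) * Complex.I_mul_I

theorem fourier_Xop (j : Fin n) (φ : 𝓢(Rn n, ℂ)) :
    ((-(2 * Real.pi) : ℝ) : ℂ) • 𝓕 (Xop j φ) = Pop j (𝓕 φ) := by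
  rw [Pop_eq, SchwartzMap.lineDerivOp_fourier_eq, ← Xop_eq, FourierTransform.fourier_smul, smul_smul]
  congr 1
  push_cast
  linear_combination (-2 * (Real.pi : ℂ)) * Complex.I_mul_I

theorem two_pi_ne : ((2 * Real.pi : ℝ) : ℂ) ≠ 0 := by
  exact_mod_cast Real.two_pi_pos.ne'

theorem neg_two_pi_ne : ((-(2 * Real.pi) : ℝ) : ℂ) ≠ 0 := by
  exact_mod_cast neg_ne_zero.mpr Real.two_pi_pos.ne'

/-- Plancherel moves both pairings to the Fourier side, and every Schwartz function is a Fourier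
transform. -/
theorem weakOp_transfer {T T' : 𝓢(Rn n, ℂ) →L[ℂ] 𝓢(Rn n, ℂ)} {c : ℝ}
    (h : ∀ φ, 𝓕 (T φ) = (c : ℂ) • T' (𝓕 φ)) {u a b : L2 n}
    (hab : FL b = (c : ℂ) • a) (hc : (c : ℂ) ≠ 0) :
    WeakOp T u b ↔ WeakOp T' (FL u) a := by
  have key : ∀ φ, inner ℂ (sch (T φ)) u = (c : ℂ) * inner ℂ (sch (T' (𝓕 φ))) (FL u) := fun φ => by
    rw [← FL.inner_map_map, FL_sch, h, sch_smul, inner_smul_left, Complex.conj_ofReal]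
  have key2 : ∀ φ, inner ℂ (sch φ) b = (c : ℂ) * inner ℂ (sch (𝓕 φ)) a := fun φ => by
    rw [← FL.inner_map_map, FL_sch, hab, inner_smul_right]
  constructor
  · intro hb φ
    have h1 := hb (𝓕⁻ φ)
    rw [key, key2, FourierTransform.fourier_fourierInv_eq] at h1
    exact mul_left_cancel₀ hc h1
  · intro ha φ
    rw [key, key2, ha]

theorem weakOp_Pop_iff {j : Fin n} {u b : L2 n} :
    WeakOp (Pop j) u b ↔ WeakOp (Xop j) (FL u) ((((2 * Real.pi : ℝ) : ℂ))⁻¹ • FL b) :=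
  weakOp_transfer (fourier_Pop j) (by rw [smul_smul, mul_inv_cancel₀ two_pi_ne, one_smul]) two_pi_ne

theorem weakOp_Xop_iff {j : Fin n} {u a : L2 n} :
    WeakOp (Xop j) u a ↔ WeakOp (Pop j) (FL u) (((-(2 * Real.pi) : ℝ) : ℂ) • FL a) := by
  -- `fourier_Xop` carries its factor `-2π` on the side of `Xop`, hence the inverse.
  refine weakOp_transfer (c := (-(2 * Real.pi))⁻¹) (fun φ => ?_) ?_ ?_
  · rw [← fourier_Xop, smul_smul, Complex.ofReal_inv, inv_mul_cancel₀ neg_two_pi_ne, one_smul]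
  · rw [smul_smul, Complex.ofReal_inv, inv_mul_cancel₀ neg_two_pi_ne, one_smul]
  · rw [Complex.ofReal_inv]; exact inv_ne_zero neg_two_pi_ne

/-- The Fourier multiplier with bounded symbol `m`. -/
def fmul (m : Rn n → ℂ) : L2 n →L[ℂ] L2 n :=
  FL.symm.toContinuousLinearEquiv.toContinuousLinearMap ∘L mulC m ∘L
    FL.toContinuousLinearEquiv.toContinuousLinearMap

theorem fmul_apply (m : Rn n → ℂ) (u : L2 n) : fmul m u = FL.symm (mulC m (FL u)) := rfl

theorem FL_fmul (m : Rn n → ℂ) (u : L2 n) : FL (fmul m u) = mulC m (FL u) :=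
  FL.apply_symm_apply _

theorem fmul_sch {m : Rn n → ℂ} (hm : BddMeas m) (ht : m.HasTemperateGrowth) (φ : 𝓢(Rn n, ℂ)) :
    fmul m (sch φ) = sch (SchwartzMap.fourierMultiplierCLM ℂ m φ) := by
  rw [fmul_apply, FL_sch, mulC_sch hm ht, FL_symm_sch, SchwartzMap.fourierMultiplierCLM_apply]

theorem norm_fmul_le {m : Rn n → ℂ} (hm : BddMeas m) {C : ℝ} (hC : ∀ x, ‖m x‖ ≤ C) (u : L2 n) :
    ‖fmul m u‖ ≤ C * ‖u‖ := by
  rw [fmul_apply, LinearIsometryEquiv.norm_map]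
  refine (norm_mulC_le hm hC _).trans ?_
  rw [LinearIsometryEquiv.norm_map]

theorem WeakOp.fmul_mom {m : Rn n → ℂ} {j : Fin n} {u b : L2 n} (hm : BddMeas m)
    (ht : m.HasTemperateGrowth) (hb : WeakOp (Pop j) u b) :
    WeakOp (Pop j) (fmul m u) (fmul m b) := by
  rw [weakOp_Pop_iff] at hb ⊢
  rw [FL_fmul, FL_fmul, ← map_smul]
  exact hb.mulC_pos hm ht

/-- On the Fourier side `xⱼ` is a derivative, up to the factor `-2π`; this is therefore the Leibniz
rule, and `c` is the commutator of `xⱼ` with the multiplier. -/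
theorem WeakOp.fmul_pos {m m' : Rn n → ℂ} {j : Fin n} {u a c : L2 n} (hm : BddMeas m)
    (ht : m.HasTemperateGrowth) (ht' : m'.HasTemperateGrowth)
    (hd : ∀ x, fderiv ℝ m x (dir j) = m' x) (ha : WeakOp (Xop j) u a)
    (hc : WeakOp (SchwartzMap.smulLeftCLM ℂ fun x => conj (-Complex.I * m' x)) (FL u)
      (((-(2 * Real.pi) : ℝ) : ℂ) • FL c)) :
    WeakOp (Xop j) (fmul m u) (fmul m a + c) := by
  rw [weakOp_Xop_iff] at ha ⊢
  rw [map_add, FL_fmul, FL_fmul, smul_add, ← map_smul]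
  exact ha.mulC_mom hm ht ht' hd hc

theorem weakOp_Pop_fmul {m : Rn n → ℂ} {j : Fin n} (hm : BddMeas m)
    (hxm : BddMeas fun x => (x j : ℂ) * m x) (u : L2 n) :
    WeakOp (Pop j) (fmul m u)
      (((2 * Real.pi : ℝ) : ℂ) • fmul (fun x => (x j : ℂ) * m x) u) := by
  rw [weakOp_Pop_iff, map_smul, smul_smul, inv_mul_cancel₀ two_pi_ne, one_smul, FL_fmul, FL_fmul]
  exact weakOp_Xop_mulC hm hxm _

/-- Uniformly bounded operators converge strongly if they converge on Schwartz functions. -/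
theorem tendsto_of_tendsto_sch {α : Type*} {l : Filter α} {T : α → L2 n →L[ℂ] L2 n}
    {S : L2 n →L[ℂ] L2 n} {C : ℝ} (hT : ∀ᶠ a in l, ∀ u, ‖T a u‖ ≤ C * ‖u‖)
    (h : ∀ φ, Tendsto (fun a => T a (sch φ)) l (𝓝 (S (sch φ)))) (u : L2 n) :
    Tendsto (fun a => T a u) l (𝓝 (S u)) := by
  rw [Metric.tendsto_nhds]
  intro ε hε
  have hCS : 0 < |C| + ‖S‖ + 1 := by positivity
  obtain ⟨φ, hφ⟩ := denseRange_sch.exists_dist_lt u (div_pos (half_pos hε) hCS)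
  filter_upwards [hT, (Metric.tendsto_nhds.mp (h φ)) (ε / 2) (half_pos hε)] with a h1 h2
  rw [dist_eq_norm] at h2 hφ ⊢
  have e : T a u - S u = T a (u - sch φ) + (T a (sch φ) - S (sch φ)) - S (u - sch φ) := by
    rw [map_sub, map_sub]; abel
  rw [lt_div_iff₀ hCS] at hφ
  have hS := S.le_opNorm (u - sch φ)
  have hTa := h1 (u - sch φ)
  have hTa' : C * ‖u - sch φ‖ ≤ |C| * ‖u - sch φ‖ :=
    mul_le_mul_of_nonneg_right (le_abs_self C) (norm_nonneg _)
  rw [e]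
  have := norm_sub_le (T a (u - sch φ) + (T a (sch φ) - S (sch φ))) (S (u - sch φ))
  have := norm_add_le (T a (u - sch φ)) (T a (sch φ) - S (sch φ))
  nlinarith [norm_nonneg (u - sch φ)]

/-! ### Schwartz functions are dense in `X` -/

/-- The cutoff `(1 + ε²|x|²)⁻¹`. -/
def cut (ε : ℝ) (x : Rn n) : ℝ := (1 + ε ^ 2 * ‖x‖ ^ 2)⁻¹

/-- The `j`-th partial derivative of `cut ε`. -/
def cutDeriv (ε : ℝ) (j : Fin n) (x : Rn n) : ℝ := -(2 * ε ^ 2 * x j) * cut ε x ^ 2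

theorem temperate_cut (ε : ℝ) : (cut ε : Rn n → ℝ).HasTemperateGrowth := by
  have h := (Function.hasTemperateGrowth_one_add_norm_sq_rpow (Rn n) (-1)).comp
    (ε • ContinuousLinearMap.id ℝ (Rn n)).hasTemperateGrowth
  have e : (cut ε : Rn n → ℝ) = (fun x : Rn n => (1 + ‖x‖ ^ 2) ^ (-1 : ℝ)) ∘
      (ε • ContinuousLinearMap.id ℝ (Rn n)) := by
    funext x
    simp [cut, Real.rpow_neg_one, norm_smul, mul_pow]
  rw [e]
  exact h

theorem temperate_ofReal {f : Rn n → ℝ} (hf : f.HasTemperateGrowth) :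
    (fun x => (f x : ℂ)).HasTemperateGrowth := Complex.ofRealCLM.hasTemperateGrowth.comp hf

theorem temperate_real_coord (j : Fin n) : (fun x : Rn n => x j).HasTemperateGrowth := by
  have : (fun x : Rn n => x j) = fun x => inner ℝ x (dir j) := by
    ext x; rw [inner_dir]
  rw [this]
  fun_prop

theorem temperate_cutDeriv (ε : ℝ) (j : Fin n) :
    (cutDeriv ε j : Rn n → ℝ).HasTemperateGrowth := by
  have h := ((Function.HasTemperateGrowth.const (-(2 * ε ^ 2))).mul
    (temperate_real_coord j)).mul ((temperate_cut (n := n) ε).pow 2)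
  have e : (cutDeriv ε j : Rn n → ℝ) =
      (fun _ => -(2 * ε ^ 2)) * (fun x => x j) * cut ε ^ 2 := by
    funext x
    simp [cutDeriv]
  rw [e]
  exact h

theorem fderiv_ofReal_apply {f : Rn n → ℝ} {x : Rn n} (hf : DifferentiableAt ℝ f x) (v : Rn n) :
    fderiv ℝ (fun y => (f y : ℂ)) x v = (fderiv ℝ f x v : ℂ) := by
  have := (Complex.ofRealCLM.hasFDerivAt.comp x hf.hasFDerivAt).fderiv
  have h2 : fderiv ℝ (fun y => (f y : ℂ)) x = Complex.ofRealCLM ∘L fderiv ℝ f x := this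
  rw [h2]; rfl

theorem fderiv_cut (ε : ℝ) (j : Fin n) (x : Rn n) :
    fderiv ℝ (fun y : Rn n => (cut ε y : ℂ)) x (dir j) = (cutDeriv ε j x : ℂ) := by
  have hpos : (1 + ε ^ 2 * ‖x‖ ^ 2) ≠ 0 := by positivity
  have h1 : HasFDerivAt (fun y : Rn n => 1 + ε ^ 2 * ‖y‖ ^ 2) (ε ^ 2 • (2 • innerSL ℝ x)) x :=
    (((hasStrictFDerivAt_norm_sq x).hasFDerivAt).const_mul (ε ^ 2)).const_add 1
  have h2 : HasFDerivAt (cut ε : Rn n → ℝ) _ x := (hasDerivAt_inv hpos).comp_hasFDerivAt x h1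
  rw [fderiv_ofReal_apply h2.differentiableAt, h2.fderiv]
  have h3 : innerSL ℝ x (dir j) = x j := inner_dir x j
  simp only [cutDeriv, cut, smul_apply, h3, smul_eq_mul, nsmul_eq_mul]
  congr 1
  field_simp
  push_cast
  ring

theorem BddMeas.ofReal {f : Rn n → ℝ} (hf : AEStronglyMeasurable f (volume : Measure (Rn n)))
    {C : ℝ} (hC : ∀ x, |f x| ≤ C) : BddMeas (fun x => (f x : ℂ)) :=
  ⟨Complex.continuous_ofReal.comp_aestronglyMeasurable hf, C, fun x => by
    rw [Complex.norm_real]; exact hC x⟩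

theorem cut_nonneg (ε : ℝ) (x : Rn n) : 0 ≤ cut ε x := by unfold cut; positivity

theorem cut_le_one (ε : ℝ) (x : Rn n) : cut ε x ≤ 1 :=
  inv_le_one_of_one_le₀ (le_add_of_nonneg_right (by positivity))

theorem abs_cut_le (ε : ℝ) (x : Rn n) : |cut ε x| ≤ 1 := by
  rw [abs_of_nonneg (cut_nonneg ε x)]; exact cut_le_one ε x

theorem abs_coord_le (x : Rn n) (j : Fin n) : |x j| ≤ ‖x‖ := EuclideanSpace.norm_eq x ▸ by
  rw [← Real.sqrt_sq (abs_nonneg (x j))]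
  refine Real.sqrt_le_sqrt ?_
  have := Finset.single_le_sum (f := fun i => ‖x i‖ ^ 2) (fun i _ => by positivity)
    (Finset.mem_univ j)
  simpa [sq_abs] using this

theorem norm_mul_cut_le {ε : ℝ} (x : Rn n) : |ε| * ‖x‖ * cut ε x ≤ 1 := by
  unfold cut
  rw [mul_inv_le_iff₀ (by positivity)]
  -- From `(|ε|‖x‖ - 1)² ≥ 0`, that is `2|ε|‖x‖ ≤ 1 + ε²‖x‖²`.
  nlinarith [sq_nonneg (|ε| * ‖x‖ - 1), sq_abs ε, mul_pow |ε| ‖x‖ 2]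

theorem abs_coord_mul_cut_le {ε : ℝ} (hε : 0 < ε) (x : Rn n) (j : Fin n) :
    |x j * cut ε x| ≤ ε⁻¹ := by
  rw [abs_mul, abs_of_nonneg (cut_nonneg ε x)]
  have h1 := norm_mul_cut_le (ε := ε) x
  rw [abs_of_pos hε] at h1
  rw [inv_eq_one_div, le_div_iff₀ hε]
  nlinarith [mul_le_mul_of_nonneg_right (abs_coord_le x j) (cut_nonneg ε x)]

theorem abs_cutDeriv_le {ε : ℝ} (hε : 0 < ε) (j : Fin n) (x : Rn n) :
    |cutDeriv ε j x| ≤ 2 * ε := by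
  have h1 := norm_mul_cut_le (ε := ε) x
  rw [abs_of_pos hε] at h1
  have h2 := mul_le_mul_of_nonneg_right (abs_coord_le x j) (cut_nonneg ε x)
  have : |cutDeriv ε j x| = 2 * ε * (ε * (|x j| * cut ε x)) * cut ε x := by
    unfold cutDeriv
    rw [abs_mul, abs_neg, abs_mul, abs_mul, abs_two, abs_of_pos (pow_pos hε 2),
      abs_of_nonneg (sq_nonneg (cut ε x))]
    ring
  rw [this]
  have h3 : ε * (|x j| * cut ε x) ≤ 1 := by nlinarith
  have h4 : 0 ≤ ε * (|x j| * cut ε x) :=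
    mul_nonneg hε.le (mul_nonneg (abs_nonneg _) (cut_nonneg ε x))
  have h5 : ε * (|x j| * cut ε x) * cut ε x ≤ 1 :=
    mul_le_one₀ h3 (cut_nonneg ε x) (cut_le_one ε x)
  nlinarith

theorem bddMeas_cut (ε : ℝ) : BddMeas (fun x : Rn n => (cut ε x : ℂ)) :=
  .ofReal (temperate_cut ε).1.continuous.aestronglyMeasurable (abs_cut_le ε)

theorem bddMeas_coord_cut {ε : ℝ} (hε : 0 < ε) (j : Fin n) :
    BddMeas (fun x : Rn n => (x j : ℂ) * (cut ε x : ℂ)) := by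
  have h := BddMeas.ofReal ((temperate_real_coord j).1.continuous.mul
    (temperate_cut ε).1.continuous).aestronglyMeasurable fun x => abs_coord_mul_cut_le hε x j
  simpa only [Pi.mul_apply, Complex.ofReal_mul] using h

theorem bddMeas_I_cutDeriv {ε : ℝ} (hε : 0 < ε) (j : Fin n) :
    BddMeas (fun x : Rn n => -Complex.I * (cutDeriv ε j x : ℂ)) :=
  ⟨(continuous_const.mul (temperate_ofReal (temperate_cutDeriv ε j)).1.continuous
    ).aestronglyMeasurable, 2 * ε, fun x => by
      rw [norm_mul, norm_neg, Complex.norm_I, one_mul, Complex.norm_real]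
      exact abs_cutDeriv_le hε j x⟩

/-- Truncation in momentum followed by truncation in position. -/
def regularize {ε : ℝ} (hε : 0 < ε) : L2 n →L[ℂ] XGraph n :=
  liftX (mulC (fun x => (cut ε x : ℂ)) ∘L fmul (fun x => (cut ε x : ℂ)))
    (fun j => mulC (fun x => (x j : ℂ) * (cut ε x : ℂ)) ∘L fmul (fun x => (cut ε x : ℂ)))
    (fun j => mulC (fun x => (cut ε x : ℂ)) ∘L
        (((2 * Real.pi : ℝ) : ℂ) • fmul (fun x => (x j : ℂ) * (cut ε x : ℂ))) +
      mulC (fun x => -Complex.I * (cutDeriv ε j x : ℂ)) ∘L fmul (fun x => (cut ε x : ℂ)))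
    (fun j z => weakOp_Xop_mulC (bddMeas_cut ε) (bddMeas_coord_cut hε j) _)
    (fun j z => by
      refine WeakOp.mulC_mom (bddMeas_cut ε) (temperate_ofReal (temperate_cut ε))
        (temperate_ofReal (temperate_cutDeriv ε j)) (fderiv_cut ε j)
        (weakOp_Pop_fmul (bddMeas_cut ε) (bddMeas_coord_cut hε j) z) ?_
      exact weakOp_smulLeft_mulC (bddMeas_I_cutDeriv hε j)
        ((Function.HasTemperateGrowth.const (-Complex.I)).mul
          (temperate_ofReal (temperate_cutDeriv ε j))) _)

theorem regularize_sch {ε : ℝ} (hε : 0 < ε) (φ : 𝓢(Rn n, ℂ)) :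
    ∃ χ, regularize hε (sch φ) = schX χ := by
  refine ⟨SchwartzMap.smulLeftCLM ℂ (fun x => (cut ε x : ℂ))
    (SchwartzMap.fourierMultiplierCLM ℂ (fun x => (cut ε x : ℂ)) φ), fstX_injective ?_⟩
  rw [fstX_schX, ← mulC_sch (bddMeas_cut ε) (temperate_ofReal (temperate_cut ε)),
    ← fmul_sch (bddMeas_cut ε) (temperate_ofReal (temperate_cut ε))]
  rfl

/-- On a Schwartz function the error is `ε²|x|² cut ε φ`, of norm at most `ε²‖|x|²φ‖`; the cutoffs
are contractions, so convergence extends to `L²`. -/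
theorem tendsto_mulC_cut (u : L2 n) :
    Tendsto (fun ε => mulC (fun x : Rn n => (cut ε x : ℂ)) u) (𝓝[>] 0) (𝓝 u) := by
  refine tendsto_of_tendsto_sch (S := ContinuousLinearMap.id ℂ (L2 n)) (C := 1)
    (Eventually.of_forall fun ε v => norm_mulC_le (bddMeas_cut ε) (fun x => ?_) v) (fun φ => ?_) u
  · rw [Complex.norm_real]; exact abs_cut_le ε x
  · rw [tendsto_iff_norm_sub_tendsto_zero]
    have hN : (fun x : Rn n => ((‖x‖ ^ 2 : ℝ) : ℂ)).HasTemperateGrowth :=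
      temperate_ofReal (Function.hasTemperateGrowth_norm_sq (Rn n))
    refine squeeze_zero (g := fun ε : ℝ => ε ^ 2 *
      ‖sch (SchwartzMap.smulLeftCLM ℂ (fun x : Rn n => ((‖x‖ ^ 2 : ℝ) : ℂ)) φ)‖)
      (fun ε => norm_nonneg _) (fun ε => norm_le_of_ae ?_) ?_
    · filter_upwards [Lp.coeFn_sub (mulC (fun x : Rn n => (cut ε x : ℂ)) (sch φ)) (sch φ),
        coeFn_mulC (bddMeas_cut ε) (sch φ), coeFn_sch φ, coeFn_sch
          (SchwartzMap.smulLeftCLM ℂ (fun x : Rn n => ((‖x‖ ^ 2 : ℝ) : ℂ)) φ)] with x h1 h2 h3 h4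
      have e : cut ε x - 1 = -(ε ^ 2 * ‖x‖ ^ 2 * cut ε x) := by
        unfold cut; field_simp; ring
      change ‖(mulC (fun x : Rn n => (cut ε x : ℂ)) (sch φ) - sch φ : L2 n) x‖ ≤ _
      rw [h1, Pi.sub_apply, h2, h3, h4, SchwartzMap.smulLeftCLM_apply_apply hN, smul_eq_mul,
        ← sub_one_mul, norm_mul, norm_mul, ← Complex.ofReal_one, ← Complex.ofReal_sub,
        Complex.norm_real, Complex.norm_real, e, norm_neg, ← mul_assoc, Real.norm_eq_abs,
        Real.norm_eq_abs, abs_of_nonneg (by have := cut_nonneg ε x; positivity),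
        abs_of_nonneg (by positivity : 0 ≤ ‖x‖ ^ 2)]
      exact mul_le_mul_of_nonneg_right
        (mul_le_of_le_one_right (by positivity) (cut_le_one ε x)) (norm_nonneg _)
    · have : Tendsto (fun ε : ℝ => ε ^ 2 *
          ‖sch (SchwartzMap.smulLeftCLM ℂ (fun x : Rn n => ((‖x‖ ^ 2 : ℝ) : ℂ)) φ)‖)
          (𝓝 0) (𝓝 ((0 : ℝ) ^ 2 *
            ‖sch (SchwartzMap.smulLeftCLM ℂ (fun x : Rn n => ((‖x‖ ^ 2 : ℝ) : ℂ)) φ)‖)) := by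
        exact Tendsto.mul_const _ (by fun_prop : Continuous fun ε : ℝ => ε ^ 2).continuousAt
      rw [zero_pow two_ne_zero, zero_mul] at this
      exact this.mono_left nhdsWithin_le_nhds

theorem tendsto_fmul_cut (u : L2 n) :
    Tendsto (fun ε => fmul (fun x : Rn n => (cut ε x : ℂ)) u) (𝓝[>] 0) (𝓝 u) := by
  have h := (FL.symm.continuous.tendsto _).comp (tendsto_mulC_cut (FL u))
  rwa [FL.symm_apply_apply] at h

theorem tendsto_mulC_cut_of_tendsto {w : ℝ → L2 n} {u : L2 n} (h : Tendsto w (𝓝[>] 0) (𝓝 u)) :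
    Tendsto (fun ε => mulC (fun x : Rn n => (cut ε x : ℂ)) (w ε)) (𝓝[>] 0) (𝓝 u) := by
  have h0 : Tendsto (fun ε => mulC (fun x : Rn n => (cut ε x : ℂ)) (w ε - u)) (𝓝[>] 0) (𝓝 0) := by
    refine squeeze_zero_norm (a := fun ε => 1 * ‖w ε - u‖) (fun ε => norm_mulC_le (bddMeas_cut ε)
      (fun x => ?_) _) ?_
    · rw [Complex.norm_real]; exact abs_cut_le ε x
    · simpa using (tendsto_iff_norm_sub_tendsto_zero.mp h)
  have h1 := h0.add (tendsto_mulC_cut u)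
  simpa only [map_sub, sub_add_cancel, zero_add] using h1

theorem tendsto_zero_of_norm_le {w : ℝ → L2 n} {C : ℝ} (h : ∀ ε > 0, ‖w ε‖ ≤ C * ε) :
    Tendsto w (𝓝[>] 0) (𝓝 0) := by
  have : Tendsto (fun ε : ℝ => C * ε) (𝓝[>] 0) (𝓝 0) := by
    have h1 : Tendsto (fun ε : ℝ => C * ε) (𝓝 0) (𝓝 (C * 0)) :=
      (by fun_prop : Continuous fun ε : ℝ => C * ε).continuousAt
    rw [mul_zero] at h1
    exact h1.mono_left nhdsWithin_le_nhds
  refine squeeze_zero_norm' ?_ this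
  filter_upwards [self_mem_nhdsWithin] with ε hε using h ε hε

/-- `regularize` is bounded from `L²` to `X` and preserves Schwartz functions, so all its values lie
in the closure of their range. It tends to the identity on `X` because moving `xⱼ` or `pⱼ` past a
cutoff costs one derivative of the cutoff, which is `O(ε)`. -/
theorem denseRange_schX : DenseRange (schX (n := n)) := by
  have hreg : ∀ {ε : ℝ} (hε : 0 < ε) (u : L2 n),
      regularize hε u ∈ closure (range (schX (n := n))) := by
    intro ε hε u
    refine denseRange_sch.induction_on
      (p := fun u => regularize hε u ∈ closure (range (schX (n := n)))) u
      (isClosed_closure.preimage (regularize hε).continuous) fun φ => ?_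
    obtain ⟨χ, hχ⟩ := regularize_sch hε φ
    rw [hχ]
    exact subset_closure (mem_range_self χ)
  intro z
  let f : ℝ → XGraph n := fun ε => if hε : 0 < ε then regularize hε (fstX z) else 0
  have hf : ∀ ε (hε : 0 < ε), f ε = regularize hε (fstX z) := fun ε hε => dif_pos hε
  refine isClosed_closure.mem_of_tendsto (f := f) (b := 𝓝[>] 0) (tendsto_XGraph ?_ ?_ ?_) ?_
  · refine (tendsto_mulC_cut_of_tendsto (tendsto_fmul_cut (fstX z))).congr' ?_
    filter_upwards [self_mem_nhdsWithin] with ε hε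
    rw [hf ε hε]; rfl
  · intro j
    -- The commutator of `xⱼ` with the momentum cutoff.
    let c : ℝ → L2 n := fun ε => ((-(2 * Real.pi) : ℝ) : ℂ)⁻¹ •
      fmul (fun x => -Complex.I * (cutDeriv ε j x : ℂ)) (fstX z)
    have hc : Tendsto c (𝓝[>] 0) (𝓝 0) := by
      refine tendsto_zero_of_norm_le
        (C := ‖((-(2 * Real.pi) : ℝ) : ℂ)⁻¹‖ * (2 * ‖fstX z‖)) fun ε hε => ?_
      rw [norm_smul, mul_assoc]
      refine mul_le_mul_of_nonneg_left ?_ (norm_nonneg _)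
      refine (norm_fmul_le (bddMeas_I_cutDeriv hε j) (C := 2 * ε) (fun x => ?_) _).trans (by linarith)
      rw [norm_mul, norm_neg, Complex.norm_I, one_mul, Complex.norm_real]
      exact abs_cutDeriv_le hε j x
    have h1 := tendsto_mulC_cut_of_tendsto ((tendsto_fmul_cut (posX j z)).add hc)
    rw [add_zero] at h1
    refine h1.congr' ?_
    filter_upwards [self_mem_nhdsWithin] with ε hε
    rw [hf ε hε]
    have hw : WeakOp (Xop j) (fmul (fun x : Rn n => (cut ε x : ℂ)) (fstX z))
        (fmul (fun x : Rn n => (cut ε x : ℂ)) (posX j z) + c ε) := by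
      refine (weak_posX z j).fmul_pos (bddMeas_cut ε) (temperate_ofReal (temperate_cut ε))
        (temperate_ofReal (temperate_cutDeriv ε j)) (fderiv_cut ε j) ?_
      rw [map_smul, smul_smul, mul_inv_cancel₀ neg_two_pi_ne, one_smul, FL_fmul]
      exact weakOp_smulLeft_mulC (bddMeas_I_cutDeriv hε j)
        ((Function.HasTemperateGrowth.const (-Complex.I)).mul
          (temperate_ofReal (temperate_cutDeriv ε j))) _
    exact (hw.mulC_pos (bddMeas_cut ε) (temperate_ofReal (temperate_cut ε))).unique
      (weak_posX (regularize hε (fstX z)) j)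
  · intro j
    -- The commutator of `pⱼ` with the position cutoff.
    let c : ℝ → L2 n := fun ε => mulC (fun x => -Complex.I * (cutDeriv ε j x : ℂ))
      (fmul (fun x => (cut ε x : ℂ)) (fstX z))
    have hc : Tendsto c (𝓝[>] 0) (𝓝 0) := by
      refine tendsto_zero_of_norm_le (C := 2 * ‖fstX z‖) fun ε hε => ?_
      refine (norm_mulC_le (bddMeas_I_cutDeriv hε j) (C := 2 * ε) (fun x => ?_) _).trans ?_
      · rw [norm_mul, norm_neg, Complex.norm_I, one_mul, Complex.norm_real]
        exact abs_cutDeriv_le hε j x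
      · have := norm_fmul_le (bddMeas_cut ε) (C := 1) (fun x => by
          rw [Complex.norm_real]; exact abs_cut_le ε x) (fstX z)
        rw [one_mul] at this
        have h2 : (0 : ℝ) ≤ 2 * ε := by have : (0 : ℝ) < ε := hε; positivity
        nlinarith [mul_le_mul_of_nonneg_left this h2]
    have h1 := (tendsto_mulC_cut_of_tendsto (tendsto_fmul_cut (momX j z))).add hc
    rw [add_zero] at h1
    refine h1.congr' ?_
    filter_upwards [self_mem_nhdsWithin] with ε hε
    rw [hf ε hε]
    refine WeakOp.unique ?_ (weak_momX (regularize hε (fstX z)) j)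
    refine WeakOp.mulC_mom (bddMeas_cut ε) (temperate_ofReal (temperate_cut ε))
      (temperate_ofReal (temperate_cutDeriv ε j)) (fderiv_cut ε j)
      ((weak_momX z j).fmul_mom (bddMeas_cut ε) (temperate_ofReal (temperate_cut ε))) ?_
    exact weakOp_smulLeft_mulC (bddMeas_I_cutDeriv hε j)
      ((Function.HasTemperateGrowth.const (-Complex.I)).mul
        (temperate_ofReal (temperate_cutDeriv ε j))) _
  · filter_upwards [self_mem_nhdsWithin] with ε hε
    rw [hf ε hε]
    exact hreg hε _

/-! ### Multiplication by bounded Lipschitz functions on `X` -/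

/-- Multiplication by a bounded real function. -/
abbrev mulR (f : Rn n → ℝ) : L2 n →L[ℂ] L2 n := mulC fun x => (f x : ℂ)

/-- The `j`-th partial derivative. -/
def pderiv (f : Rn n → ℝ) (j : Fin n) (x : Rn n) : ℝ := fderiv ℝ f x (dir j)

theorem pderiv_eq {f : Rn n → ℝ} {x : Rn n} (j : Fin n) : pderiv f j x = gradient f x j := by
  rw [← inner_dir (gradient f x) j, gradient, InnerProductSpace.toDual_symm_apply, pderiv]

theorem BoundedDiff.bddMeas {f : Rn n → ℝ} (hf : BoundedDiff f) :
    BddMeas (fun x => (f x : ℂ)) := by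
  obtain ⟨M, hM⟩ := hf.bounded
  exact .ofReal hf.differentiable.continuous.aestronglyMeasurable fun x => (hM x).1

theorem measurable_pderiv (f : Rn n → ℝ) (j : Fin n) : Measurable (pderiv f j) :=
  measurable_fderiv_apply_const ℝ f (dir j)

theorem abs_pderiv_le {f : Rn n → ℝ} {M : ℝ} (hM : ∀ x, ‖gradient f x‖ ≤ M) (j : Fin n)
    (x : Rn n) : |pderiv f j x| ≤ M := by
  rw [pderiv_eq]
  exact (abs_coord_le _ j).trans (hM x)

theorem BoundedDiff.bddMeas_pderiv {f : Rn n → ℝ} (hf : BoundedDiff f) (j : Fin n) :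
    BddMeas (fun x => (pderiv f j x : ℂ)) := by
  obtain ⟨M, hM⟩ := hf.bounded
  exact .ofReal (measurable_pderiv f j).aestronglyMeasurable (abs_pderiv_le (fun x => (hM x).2) j)

theorem BddMeas.memLp_mul {m g : Rn n → ℂ} (hm : BddMeas m) (hg : MemLp g 2 volume) :
    MemLp (fun x => m x * g x) 2 volume := by
  obtain ⟨C, hC⟩ := hm.bdd
  refine hg.of_le_mul (c := C) (hm.meas.mul hg.1) ?_
  filter_upwards with x
  rw [norm_mul]
  exact mul_le_mul_of_nonneg_right (hC x) (norm_nonneg _)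

/-- `f` need not be `C¹`: integration by parts only asks for a derivative at every point and
integrable products, which the measurable, bounded partial derivatives provide. -/
theorem weakOp_Pop_mulR_sch {f : Rn n → ℝ} (hf : BoundedDiff f) (j : Fin n) (χ : 𝓢(Rn n, ℂ)) :
    WeakOp (Pop j) (mulR f (sch χ))
      (mulR f (sch (Pop j χ)) + (-Complex.I) • mulR (pderiv f j) (sch χ)) := by
  intro φ
  have hfb := hf.bddMeas
  have hpb := hf.bddMeas_pderiv j
  have hG : ∀ x, HasFDerivAt (fun y => (f y : ℂ) * χ y)
      ((f x : ℂ) • fderiv ℝ χ x + χ x • (Complex.ofRealCLM ∘L fderiv ℝ f x)) x := fun x =>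
    (Complex.ofRealCLM.hasFDerivAt.comp x (hf.differentiable x).hasFDerivAt).mul (χ.hasFDerivAt x)
  have hi : ∀ {a b : Rn n → ℂ}, MemLp a 2 (volume : Measure (Rn n)) →
      MemLp b 2 (volume : Measure (Rn n)) → Integrable (fun x => conj (a x) * b x) volume :=
    fun ha hb => ha.star.integrable_mul hb
  have m1 : MemLp (fun x => fderiv ℝ φ x (dir j)) 2 (volume : Measure (Rn n)) :=
    (∂_{dir j} φ).memLp 2 volume
  have m2 : MemLp (fun x => fderiv ℝ χ x (dir j)) 2 (volume : Measure (Rn n)) :=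
    (∂_{dir j} χ).memLp 2 volume
  have m3 : MemLp (fun x => (f x : ℂ) * χ x) 2 (volume : Measure (Rn n)) :=
    hfb.memLp_mul (χ.memLp 2 volume)
  have m4 : MemLp (fun x => (f x : ℂ) * fderiv ℝ χ x (dir j) + (pderiv f j x : ℂ) * χ x) 2
      (volume : Measure (Rn n)) := (hfb.memLp_mul m2).add (hpb.memLp_mul (χ.memLp 2 volume))
  have e : ∀ x, ((f x : ℂ) • fderiv ℝ χ x + χ x • (Complex.ofRealCLM ∘L fderiv ℝ f x)) (dir j) =
      (f x : ℂ) * fderiv ℝ χ x (dir j) + (pderiv f j x : ℂ) * χ x := fun x => by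
    simp [pderiv, mul_comm]
  have h := integral_bilinear_hasFDerivAt_right_eq_neg_left_of_integrable
    (μ := (volume : Measure (Rn n))) (f := φ) (f' := fun x => fderiv ℝ φ x)
    (g := fun y => (f y : ℂ) * χ y) (v := dir j)
    (B := (ContinuousLinearMap.mul ℝ ℂ).comp (Complex.conjCLE : ℂ →L[ℝ] ℂ))
    (hi m1 m3) (by simp only [e]; exact hi (φ.memLp 2 volume) m4) (hi (φ.memLp 2 volume) m3)
    (fun x _ => φ.hasFDerivAt x) (fun x _ => hG x)
  simp only [ContinuousLinearMap.comp_apply, ContinuousLinearMap.mul_apply',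
    ContinuousLinearEquiv.coe_coe, Complex.conjCLE_apply, e] at h
  rw [inner_eq_integral, inner_eq_integral]
  calc _ = ∫ x, -Complex.I * (conj (φ x) *
        ((f x : ℂ) * fderiv ℝ χ x (dir j) + (pderiv f j x : ℂ) * χ x)) := by
        refine integral_congr_ae ?_
        filter_upwards [coeFn_sch φ, coeFn_sch χ, coeFn_sch (Pop j χ),
          coeFn_mulC hfb (sch (Pop j χ)), coeFn_mulC hpb (sch χ),
          Lp.coeFn_add (mulR f (sch (Pop j χ))) ((-Complex.I) • mulR (pderiv f j) (sch χ)),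
          Lp.coeFn_smul (-Complex.I) (mulR (pderiv f j) (sch χ))] with x h1 h2 h3 h4 h5 h6 h7
        rw [h6, Pi.add_apply, h7, Pi.smul_apply, h4, h5, h1, h2, h3, Pop_apply, smul_eq_mul]
        ring
    _ = ∫ x, Complex.I * (conj (fderiv ℝ φ x (dir j)) * ((f x : ℂ) * χ x)) := by
        rw [integral_const_mul, h, integral_const_mul]; ring
    _ = _ := by
        refine integral_congr_ae ?_
        filter_upwards [coeFn_sch χ, coeFn_sch (Pop j φ), coeFn_mulC hfb (sch χ)] with x h1 h2 h3
        rw [h2, h3, h1, Pop_apply, map_mul, map_neg, Complex.conj_I]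
        ring

theorem weakOp_Pop_mulR {f : Rn n → ℝ} (hf : BoundedDiff f) (j : Fin n) (z : XGraph n) :
    WeakOp (Pop j) (mulR f (fstX z))
      (mulR f (momX j z) + (-Complex.I) • mulR (pderiv f j) (fstX z)) := by
  refine denseRange_schX.induction_on (p := fun z => WeakOp (Pop j) (mulR f (fstX z))
      (mulR f (momX j z) + (-Complex.I) • mulR (pderiv f j) (fstX z))) z ?_
    (weakOp_Pop_mulR_sch hf j)
  exact (isClosed_weakOp (Pop j)).preimage (f := fun z : XGraph n => (mulR f (fstX z),
    mulR f (momX j z) + (-Complex.I) • mulR (pderiv f j) (fstX z))) (by fun_prop)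

theorem weakOp_Xop_mulR {f : Rn n → ℝ} (hf : BoundedDiff f) (j : Fin n) (z : XGraph n) :
    WeakOp (Xop j) (mulR f (fstX z)) (mulR f (posX j z)) := by
  refine denseRange_schX.induction_on
    (p := fun z => WeakOp (Xop j) (mulR f (fstX z)) (mulR f (posX j z))) z ?_ fun φ => ?_
  · exact (isClosed_weakOp (Xop j)).preimage
      (f := fun z : XGraph n => (mulR f (fstX z), mulR f (posX j z))) (by fun_prop)
  · refine weakOp_Xop_of_ae ?_
    filter_upwards [coeFn_mulC hf.bddMeas (posX j (schX φ)),
      coeFn_mulC hf.bddMeas (fstX (schX φ)), coeFn_sch φ, coeFn_sch (Xop j φ)] with x h1 h2 h3 h4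
    rw [h1, h2, fstX_schX, posX_schX, h3, h4, Xop_apply]
    ring

/-- Multiplication by a bounded function with bounded gradient, on `X`. -/
def mulX {f : Rn n → ℝ} (hf : BoundedDiff f) : XGraph n →L[ℂ] XGraph n :=
  liftX (mulR f ∘L fstX) (fun j => mulR f ∘L posX j)
    (fun j => mulR f ∘L momX j + (-Complex.I) • (mulR (pderiv f j) ∘L fstX))
    (fun j z => weakOp_Xop_mulR hf j z) (fun j z => weakOp_Pop_mulR hf j z)

section mulX

variable {f : Rn n → ℝ} (hf : BoundedDiff f) (z : XGraph n)

theorem fstX_mulX : fstX (mulX hf z) = mulR f (fstX z) := rfl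

theorem posX_mulX (j : Fin n) : posX j (mulX hf z) = mulR f (posX j z) := rfl

theorem momX_mulX (j : Fin n) : momX j (mulX hf z) =
    mulR f (momX j z) + (-Complex.I) • mulR (pderiv f j) (fstX z) := rfl

theorem norm_mulR_le {f : Rn n → ℝ} (hf : BddMeas (fun x => (f x : ℂ))) {M : ℝ}
    (hM : ∀ x, |f x| ≤ M) (u : L2 n) : ‖mulR f u‖ ≤ M * ‖u‖ :=
  norm_mulC_le hf (fun x => by rw [Complex.norm_real]; exact hM x) u

/-- The factor `2` comes from the momentum component, where `f pⱼz` and `(∂ⱼf) z` each contribute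
`M`. -/
theorem norm_mulX_le {M : ℝ} (hM : ∀ x, |f x| ≤ M ∧ ‖gradient f x‖ ≤ M) :
    ‖mulX hf z‖ ≤ (2 * M) * ‖z‖ := by
  have h0 : 0 ≤ M := (norm_nonneg _).trans (hM 0).2
  have hf' : ∀ u, ‖mulR f u‖ ≤ M * ‖u‖ := norm_mulR_le hf.bddMeas fun x => (hM x).1
  have hz := norm_nonneg z
  have hMz : 0 ≤ M * ‖z‖ := mul_nonneg h0 hz
  refine normX_le (by positivity) ?_ (fun j => ?_) fun j => ?_
  · have := (hf' (fstX z)).trans (mul_le_mul_of_nonneg_left (norm_fstX_le z) h0)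
    rw [fstX_mulX]; linarith
  · have := (hf' (posX j z)).trans (mul_le_mul_of_nonneg_left (norm_posX_le z j) h0)
    rw [posX_mulX]; linarith
  · have h1 := (hf' (momX j z)).trans (mul_le_mul_of_nonneg_left (norm_momX_le z j) h0)
    have h2 := (norm_mulR_le (hf.bddMeas_pderiv j) (abs_pderiv_le (fun x => (hM x).2) j)
      (fstX z)).trans (mul_le_mul_of_nonneg_left (norm_fstX_le z) h0)
    rw [momX_mulX]
    refine (norm_add_le _ _).trans ?_
    rw [norm_smul, norm_neg, Complex.norm_I, one_mul]
    linarith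

end mulX

theorem inner_mulR {f : Rn n → ℝ} (hf : BddMeas (fun x => (f x : ℂ))) (u v : L2 n) :
    inner ℂ u (mulR f v) = inner ℂ (mulR f u) v := by
  rw [inner_mulC_right hf]
  simp only [Complex.conj_ofReal]

/-! ### The free Schrödinger group -/

theorem temperate_cexp : (fun s : ℝ => Complex.exp (-(Complex.I * s))).HasTemperateGrowth := by
  have hd : ∀ s : ℝ, HasDerivAt (fun s : ℝ => Complex.exp (-(Complex.I * s)))
      (-Complex.I * Complex.exp (-(Complex.I * s))) s := fun s => by
    have := (((hasDerivAt_id s).ofReal_comp.const_mul Complex.I).neg).cexp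
    simpa [mul_comm] using this
  have hit : ∀ k, iteratedDeriv k (fun s : ℝ => Complex.exp (-(Complex.I * s))) =
      fun s : ℝ => (-Complex.I) ^ k * Complex.exp (-(Complex.I * s)) := by
    intro k
    induction k with
    | zero => ext s; simp
    | succ k ih =>
      ext s
      rw [iteratedDeriv_succ, ih, ((hd s).const_mul ((-Complex.I) ^ k)).deriv, pow_succ, mul_assoc]
  refine ⟨((contDiff_const.mul Complex.ofRealCLM.contDiff).neg).cexp, fun k => ⟨0, 1, fun s => ?_⟩⟩
  rw [norm_iteratedFDeriv_eq_norm_iteratedDeriv, hit]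
  have : -(Complex.I * (s : ℂ)) = ((-s : ℝ) : ℂ) * Complex.I := by push_cast; ring
  rw [norm_mul, norm_pow, norm_neg, Complex.norm_I, one_pow, this, Complex.norm_exp_ofReal_mul_I]
  simp

/-- The symbol `4π²|ξ|²` of `-Δ`. -/
def freeSymbol (x : Rn n) : ℝ := (2 * Real.pi) ^ 2 * ‖x‖ ^ 2

/-- The symbol of `e^{itΔ}`. -/
def freePhase (t : ℝ) (x : Rn n) : ℂ := Complex.exp (-(Complex.I * ((t * freeSymbol x : ℝ) : ℂ)))

theorem temperate_freeSymbol : (freeSymbol : Rn n → ℝ).HasTemperateGrowth :=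
  (Function.HasTemperateGrowth.const ((2 * Real.pi) ^ 2)).mul
    (Function.hasTemperateGrowth_norm_sq (Rn n))

theorem temperate_freePhase (t : ℝ) : (freePhase t : Rn n → ℂ).HasTemperateGrowth :=
  temperate_cexp.comp ((Function.HasTemperateGrowth.const t).mul temperate_freeSymbol)

theorem norm_freePhase (t : ℝ) (x : Rn n) : ‖freePhase t x‖ = 1 := by
  have : -(Complex.I * ((t * freeSymbol x : ℝ) : ℂ)) =
    ((-(t * freeSymbol x) : ℝ) : ℂ) * Complex.I := by push_cast; ring
  rw [freePhase, this, Complex.norm_exp_ofReal_mul_I]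

theorem bddMeas_freePhase (t : ℝ) : BddMeas (freePhase t : Rn n → ℂ) :=
  ⟨(temperate_freePhase t).1.continuous.aestronglyMeasurable, 1, fun x => (norm_freePhase t x).le⟩

theorem freePhase_add (s t : ℝ) (x : Rn n) :
    freePhase s x * freePhase t x = freePhase (s + t) x := by
  rw [freePhase, freePhase, freePhase, ← Complex.exp_add]
  push_cast
  ring_nf

theorem conj_freePhase (t : ℝ) (x : Rn n) : conj (freePhase t x) = freePhase (-t) x := by
  rw [freePhase, freePhase, ← Complex.exp_conj]
  simp only [map_neg, map_mul, Complex.conj_I, Complex.conj_ofReal]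
  push_cast
  ring_nf

/-- The unitary group `e^{itΔ}` on `L²`. -/
def free (t : ℝ) : L2 n →L[ℂ] L2 n := fmul (freePhase t)

theorem norm_free_le (t : ℝ) (u : L2 n) : ‖free t u‖ ≤ ‖u‖ := by
  have := norm_fmul_le (bddMeas_freePhase t) (fun x => (norm_freePhase t x).le) u
  rwa [one_mul] at this

theorem free_free (s t : ℝ) (u : L2 n) : free s (free t u) = free (s + t) u := by
  rw [free, free, free, fmul_apply, FL_fmul, mulC_mulC (bddMeas_freePhase s) (bddMeas_freePhase t),
    fmul_apply]
  simp only [freePhase_add]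

theorem free_zero (u : L2 n) : free 0 u = u := by
  rw [free, fmul_apply]
  have : mulC (freePhase 0) (FL u) = FL u := by
    refine L2_ext ?_
    filter_upwards [coeFn_mulC (bddMeas_freePhase 0) (FL u)] with x hx
    rw [hx, freePhase]
    simp
  rw [this, FL.symm_apply_apply]

theorem free_neg_free (t : ℝ) (u : L2 n) : free (-t) (free t u) = u := by
  rw [free_free, neg_add_cancel, free_zero]

theorem free_free_neg (t : ℝ) (u : L2 n) : free t (free (-t) u) = u := by
  rw [free_free, add_neg_cancel, free_zero]

theorem norm_free (t : ℝ) (u : L2 n) : ‖free t u‖ = ‖u‖ := by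
  refine le_antisymm (norm_free_le t u) ?_
  have := norm_free_le (-t) (free t u)
  rwa [free_neg_free] at this

theorem inner_free_right (t : ℝ) (u v : L2 n) :
    inner ℂ u (free t v) = inner ℂ (free (-t) u) v := by
  rw [free, free, fmul_apply, fmul_apply, ← FL.inner_map_map, FL.apply_symm_apply,
    inner_mulC_right (bddMeas_freePhase t), ← FL.inner_map_map (FL.symm _), FL.apply_symm_apply]
  simp only [conj_freePhase]

theorem inner_free_free (t : ℝ) (u v : L2 n) : inner ℂ (free t u) (free t v) = inner ℂ u v := by
  rw [inner_free_right, free_neg_free]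

/-- The group `e^{itΔ}` on the Schwartz space. -/
def freeS (t : ℝ) : 𝓢(Rn n, ℂ) →L[ℂ] 𝓢(Rn n, ℂ) := SchwartzMap.fourierMultiplierCLM ℂ (freePhase t)

theorem free_sch (t : ℝ) (φ : 𝓢(Rn n, ℂ)) : free t (sch φ) = sch (freeS t φ) :=
  fmul_sch (bddMeas_freePhase t) (temperate_freePhase t) φ
theorem fderiv_freePhase (t : ℝ) (j : Fin n) (x : Rn n) :
    fderiv ℝ (freePhase t) x (dir j) =
      ((-(8 * Real.pi ^ 2 * t) : ℝ) : ℂ) * Complex.I * ((x j : ℂ) * freePhase t x) := by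
  have h1 : HasFDerivAt (fun y : Rn n => t * freeSymbol y)
      (t • ((2 * Real.pi) ^ 2 • (2 • innerSL ℝ x))) x :=
    (((hasStrictFDerivAt_norm_sq x).hasFDerivAt).const_mul ((2 * Real.pi) ^ 2)).const_mul t
  have h2 := (((Complex.ofRealCLM.hasFDerivAt.comp x h1).const_mul Complex.I).neg).cexp
  have h3 : innerSL ℝ x (dir j) = x j := inner_dir x j
  have h4 : HasFDerivAt (freePhase t : Rn n → ℂ) _ x := h2
  rw [h4.fderiv]
  simp [h3, freePhase]
  ring

theorem temperate_coord_freePhase (t : ℝ) (j : Fin n) :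
    (fun x : Rn n => (x j : ℂ) * freePhase t x).HasTemperateGrowth :=
  (temperate_coord j).mul (temperate_freePhase t)

theorem temperate_freePhase_deriv (c : ℂ) (t : ℝ) (j : Fin n) :
    (fun x : Rn n => c * ((x j : ℂ) * freePhase t x)).HasTemperateGrowth :=
  (Function.HasTemperateGrowth.const c).mul (temperate_coord_freePhase t j)

/-- This is `xⱼ e^{itΔ} = e^{itΔ}(xⱼ + 2t pⱼ)`: differentiating the phase brings down a multiple of
`t ξⱼ`, and `ξⱼ` is `pⱼ/2π` in this normalisation of the Fourier transform. -/
theorem weakOp_Xop_free {j : Fin n} {u a b : L2 n} (ha : WeakOp (Xop j) u a)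
    (hb : WeakOp (Pop j) u b) (t : ℝ) :
    WeakOp (Xop j) (free t u) (free t a + ((2 * t : ℝ) : ℂ) • free t b) := by
  refine WeakOp.fmul_pos (bddMeas_freePhase t) (temperate_freePhase t)
    (temperate_freePhase_deriv _ t j) (fderiv_freePhase t j) ha ?_
  rw [weakOp_Pop_iff] at hb
  intro φ
  have e : SchwartzMap.smulLeftCLM ℂ (fun x : Rn n => conj (-Complex.I *
      (((-(8 * Real.pi ^ 2 * t) : ℝ) : ℂ) * Complex.I * ((x j : ℂ) * freePhase t x)))) φ =
      ((-(8 * Real.pi ^ 2 * t) : ℝ) : ℂ) • Xop j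
        (SchwartzMap.smulLeftCLM ℂ (fun x => conj (freePhase t x)) φ) := by
    ext x
    rw [SchwartzMap.smulLeftCLM_apply_apply (temperate_conj_mulI
      (temperate_freePhase_deriv _ t j)), smul_apply,
      Xop_apply, SchwartzMap.smulLeftCLM_apply_apply (temperate_conj (temperate_freePhase t))]
    simp only [map_mul, map_neg, Complex.conj_I, Complex.conj_ofReal, smul_eq_mul]
    linear_combination (((-(8 * Real.pi ^ 2 * t) : ℝ) : ℂ) * (x j : ℂ) *
      conj (freePhase t x) * φ x) * (-Complex.I_mul_I)
  rw [e, sch_smul, inner_smul_left, ← hb, ← mulC_sch (bddMeas_freePhase t).conj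
    (temperate_conj (temperate_freePhase t)), ← inner_mulC_right (bddMeas_freePhase t)]
  simp only [map_smul, inner_smul_right, free, FL_fmul, Complex.conj_ofReal]
  have := two_pi_ne
  push_cast at this ⊢
  field_simp
  ring

/-- The group `e^{itΔ}` on `X`. -/
def freeX (t : ℝ) : XGraph n →L[ℂ] XGraph n :=
  liftX (free t ∘L fstX) (fun j => free t ∘L posX j + ((2 * t : ℝ) : ℂ) • (free t ∘L momX j))
    (fun j => free t ∘L momX j) (fun j z => weakOp_Xop_free (weak_posX z j) (weak_momX z j) t)
    (fun j z => (weak_momX z j).fmul_mom (bddMeas_freePhase t) (temperate_freePhase t))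

theorem fstX_freeX (t : ℝ) (z : XGraph n) : fstX (freeX t z) = free t (fstX z) := rfl

theorem posX_freeX (t : ℝ) (z : XGraph n) (j : Fin n) : posX j (freeX t z) =
    free t (posX j z) + ((2 * t : ℝ) : ℂ) • free t (momX j z) := rfl

theorem momX_freeX (t : ℝ) (z : XGraph n) (j : Fin n) :
    momX j (freeX t z) = free t (momX j z) := rfl

theorem freeX_schX (t : ℝ) (φ : 𝓢(Rn n, ℂ)) : freeX t (schX φ) = schX (freeS t φ) :=
  fstX_injective (free_sch t φ)

theorem norm_freeX_le (t : ℝ) (z : XGraph n) : ‖freeX t z‖ ≤ (1 + 2 * |t|) * ‖z‖ := by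
  have hz := norm_nonneg z
  have ht := abs_nonneg t
  have htz := mul_nonneg ht hz
  refine normX_le (by positivity) ?_ (fun j => ?_) fun j => ?_
  · rw [fstX_freeX, norm_free]; nlinarith [norm_fstX_le z]
  · rw [posX_freeX]
    refine (norm_add_le _ _).trans ?_
    rw [norm_smul, norm_free, norm_free, Complex.norm_real, Real.norm_eq_abs, abs_mul, abs_two]
    nlinarith [norm_posX_le z j, mul_le_mul_of_nonneg_left (norm_momX_le z j) ht]
  · rw [momX_freeX, norm_free]; nlinarith [norm_momX_le z j]

/-- Taylor's bound for `|θ| ≤ 1`; for `|θ| > 1` the trivial bound `2 + |θ|` is below `3θ²`. -/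
theorem norm_exp_sub_le (θ : ℝ) :
    ‖Complex.exp (-(Complex.I * θ)) - 1 + Complex.I * θ‖ ≤ 3 * θ ^ 2 := by
  have e : -(Complex.I * (θ : ℂ)) = ((-θ : ℝ) : ℂ) * Complex.I := by push_cast; ring
  have hn : ‖-(Complex.I * (θ : ℂ))‖ = |θ| := by
    rw [norm_neg, norm_mul, Complex.norm_I, one_mul, Complex.norm_real, Real.norm_eq_abs]
  rcases le_or_gt |θ| 1 with h | h
  · have := Complex.norm_exp_sub_one_sub_id_le (hn.le.trans h)
    rw [hn, sq_abs, sub_neg_eq_add] at this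
    nlinarith [sq_nonneg θ]
  · have h1 : ‖Complex.exp (-(Complex.I * θ))‖ = 1 := by rw [e, Complex.norm_exp_ofReal_mul_I]
    have h2 := norm_add_le (Complex.exp (-(Complex.I * θ)) - 1) (Complex.I * θ)
    have h3 := norm_sub_le (Complex.exp (-(Complex.I * θ))) 1
    rw [norm_neg] at hn
    rw [h1, norm_one] at h3
    nlinarith [sq_abs θ]

theorem fourier_laplacian_apply (φ : 𝓢(Rn n, ℂ)) (x : Rn n) :
    𝓕 (Δ φ) x = -(freeSymbol x : ℂ) * 𝓕 φ x := by
  rw [SchwartzMap.laplacian_eq_fourierMultiplierCLM, SchwartzMap.fourierMultiplierCLM_apply,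
    FourierTransform.fourier_smul, FourierTransform.fourier_fourierInv_eq, smul_apply,
    SchwartzMap.smulLeftCLM_apply_apply (Function.hasTemperateGrowth_norm_sq (Rn n))]
  simp [freeSymbol]
  ring

theorem hasDerivAt_of_norm_le_sq {E : Type*} [NormedAddCommGroup E] [NormedSpace ℝ E] {f : ℝ → E}
    {f' : E} {t C : ℝ} (h : ∀ s, ‖f (t + s) - f t - s • f'‖ ≤ C * s ^ 2) : HasDerivAt f f' t := by
  rw [hasDerivAt_iff_isLittleO_nhds_zero]
  have h1 : (fun s => f (t + s) - f t - s • f') =O[𝓝 0] fun s : ℝ => s ^ 2 :=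
    Asymptotics.IsBigO.of_bound C (Eventually.of_forall fun s => by
      rw [norm_pow, Real.norm_eq_abs, sq_abs]; exact h s)
  exact h1.trans_isLittleO (Asymptotics.isLittleO_pow_id one_lt_two)

/-- By Plancherel the Taylor remainder is at most `3s²` times the norm of `freeSymbol² 𝓕χ`, which is
finite because `𝓕χ` is Schwartz. -/
theorem hasDerivAt_free_sch (φ : 𝓢(Rn n, ℂ)) (t : ℝ) :
    HasDerivAt (fun s => free s (sch φ)) (Complex.I • sch (Δ (freeS t φ))) t := by
  set χ := freeS t φ
  have h2 : ((fun x : Rn n => ((freeSymbol x ^ 2 : ℝ) : ℂ))).HasTemperateGrowth :=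
    temperate_ofReal (temperate_freeSymbol.pow 2)
  refine hasDerivAt_of_norm_le_sq (C := 3 * ‖sch (SchwartzMap.smulLeftCLM ℂ
    (fun x : Rn n => ((freeSymbol x ^ 2 : ℝ) : ℂ)) (𝓕 χ))‖) fun s => ?_
  rw [add_comm t s, ← free_free, free_sch, ← FL.norm_map]
  simp only [map_sub]
  rw [free, FL_fmul, FL_sch, RCLike.real_smul_eq_coe_smul (K := ℂ), map_smul, map_smul, FL_sch,
    mul_right_comm]
  refine norm_le_of_ae ?_
  filter_upwards [coeFn_sch (𝓕 χ), coeFn_sch (𝓕 (Δ χ)), coeFn_mulC (bddMeas_freePhase s) (sch (𝓕 χ)),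
    Lp.coeFn_sub (mulC (freePhase s) (sch (𝓕 χ)) - sch (𝓕 χ))
      ((RCLike.ofReal s : ℂ) • Complex.I • sch (𝓕 (Δ χ))),
    Lp.coeFn_sub (mulC (freePhase s) (sch (𝓕 χ))) (sch (𝓕 χ)),
    Lp.coeFn_smul (RCLike.ofReal s : ℂ) (Complex.I • sch (𝓕 (Δ χ))),
    Lp.coeFn_smul Complex.I (sch (𝓕 (Δ χ))),
    coeFn_sch (SchwartzMap.smulLeftCLM ℂ (fun x : Rn n => ((freeSymbol x ^ 2 : ℝ) : ℂ)) (𝓕 χ))]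
    with x h3 h4 h5 h6 h7 h8 h9 h10
  rw [h6, Pi.sub_apply, h7, Pi.sub_apply, h8, Pi.smul_apply, h9, Pi.smul_apply, h5, h3, h4, h10,
    fourier_laplacian_apply, SchwartzMap.smulLeftCLM_apply_apply h2]
  have e : freePhase s x * 𝓕 χ x - 𝓕 χ x -
      (RCLike.ofReal s : ℂ) • Complex.I • (-(freeSymbol x : ℂ) * 𝓕 χ x) =
      (Complex.exp (-(Complex.I * ((s * freeSymbol x : ℝ) : ℂ))) - 1 +
        Complex.I * ((s * freeSymbol x : ℝ) : ℂ)) * 𝓕 χ x := by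
    simp only [smul_eq_mul, freePhase, Complex.coe_algebraMap]
    push_cast
    ring
  rw [e, norm_mul, smul_eq_mul, norm_mul, Complex.norm_real, Real.norm_eq_abs,
    abs_of_nonneg (sq_nonneg _), ← mul_assoc]
  refine mul_le_mul_of_nonneg_right ((norm_exp_sub_le _).trans (le_of_eq ?_)) (norm_nonneg _)
  ring

theorem continuous_free (u : L2 n) : Continuous fun t => free t u := by
  rw [continuous_iff_continuousAt]
  exact fun t => tendsto_of_tendsto_sch (C := 1) (Eventually.of_forall fun s v => by
    rw [one_mul]; exact norm_free_le s v) (fun φ => (hasDerivAt_free_sch φ t).continuousAt) u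

theorem tendsto_free {α : Type*} {l : Filter α} {τ : α → ℝ} {w : α → L2 n} {t : ℝ} {u : L2 n}
    (hτ : Tendsto τ l (𝓝 t)) (hw : Tendsto w l (𝓝 u)) :
    Tendsto (fun a => free (τ a) (w a)) l (𝓝 (free t u)) := by
  have h0 : Tendsto (fun a => free (τ a) (w a - u)) l (𝓝 0) := by
    refine squeeze_zero_norm (fun a => norm_free_le _ _) ?_
    exact tendsto_iff_norm_sub_tendsto_zero.mp hw
  have h1 := h0.add (((continuous_free u).tendsto t).comp hτ)
  simpa only [Function.comp_def, map_sub, sub_add_cancel, zero_add] using h1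

theorem tendsto_freeX {α : Type*} {l : Filter α} {τ : α → ℝ} {w : α → XGraph n} {t : ℝ}
    {z : XGraph n} (hτ : Tendsto τ l (𝓝 t)) (hw : Tendsto w l (𝓝 z)) :
    Tendsto (fun a => freeX (τ a) (w a)) l (𝓝 (freeX t z)) := by
  have h1 : Tendsto (fun a => fstX (w a)) l (𝓝 (fstX z)) := (fstX.continuous.tendsto z).comp hw
  have h2 : ∀ j, Tendsto (fun a => posX j (w a)) l (𝓝 (posX j z)) := fun j =>
    ((posX j).continuous.tendsto z).comp hw
  have h3 : ∀ j, Tendsto (fun a => momX j (w a)) l (𝓝 (momX j z)) := fun j =>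
    ((momX j).continuous.tendsto z).comp hw
  have h4 : ∀ j, Tendsto (fun a => free (τ a) (posX j (w a)) +
      ((2 * τ a : ℝ) : ℂ) • free (τ a) (momX j (w a))) l
      (𝓝 (free t (posX j z) + ((2 * t : ℝ) : ℂ) • free t (momX j z))) := fun j =>
    (tendsto_free hτ (h2 j)).add (Tendsto.smul ((Complex.continuous_ofReal.tendsto _).comp
      (hτ.const_mul 2)) (tendsto_free hτ (h3 j)))
  refine tendsto_XGraph ?_ (fun j => ?_) fun j => ?_
  · simp only [fstX_freeX]; exact tendsto_free hτ h1
  · simp only [posX_freeX]; exact h4 j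
  · simp only [momX_freeX]; exact tendsto_free hτ (h3 j)

theorem continuous_freeX : Continuous fun p : ℝ × XGraph n => freeX p.1 p.2 :=
  continuous_iff_continuousAt.mpr fun p =>
    tendsto_freeX (continuous_fst.tendsto p) (continuous_snd.tendsto p)

/-! ### Identification of the graph with `X` -/

theorem ap_of_mem {T : L2 n →ₗ.[ℂ] L2 n} {u : L2 n} (h : u ∈ T.domain) : ap T u = T ⟨u, h⟩ :=
  dif_pos h

theorem coeFn_ap_mulOp {f : Rn n → ℝ} {u : L2 n} (h : u ∈ (mulOp f).domain) :
    ∀ᵐ x, ap (mulOp f) u x = (f x : ℂ) * u x := by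
  rw [ap_of_mem h]
  exact (mulDomain_memLp h).coeFn_toLp

theorem mem_mulOp_of_bdd {f : Rn n → ℝ} (hf : BddMeas fun x => (f x : ℂ)) (u : L2 n) :
    u ∈ (mulOp f).domain := hf.memLp u

theorem ap_mulOp_of_bdd {f : Rn n → ℝ} (hf : BddMeas fun x => (f x : ℂ)) (u : L2 n) :
    ap (mulOp f) u = mulR f u := by
  refine L2_ext ?_
  filter_upwards [coeFn_ap_mulOp (mem_mulOp_of_bdd hf u), coeFn_mulC hf u] with x h1 h2
  rw [h1, h2]

/-- Multiplying by `cut 1` makes `xⱼ` bounded, so weak uniqueness applies; `cut 1` vanishes nowhere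
and cancels. -/
theorem WeakOp.ae_eq_coord_mul {j : Fin n} {u a : L2 n} (h : WeakOp (Xop j) u a) :
    ∀ᵐ x, a x = (x j : ℂ) * u x := by
  have e := (h.mulC_pos (bddMeas_cut 1) (temperate_ofReal (temperate_cut 1))).unique
    (weakOp_Xop_mulC (bddMeas_cut 1) (bddMeas_coord_cut one_pos j) u)
  filter_upwards [coeFn_mulC (bddMeas_cut 1) a, coeFn_mulC (bddMeas_coord_cut one_pos j) u]
    with x h1 h2
  have hc : (cut 1 x : ℂ) ≠ 0 := by
    have : 0 < cut 1 x := by unfold cut; positivity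
    exact_mod_cast this.ne'
  rw [e, h2] at h1
  refine mul_left_cancel₀ hc (h1.symm.trans ?_)
  ring

theorem mem_posOp_of_weakOp {j : Fin n} {u a : L2 n} (h : WeakOp (Xop j) u a) :
    u ∈ (posOp j).domain :=
  (Lp.memLp a).ae_eq h.ae_eq_coord_mul

theorem weakOp_ap_posOp {j : Fin n} {u : L2 n} (h : u ∈ (posOp j).domain) :
    WeakOp (Xop j) u (ap (posOp j) u) := weakOp_Xop_of_ae (coeFn_ap_mulOp h)

theorem ap_posOp (z : XGraph n) (j : Fin n) : ap (posOp j) (fstX z) = posX j z :=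
  (weakOp_ap_posOp (mem_posOp_of_weakOp (weak_posX z j))).unique (weak_posX z j)

/-- The complex conjugate of a Schwartz function. -/
def conjS (φ : 𝓢(Rn n, ℂ)) : 𝓢(Rn n, ℂ) := φ.postcompCLM (Complex.conjCLE : ℂ →L[ℝ] ℂ)

theorem conjS_apply (φ : 𝓢(Rn n, ℂ)) (x : Rn n) : conjS φ x = conj (φ x) := rfl

theorem conjS_conjS (φ : 𝓢(Rn n, ℂ)) : conjS (conjS φ) = φ := by
  ext x; rw [conjS_apply, conjS_apply, Complex.conj_conj]

theorem lineDeriv_conjS (v : Rn n) (φ : 𝓢(Rn n, ℂ)) : ∂_{v} (conjS φ) = conjS (∂_{v} φ) := by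
  ext x
  have h : HasFDerivAt (conjS φ) ((Complex.conjCLE : ℂ →L[ℝ] ℂ) ∘L fderiv ℝ φ x) x :=
    (Complex.conjCLE : ℂ →L[ℝ] ℂ).hasFDerivAt.comp x (φ.hasFDerivAt x)
  rw [conjS_apply, SchwartzMap.lineDerivOp_apply_eq_fderiv,
    SchwartzMap.lineDerivOp_apply_eq_fderiv, h.fderiv]
  rfl

/-- Distributions pair bilinearly while the inner product is conjugate-linear in its first slot,
hence the conjugated test function. -/
theorem dist_apply (u : L2 n) (φ : 𝓢(Rn n, ℂ)) : dist u φ = inner ℂ (sch (conjS φ)) u := by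
  have h : dist u φ = ∫ x, φ x • u x := Lp.toTemperedDistribution_apply u φ
  rw [h, inner_eq_integral]
  refine integral_congr_ae ?_
  filter_upwards [coeFn_sch (conjS φ)] with x h1
  rw [h1, conjS_apply, Complex.conj_conj, smul_eq_mul]

theorem momDist_apply (j : Fin n) (u : L2 n) (φ : 𝓢(Rn n, ℂ)) :
    momDist j u φ = inner ℂ (sch (Pop j (conjS φ))) u := by
  have h : momDist j u φ = -Complex.I * dist u (-∂_{dir j} φ) := rfl
  rw [h, map_neg, dist_apply, Pop_eq, lineDeriv_conjS, sch_smul, inner_smul_left]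
  simp

theorem dist_eq_momDist_iff {j : Fin n} {u v : L2 n} :
    dist v = momDist j u ↔ WeakOp (Pop j) u v := by
  constructor
  · intro h φ
    have := DFunLike.congr_fun h (conjS φ)
    rwa [dist_apply, momDist_apply, conjS_conjS] at this
  · intro h
    ext φ
    rw [dist_apply, momDist_apply, h]

theorem mem_momOp_iff {j : Fin n} {u : L2 n} :
    u ∈ (momOp j).domain ↔ ∃ v, WeakOp (Pop j) u v :=
  exists_congr fun _ => dist_eq_momDist_iff

theorem weakOp_ap_momOp {j : Fin n} {u : L2 n} (h : u ∈ (momOp j).domain) :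
    WeakOp (Pop j) u (ap (momOp j) u) := by
  rw [ap_of_mem h]
  exact dist_eq_momDist_iff.mp (dist_momVal h)

theorem ap_momOp (z : XGraph n) (j : Fin n) : ap (momOp j) (fstX z) = momX j z :=
  (weakOp_ap_momOp (mem_momOp_iff.mpr ⟨_, weak_momX z j⟩)).unique (weak_momX z j)

/-! ### The Japanese bracket, membership in `X`, and comparison of norms. -/

theorem one_le_bracket (x : Rn n) : 1 ≤ bracket x :=
  Real.one_le_sqrt.mpr (le_add_of_nonneg_right (sq_nonneg _))

theorem norm_le_bracket (x : Rn n) : ‖x‖ ≤ bracket x :=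
  Real.le_sqrt_of_sq_le (by linarith)

theorem norm_le_sum_coord (x : Rn n) : ‖x‖ ≤ ∑ j, |x j| := by
  rw [EuclideanSpace.norm_eq]
  refine Real.sqrt_le_iff.mpr ⟨Finset.sum_nonneg fun j _ => abs_nonneg _, ?_⟩
  have := Finset.sum_sq_le_sq_sum_of_nonneg (s := Finset.univ) (f := fun j => |x j|)
    fun j _ => abs_nonneg _
  simpa [sq_abs] using this

theorem bracket_le (x : Rn n) : bracket x ≤ 1 + ∑ j, |x j| := by
  refine Real.sqrt_le_iff.mpr ⟨?_, ?_⟩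
  · have := Finset.sum_nonneg (s := Finset.univ) fun j _ => abs_nonneg (x j)
    linarith
  · nlinarith [norm_le_sum_coord x, norm_nonneg x]

theorem continuous_bracket : Continuous (bracket (n := n)) := by unfold bracket; fun_prop

theorem memLp_of_le_coord {u : L2 n} {f : Rn n → ℂ} {C : ℝ}
    (hf : AEStronglyMeasurable f (volume : Measure (Rn n)))
    (hC : ∀ x, ‖f x‖ ≤ C * (1 + ∑ j, |x j|)) (h : ∀ j, ∃ a, WeakOp (Xop j) u a) :
    MemLp (fun x => f x * u x) 2 volume := by
  choose a ha using h
  have h1 : MemLp (fun x => ‖u x‖ + ∑ j, ‖a j x‖) 2 (volume : Measure (Rn n)) :=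
    (Lp.memLp u).norm.add (memLp_finsetSum _ fun j _ => (Lp.memLp (a j)).norm)
  refine h1.of_le_mul (c := C) (hf.mul (Lp.aestronglyMeasurable u)) ?_
  filter_upwards [ae_all_iff.mpr fun j => (ha j).ae_eq_coord_mul] with x hx
  have e : ‖u x‖ + ∑ j, ‖a j x‖ = (1 + ∑ j, |x j|) * ‖u x‖ := by
    rw [add_mul, one_mul, Finset.sum_mul]
    congr 1
    refine Finset.sum_congr rfl fun j _ => ?_
    rw [hx j, norm_mul, Complex.norm_real, Real.norm_eq_abs]
  rw [e, Real.norm_eq_abs, abs_of_nonneg, norm_mul, ← mul_assoc]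
  · exact mul_le_mul_of_nonneg_right (hC x) (norm_nonneg _)
  · exact mul_nonneg (by have := Finset.sum_nonneg (s := Finset.univ) fun j _ => abs_nonneg (x j)
                         linarith) (norm_nonneg _)

theorem memLp_bracket_mul {u : L2 n} (h : ∀ j, ∃ a, WeakOp (Xop j) u a) :
    MemLp (fun x => (bracket x : ℂ) * u x) 2 volume := by
  refine memLp_of_le_coord (C := 1)
    (Complex.continuous_ofReal.comp continuous_bracket).aestronglyMeasurable (fun x => ?_) h
  rw [Complex.norm_real, Real.norm_eq_abs, abs_of_nonneg (zero_le_one.trans (one_le_bracket x)),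
    one_mul]
  exact bracket_le x

theorem mem_posOp_of_bracket {u : L2 n} (h : u ∈ (mulOp (bracket (n := n))).domain) (j : Fin n) :
    u ∈ (posOp j).domain := by
  refine MemLp.of_le_mul (c := 1) (mulDomain_memLp h)
    ((temperate_coord j).1.continuous.aestronglyMeasurable.mul (Lp.aestronglyMeasurable u)) ?_
  filter_upwards with x
  rw [one_mul, norm_mul, norm_mul, Complex.norm_real, Complex.norm_real, Real.norm_eq_abs,
    Real.norm_eq_abs]
  exact mul_le_mul_of_nonneg_right ((abs_coord_le x j).trans ((norm_le_bracket x).trans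
    (le_abs_self _))) (norm_nonneg _)

theorem mem_momOp_of_mem_H1 {u : L2 n} (h : u ∈ H1 n) (j : Fin n) : u ∈ (momOp j).domain := by
  have h1 : TemperedDistribution.MemSobolev (1 - 1) 2 (∂_{dir j} (dist u)) :=
    TemperedDistribution.MemSobolev.lineDerivOp h
  rw [sub_self, TemperedDistribution.memSobolev_zero_iff] at h1
  obtain ⟨f, hf⟩ := h1
  refine ⟨(-Complex.I) • f, ?_⟩
  rw [map_smul, momDist, hf]
  rfl

/-- On the Fourier side the hypothesis says that every `ξⱼ û` is in `L²`; hence so is `⟨ξ⟩û`, which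
is the Fourier criterion for `H¹`. -/
theorem mem_H1_of_momOp {u : L2 n} (h : ∀ j, ∃ b, WeakOp (Pop j) u b) : u ∈ H1 n := by
  have h1 : ∀ j, ∃ a, WeakOp (Xop j) (FL u) a := fun j => by
    obtain ⟨b, hb⟩ := h j
    exact ⟨_, weakOp_Pop_iff.mp hb⟩
  have hm := memLp_bracket_mul h1
  refine TemperedDistribution.memSobolev_iff_exists_smulLeftCLM_fourier.mpr ⟨hm.toLp, ?_⟩
  have e1 : 𝓕 (dist u) = dist (FL u) := Lp.fourier_toTemperedDistribution_eq u
  have e2 : (fun x : Rn n => (((1 + ‖x‖ ^ 2) ^ ((1 : ℝ) / 2) : ℝ) : ℂ)) =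
      fun x => (bracket x : ℂ) := by
    ext x; rw [bracket, Real.sqrt_eq_rpow]
  have ht : (fun x : Rn n => (bracket x : ℂ)).HasTemperateGrowth := by
    rw [← e2]
    exact temperate_ofReal (Function.hasTemperateGrowth_one_add_norm_sq_rpow (Rn n) (1 / 2))
  rw [e1, e2]
  ext φ
  rw [TemperedDistribution.smulLeftCLM_apply_apply]
  change (dist (FL u)) _ = Lp.toTemperedDistribution _ φ
  rw [Lp.toTemperedDistribution_apply,
    show dist (FL u) = Lp.toTemperedDistribution (FL u) from rfl, Lp.toTemperedDistribution_apply]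
  refine integral_congr_ae ?_
  filter_upwards [hm.coeFn_toLp] with x hx
  rw [hx, SchwartzMap.smulLeftCLM_apply_apply ht, smul_eq_mul, smul_eq_mul, smul_eq_mul]
  ring

theorem fstX_mem (z : XGraph n) : fstX z ∈ X n :=
  ⟨mem_H1_of_momOp fun j => ⟨_, weak_momX z j⟩, memLp_bracket_mul fun j => ⟨_, weak_posX z j⟩⟩

theorem exists_fstX_eq {u : L2 n} (hu : u ∈ X n) : ∃ z : XGraph n, fstX z = u :=
  ⟨mkX u (fun j => ap (posOp j) u) (fun j => ap (momOp j) u)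
    (fun j => weakOp_ap_posOp (mem_posOp_of_bracket hu.2 j))
    (fun j => weakOp_ap_momOp (mem_momOp_of_mem_H1 hu.1 j)), rfl⟩

/-- This direction suffices: convergence in `xNorm` forces convergence in the graph, so forms
continuous on `XGraph` satisfy `ExtendsTo`. -/
theorem norm_le_xNorm (z : XGraph n) : ‖z‖ ≤ xNorm (fstX z) := by
  have hb := coeFn_ap_mulOp (fstX_mem z).2
  have hle : ∀ (v : L2 n) (f : Rn n → ℂ), (∀ x, ‖f x‖ ≤ bracket x) →
      (∀ᵐ x, v x = f x * fstX z x) → ‖v‖ ≤ ‖ap (mulOp bracket) (fstX z)‖ := by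
    intro v f hf hv
    rw [← one_mul ‖ap (mulOp bracket) (fstX z)‖]
    refine norm_le_of_ae ?_
    filter_upwards [hb, hv] with x h1 h2
    rw [h1, h2, one_mul, norm_mul, norm_mul, Complex.norm_real, Real.norm_eq_abs]
    exact mul_le_mul_of_nonneg_right ((hf x).trans (le_abs_self _)) (norm_nonneg _)
  have hs : 0 ≤ ∑ j, ‖ap (momOp j) (fstX z)‖ := Finset.sum_nonneg fun j _ => norm_nonneg _
  have hn := norm_nonneg (ap (mulOp bracket) (fstX z))
  have h0 : ‖fstX z‖ ≤ ‖ap (mulOp bracket) (fstX z)‖ := by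
    refine hle (fstX z) (fun _ => 1) (fun x => ?_) ?_
    · rw [norm_one]; exact one_le_bracket x
    · filter_upwards with x; rw [one_mul]
  have h1 : ∀ j, ‖posX j z‖ ≤ ‖ap (mulOp bracket) (fstX z)‖ := fun j => by
    refine hle (posX j z) (fun x => (x j : ℂ)) (fun x => ?_) (weak_posX z j).ae_eq_coord_mul
    rw [Complex.norm_real]; exact (abs_coord_le x j).trans (norm_le_bracket x)
  have h2 : ∀ j, ‖momX j z‖ ≤ ∑ j, ‖ap (momOp j) (fstX z)‖ := fun j => by
    rw [← ap_momOp z j]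
    exact Finset.single_le_sum (f := fun j => ‖ap (momOp j) (fstX z)‖)
      (fun i _ => norm_nonneg _) (Finset.mem_univ j)
  have hR := add_nonneg hn hs
  change ‖z‖ ≤ ‖ap (mulOp bracket) (fstX z)‖ + ∑ j, ‖ap (momOp j) (fstX z)‖
  exact normX_le hR (h0.trans (le_add_of_nonneg_right hs))
    (fun j => (h1 j).trans (le_add_of_nonneg_right hs))
    fun j => (h2 j).trans (le_add_of_nonneg_left hn)

/-! ### Time-dependent potentials -/

theorem BoundedDiff.add {f g : Rn n → ℝ} (hf : BoundedDiff f) (hg : BoundedDiff g) :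
    BoundedDiff (f + g) := by
  obtain ⟨M, hM⟩ := hf.bounded
  obtain ⟨N, hN⟩ := hg.bounded
  refine ⟨hf.differentiable.add hg.differentiable, M + N, fun x => ⟨?_, ?_⟩⟩
  · exact (abs_add_le _ _).trans (add_le_add (hM x).1 (hN x).1)
  · have : gradient (f + g) x = gradient f x + gradient g x := by
      simp only [gradient, fderiv_add (hf.differentiable x) (hg.differentiable x), map_add]
    rw [this]
    exact (norm_add_le _ _).trans (add_le_add (hM x).2 (hN x).2)

theorem BoundedDiffTime.boundedDiff {U : ℝ → Rn n → ℝ} (hU : BoundedDiffTime U) {t : ℝ}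
    (ht : 0 < t) : BoundedDiff (U t) := by
  obtain ⟨M, hM⟩ := hU.bounded t
  exact ⟨hU.differentiable_space t ht, M, fun x => ⟨(hM t ht le_rfl x).1, (hM t ht le_rfl x).2.1⟩⟩

theorem dt_const_add (V : Rn n → ℝ) (W : ℝ → Rn n → ℝ) (t : ℝ) :
    dt (fun s => V + W s) t = dt W t := by
  ext x
  exact congrFun (deriv_const_add' (f := fun s => W s x) (V x)) t

theorem BoundedDiffTime.const_add {V : Rn n → ℝ} {W : ℝ → Rn n → ℝ} (hV : BoundedDiff V)
    (hW : BoundedDiffTime W) : BoundedDiffTime fun t => V + W t := by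
  refine ⟨fun t ht => hV.differentiable.add (hW.differentiable_space t ht),
    fun t ht x => (hW.differentiable_time t ht x).const_add (V x), fun T => ?_⟩
  obtain ⟨M, hM⟩ := hV.bounded
  obtain ⟨N, hN⟩ := hW.bounded T
  refine ⟨M + N, fun t h0 hT x => ⟨?_, ?_, ?_⟩⟩
  · exact (abs_add_le _ _).trans (add_le_add (hM x).1 (hN t h0 hT x).1)
  · have : gradient (V + W t) x = gradient V x + gradient (W t) x := by
      simp only [gradient, fderiv_add (hV.differentiable x) (hW.differentiable_space t h0 x),
        map_add]
    rw [this]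
    exact (norm_add_le _ _).trans (add_le_add (hM x).2 (hN t h0 hT x).2.1)
  · rw [dt_const_add]
    exact (hN t h0 hT x).2.2.trans (le_add_of_nonneg_left ((abs_nonneg _).trans (hM x).1))

theorem BoundedDiffTime.abs_sub_le {U : ℝ → Rn n → ℝ} (hU : BoundedDiffTime U) {T M : ℝ}
    (hM : ∀ t, 0 < t → t ≤ T → ∀ x, |U t x| ≤ M ∧ ‖gradient (U t) x‖ ≤ M ∧ |dt U t x| ≤ M)
    {s t : ℝ} (hs : 0 < s) (hsT : s ≤ T) (ht : 0 < t) (htT : t ≤ T) (x : Rn n) :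
    |U s x - U t x| ≤ M * |s - t| :=
  (convex_Ioc 0 T).norm_image_sub_le_of_norm_hasDerivWithin_le (f := fun r => U r x)
    (fun r hr => (hU.differentiable_time r hr.1 x).hasDerivAt.hasDerivWithinAt)
    (fun r hr => (hM r hr.1 hr.2 x).2.2) ⟨ht, htT⟩ ⟨hs, hsT⟩

/-- A pointwise limit of the difference quotients at the times `t + 1/(k+1)`, which are continuous
in `x`. -/
theorem BoundedDiffTime.measurable_dt {U : ℝ → Rn n → ℝ} (hU : BoundedDiffTime U) {t : ℝ}
    (ht : 0 < t) : Measurable (dt U t) := by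
  refine measurable_of_tendsto_metrizable (f := fun (k : ℕ) x =>
    (1 / ((k : ℝ) + 1))⁻¹ • (U (t + 1 / ((k : ℝ) + 1)) x - U t x)) (fun k => ?_) ?_
  · have hk : 0 < t + 1 / ((k : ℝ) + 1) := by positivity
    have hm : Measurable fun x => U (t + 1 / ((k : ℝ) + 1)) x - U t x :=
      (hU.differentiable_space _ hk).continuous.measurable.sub
        (hU.differentiable_space t ht).continuous.measurable
    exact hm.const_smul ((1 / ((k : ℝ) + 1))⁻¹)
  · refine tendsto_pi_nhds.mpr fun x => ?_
    have h1 := (hasDerivAt_iff_tendsto_slope_zero.mp (hU.differentiable_time t ht x).hasDerivAt)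
    refine h1.comp (tendsto_nhdsWithin_iff.mpr ⟨tendsto_one_div_add_atTop_nhds_zero_nat, ?_⟩)
    exact Eventually.of_forall fun k => (Nat.one_div_pos_of_nat (n := k)).ne'

theorem BoundedDiffTime.bddMeas_dt {U : ℝ → Rn n → ℝ} (hU : BoundedDiffTime U) {t : ℝ}
    (ht : 0 < t) : BddMeas (fun x => (dt U t x : ℂ)) := by
  obtain ⟨M, hM⟩ := hU.bounded t
  exact .ofReal (hU.measurable_dt ht).aestronglyMeasurable fun x => (hM t ht le_rfl x).2.2

theorem BoundedDiffTime.norm_mulR_sub_le {U : ℝ → Rn n → ℝ} (hU : BoundedDiffTime U) {T M : ℝ}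
    (hM : ∀ t, 0 < t → t ≤ T → ∀ x, |U t x| ≤ M ∧ ‖gradient (U t) x‖ ≤ M ∧ |dt U t x| ≤ M)
    {s t : ℝ} (hs : 0 < s) (hsT : s ≤ T) (ht : 0 < t) (htT : t ≤ T) (u : L2 n) :
    ‖mulR (U s) u - mulR (U t) u‖ ≤ M * |s - t| * ‖u‖ := by
  refine norm_le_of_ae ?_
  filter_upwards [Lp.coeFn_sub (mulR (U s) u) (mulR (U t) u),
    coeFn_mulC (hU.boundedDiff hs).bddMeas u, coeFn_mulC (hU.boundedDiff ht).bddMeas u]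
    with x h1 h2 h3
  rw [h1, Pi.sub_apply, h2, h3, ← sub_mul, norm_mul, ← Complex.ofReal_sub, Complex.norm_real]
  exact mul_le_mul_of_nonneg_right (hU.abs_sub_le hM hs hsT ht htT x) (norm_nonneg _)

theorem BoundedDiffTime.tendsto_mulR {U : ℝ → Rn n → ℝ} (hU : BoundedDiffTime U) {t : ℝ}
    (ht : 0 < t) {w : ℝ → L2 n} {u : L2 n} (hw : Tendsto w (𝓝 t) (𝓝 u)) :
    Tendsto (fun s => mulR (U s) (w s)) (𝓝 t) (𝓝 (mulR (U t) u)) := by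
  obtain ⟨M, hM⟩ := hU.bounded (t + 1)
  have h1 : Tendsto (fun s => mulR (U t) (w s)) (𝓝 t) (𝓝 (mulR (U t) u)) :=
    ((mulR (U t)).continuous.tendsto u).comp hw
  have h2 : Tendsto (fun s => mulR (U s) (w s) - mulR (U t) (w s)) (𝓝 t) (𝓝 0) := by
    have h3 : Tendsto (fun s => M * |s - t| * ‖w s‖) (𝓝 t) (𝓝 (M * |t - t| * ‖u‖)) :=
      ((continuous_const.mul (continuous_id.sub continuous_const).abs).tendsto t).mul hw.norm
    rw [sub_self, abs_zero, mul_zero, zero_mul] at h3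
    refine squeeze_zero_norm' ?_ h3
    filter_upwards [Ioo_mem_nhds ht (lt_add_one t)] with s hs
    exact hU.norm_mulR_sub_le hM hs.1 hs.2.le ht (le_add_of_nonneg_right zero_le_one) _
  have h4 := h2.add h1
  rw [zero_add] at h4
  exact h4.congr fun s => sub_add_cancel _ _

/-! ### The interaction picture -/

/-- `ψ` is a weak solution of `i ∂ₜψ = (-Δ + U(t)) ψ`, `t > 0`. -/
structure Evolves (U : ℝ → Rn n → ℝ) (ψ : ℝ → L2 n) : Prop where
  potential : BoundedDiffTime U
  continuousOn : ContinuousOn ψ (Ici 0)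
  equation : ∀ φ : 𝓢(Rn n, ℂ), ∀ t > 0,
    HasDerivAt (fun s => inner ℂ (sch φ) (ψ s)) (-Complex.I * inner ℂ (ham (U t) φ) (ψ t)) t

/-- The scalar mean value inequality has error `ε‖sch φ‖` on a neighbourhood independent of `φ`, so
the estimate passes to the norm. -/
theorem hasDerivAt_of_weak {v g : ℝ → L2 n} {t : ℝ}
    (hd : ∀ᶠ s in 𝓝 t, ∀ φ : 𝓢(Rn n, ℂ),
      HasDerivAt (fun r => inner ℂ (sch φ) (v r)) (inner ℂ (sch φ) (g s)) s)
    (hg : ContinuousAt g t) : HasDerivAt v (g t) t := by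
  rw [hasDerivAt_iff_isLittleO, Asymptotics.isLittleO_iff]
  intro ε hε
  have h1 : ∀ᶠ s in 𝓝 t, ‖g s - g t‖ ≤ ε := by
    filter_upwards [Metric.tendsto_nhds.mp hg ε hε] with s hs
    rw [← dist_eq_norm]; exact hs.le
  obtain ⟨δ, hδ, hb⟩ := Metric.eventually_nhds_iff_ball.mp (hd.and h1)
  filter_upwards [Metric.ball_mem_nhds t hδ] with s hs
  refine norm_le_of_inner_sch (mul_nonneg hε.le (norm_nonneg _)) fun φ => ?_
  have h2 := (convex_ball t δ).norm_image_sub_le_of_norm_hasDerivWithin_le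
    (f := fun r => inner ℂ (sch φ) (v r) - r • inner ℂ (sch φ) (g t))
    (f' := fun r => inner ℂ (sch φ) (g r) - (1 : ℝ) • inner ℂ (sch φ) (g t)) (C := ε * ‖sch φ‖)
    (fun r hr => (((hb r hr).1 φ).sub
      ((hasDerivAt_id r).smul_const (inner ℂ (sch φ) (g t)))).hasDerivWithinAt)
    (fun r hr => ?_) (Metric.mem_ball_self hδ) hs
  · convert h2 using 1
    · rw [inner_sub_right, inner_sub_right, inner_smul_right_eq_smul, sub_smul]
      congr 1; abel
    · ring
  · rw [one_smul, ← inner_sub_right, mul_comm]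
    exact (norm_inner_le_norm _ _).trans
      (mul_le_mul_of_nonneg_left (hb r hr).2 (norm_nonneg _))

/-- A product rule for a second factor that is merely continuous: its increment is multiplied by a
factor vanishing at `t`. -/
theorem hasDerivAt_inner_of_eq_zero {r z : ℝ → L2 n} {r' : L2 n} {t : ℝ} (hr : HasDerivAt r r' t)
    (h0 : r t = 0) (hz : ContinuousAt z t) :
    HasDerivAt (fun s => inner ℂ (r s) (z s)) (inner ℂ r' (z t)) t := by
  rw [hasDerivAt_iff_tendsto_slope] at hr ⊢
  have h1 := hr.inner (𝕜 := ℂ) (hz.tendsto.mono_left nhdsWithin_le_nhds)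
  refine h1.congr fun s => ?_
  rw [slope_def_module, slope_def_module, h0, inner_zero_left, sub_zero, sub_zero,
    inner_smul_left_eq_smul]

section Evolves

variable {U : ℝ → Rn n → ℝ} {ψ : ℝ → L2 n}

theorem Evolves.continuousAt (h : Evolves U ψ) {t : ℝ} (ht : 0 < t) : ContinuousAt ψ t :=
  h.continuousOn.continuousAt (Ici_mem_nhds ht)

/-- The moving test function `free s φ` is split as its value at `t` plus an increment vanishing at
`t`. The first part falls under the weak equation, the second under `hasDerivAt_inner_of_eq_zero`,
and the Laplacians cancel. -/
theorem Evolves.hasDerivAt_inner (h : Evolves U ψ) {t : ℝ} (ht : 0 < t) (φ : 𝓢(Rn n, ℂ)) :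
    HasDerivAt (fun s => inner ℂ (sch φ) (free (-s) (ψ s)))
      (inner ℂ (sch φ) ((-Complex.I) • free (-t) (mulR (U t) (ψ t)))) t := by
  have hr : HasDerivAt (fun s => free s (sch φ) - free t (sch φ))
      (Complex.I • sch (Δ (freeS t φ))) t := (hasDerivAt_free_sch φ t).sub_const _
  have h1 := hasDerivAt_inner_of_eq_zero hr (sub_self _) (h.continuousAt ht)
  have h2 := h1.add (h.equation (freeS t φ) t ht)
  have e1 : (fun s => inner ℂ (sch φ) (free (-s) (ψ s))) =
      (fun s => inner ℂ (free s (sch φ) - free t (sch φ)) (ψ s)) +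
        fun s => inner ℂ (sch (freeS t φ)) (ψ s) := by
    ext s
    rw [Pi.add_apply, inner_free_right, neg_neg, ← free_sch, inner_sub_left, sub_add_cancel]
  rw [e1]
  refine h2.congr_deriv ?_
  have hb := (h.potential.boundedDiff ht).bddMeas
  rw [ham, ap_mulOp_of_bdd hb, inner_smul_right, inner_free_right, neg_neg, free_sch,
    inner_mulR hb, inner_add_left, inner_neg_left, inner_smul_left, Complex.conj_I]
  ring

theorem Evolves.tendsto_deriv (h : Evolves U ψ) {t : ℝ} (ht : 0 < t) :
    ContinuousAt (fun s => (-Complex.I) • free (-s) (mulR (U s) (ψ s))) t :=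
  (tendsto_free (continuous_neg.tendsto t)
    (h.potential.tendsto_mulR ht (h.continuousAt ht))).const_smul _

theorem Evolves.hasDerivAt_free (h : Evolves U ψ) {t : ℝ} (ht : 0 < t) :
    HasDerivAt (fun s => free (-s) (ψ s)) ((-Complex.I) • free (-t) (mulR (U t) (ψ t))) t :=
  hasDerivAt_of_weak (g := fun s => (-Complex.I) • free (-s) (mulR (U s) (ψ s)))
    (by filter_upwards [Ioi_mem_nhds ht] with s hs φ using h.hasDerivAt_inner hs φ)
    (h.tendsto_deriv ht)

end Evolves

/-! ### Propagation of regularity -/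

theorem exists_fstX_of_weak {u : L2 n} {R : ℝ} (hR : 0 ≤ R) (h : ‖u‖ ≤ R)
    (hx : ∀ j φ, ‖inner ℂ (sch (Xop j φ)) u‖ ≤ R * ‖sch φ‖)
    (hp : ∀ j φ, ‖inner ℂ (sch (Pop j φ)) u‖ ≤ R * ‖sch φ‖) :
    ∃ z : XGraph n, fstX z = u ∧ ‖z‖ ≤ R := by
  choose a ha using fun j => exists_weakOp hR (hx j)
  choose b hb using fun j => exists_weakOp hR (hp j)
  exact ⟨mkX u a b (fun j => (ha j).1) fun j => (hb j).1, rfl,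
    normX_le hR h (fun j => (ha j).2) fun j => (hb j).2⟩

/-- Balls of `X` are closed in `L²`: the bounds on the pairings with `xⱼφ` and `pⱼφ` survive the
limit, and Riesz representation recovers the components. -/
theorem exists_fstX_of_approx {u : L2 n} {R : ℝ} (hR : 0 ≤ R)
    (h : ∀ ε > 0, ∃ a : XGraph n, ‖a‖ ≤ R ∧ ‖u - fstX a‖ ≤ ε) :
    ∃ z : XGraph n, fstX z = u ∧ ‖z‖ ≤ R := by
  have key : ∀ (w : L2 n) (c : ℝ), 0 ≤ c →
      (∀ a : XGraph n, ‖inner ℂ w (fstX a)‖ ≤ c * ‖a‖) → ‖inner ℂ w u‖ ≤ R * c := by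
    intro w c hc hw
    refine le_of_forall_pos_le_add fun δ hδ => ?_
    have hw1 : 0 < ‖w‖ + 1 := by positivity
    obtain ⟨a, ha, hε⟩ := h (δ / (‖w‖ + 1)) (by positivity)
    have e : inner ℂ w u = inner ℂ w (fstX a) + inner ℂ w (u - fstX a) := by
      rw [inner_sub_right]; ring
    rw [e]
    refine (norm_add_le _ _).trans (add_le_add ((hw a).trans ?_) ?_)
    · rw [mul_comm]; exact mul_le_mul_of_nonneg_right ha hc
    · refine (norm_inner_le_norm _ _).trans ?_
      calc ‖w‖ * ‖u - fstX a‖ ≤ (‖w‖ + 1) * (δ / (‖w‖ + 1)) := by gcongr; linarith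
        _ = δ := by field_simp
  refine exists_fstX_of_weak hR (le_of_forall_pos_le_add fun ε hε => ?_) (fun j φ => ?_)
    fun j φ => ?_
  · obtain ⟨a, ha, hu⟩ := h ε hε
    have := norm_add_le (fstX a) (u - fstX a)
    rw [add_sub_cancel] at this
    exact this.trans (add_le_add ((norm_fstX_le a).trans ha) hu)
  · refine key _ _ (norm_nonneg _) fun a => ?_
    rw [← weak_posX a j φ]
    exact (norm_inner_le_norm _ _).trans
      (mul_le_mul_of_nonneg_left (norm_posX_le a j) (norm_nonneg _))
  · refine key _ _ (norm_nonneg _) fun a => ?_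
    rw [← weak_momX a j φ]
    exact (norm_inner_le_norm _ _).trans
      (mul_le_mul_of_nonneg_left (norm_momX_le a j) (norm_nonneg _))

/-- The `K`-functional of the pair `(X, L²)`. -/
def kFun (ε : ℝ) (u : L2 n) : ℝ := ⨅ a : XGraph n, (‖a‖ + ‖u - fstX a‖ / ε)

section kFun

variable {ε : ℝ}

theorem kFun_le (hε : 0 < ε) (u : L2 n) (a : XGraph n) : kFun ε u ≤ ‖a‖ + ‖u - fstX a‖ / ε :=
  ciInf_le ⟨0, by rintro _ ⟨b, rfl⟩; positivity⟩ a

theorem kFun_le_add (hε : 0 < ε) (u w : L2 n) : kFun ε u ≤ kFun ε w + ‖u - w‖ / ε := by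
  rw [← sub_le_iff_le_add]
  refine le_ciInf fun a => ?_
  rw [sub_le_iff_le_add]
  refine (kFun_le hε u a).trans ?_
  have h1 : ‖u - fstX a‖ / ε ≤ (‖w - fstX a‖ + ‖u - w‖) / ε := by
    gcongr
    rw [add_comm, ← sub_add_sub_cancel u w]
    exact norm_add_le _ _
  rw [add_div] at h1
  linarith

theorem abs_kFun_sub_le (hε : 0 < ε) (u w : L2 n) : |kFun ε u - kFun ε w| ≤ ‖u - w‖ / ε := by
  rw [abs_sub_le_iff]
  have h1 := kFun_le_add hε u w
  have h2 := kFun_le_add hε w u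
  rw [norm_sub_rev] at h2
  constructor <;> linarith

theorem continuous_kFun (hε : 0 < ε) : Continuous (kFun (n := n) ε) := by
  refine continuous_iff_continuousAt.mpr fun w => tendsto_iff_dist_tendsto_zero.mpr ?_
  have h1 : Tendsto (fun u : L2 n => ‖u - w‖ / ε) (𝓝 w) (𝓝 (‖w - w‖ / ε)) :=
    Continuous.tendsto (by fun_prop) w
  rw [sub_self, norm_zero, zero_div] at h1
  exact squeeze_zero (fun _ => dist_nonneg) (fun u => abs_kFun_sub_le hε u w) h1

/-- By `hA` every decomposition of `u` yields one of `w` with both parts multiplied by at most `C`.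
An Euler step thus enlarges the functional by `1 + hC`, whatever `ε` is. -/
theorem kFun_add_smul_le (hε : 0 < ε) {u w : L2 n} {C h : ℝ} (hC : 0 ≤ C) (hh : 0 ≤ h)
    (hA : ∀ a : XGraph n, ∃ b : XGraph n, ‖b‖ ≤ C * ‖a‖ ∧ ‖w - fstX b‖ ≤ C * ‖u - fstX a‖) :
    kFun ε (u + h • w) ≤ (1 + h * C) * kFun ε u := by
  have h0 : 0 < 1 + h * C := by positivity
  rw [← div_le_iff₀' h0]
  refine le_ciInf fun a => ?_
  rw [div_le_iff₀' h0]
  obtain ⟨b, hb, hw⟩ := hA a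
  refine (kFun_le hε _ (a + (h : ℂ) • b)).trans ?_
  have e : u + h • w - fstX (a + (h : ℂ) • b) = (u - fstX a) + h • (w - fstX b) := by
    rw [map_add, map_smul, Complex.coe_smul, smul_sub]; abel
  have h1 : ‖a + (h : ℂ) • b‖ ≤ ‖a‖ + h * (C * ‖a‖) := by
    refine (norm_add_le _ _).trans ?_
    rw [norm_smul, Complex.norm_real, Real.norm_of_nonneg hh]
    gcongr
  have h2 : ‖(u - fstX a) + h • (w - fstX b)‖ / ε ≤
      (‖u - fstX a‖ + h * (C * ‖u - fstX a‖)) / ε := by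
    gcongr
    refine (norm_add_le _ _).trans ?_
    rw [norm_smul, Real.norm_of_nonneg hh]
    gcongr
  rw [e]
  refine (add_le_add h1 h2).trans (le_of_eq ?_)
  ring

end kFun

/-- Gronwall for `kFun ε` along `v`, with a constant free of `ε`. Membership of `v t` in `X` is a
conclusion and is never assumed on the way, since `kFun` is finite on all of `L²`; letting the
parameter tend to `0` recovers it. -/
theorem exists_fstX_of_hasDerivAt {v v' : ℝ → L2 n} {T C : ℝ} (hC : 0 ≤ C)
    (hc : ContinuousOn v (Icc 0 T)) (hd : ∀ t ∈ Ioc 0 T, HasDerivAt v (v' t) t)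
    (hA : ∀ t ∈ Ioc 0 T, ∀ a : XGraph n, ∃ b : XGraph n, ‖b‖ ≤ C * ‖a‖ ∧
      ‖v' t - fstX b‖ ≤ C * ‖v t - fstX a‖) {z : XGraph n} (hz : fstX z = v 0) :
    ∃ R : ℝ, 0 ≤ R ∧ ∀ t ∈ Icc 0 T, ∃ a : XGraph n, fstX a = v t ∧ ‖a‖ ≤ R := by
  have main : ∀ ε > 0, ∀ t ∈ Ioc 0 T, kFun ε (v t) ≤ ‖z‖ * Real.exp (C * t) := by
    intro ε hε t ht
    have hcont : ContinuousOn (fun s => kFun ε (v s)) (Icc 0 T) :=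
      (continuous_kFun hε).comp_continuousOn hc
    -- The derivative exists only at positive times, so the estimate starts at `δ > 0`; continuity
    -- then allows `δ → 0`.
    have step : ∀ δ ∈ Ioc 0 t, kFun ε (v t) ≤ kFun ε (v δ) * Real.exp (C * (t - δ)) := by
      intro δ hδ
      rw [← gronwallBound_ε0]
      refine le_gronwallBound_of_liminf_deriv_right_le (f' := fun x => C * kFun ε (v x))
        (hcont.mono (Icc_subset_Icc hδ.1.le ht.2)) (fun x hx r hr => ?_) le_rfl
        (fun x _ => (add_zero _).ge) t ⟨hδ.2, le_rfl⟩
      have hx' : x ∈ Ioc 0 T := ⟨hδ.1.trans_le hx.1, hx.2.le.trans ht.2⟩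
      have h1 : Tendsto (slope v x) (𝓝[>] x) (𝓝 (v' x)) :=
        (hasDerivAt_iff_tendsto_slope.mp (hd x hx')).mono_left
          (nhdsWithin_mono _ fun y hy => ne_of_gt hy)
      have h2 : Tendsto (fun y => C * kFun ε (v x) + ‖slope v x y - v' x‖ / ε) (𝓝[>] x)
          (𝓝 (C * kFun ε (v x) + ‖v' x - v' x‖ / ε)) :=
        ((h1.sub_const _).norm.div_const _).const_add _
      rw [sub_self, norm_zero, zero_div, add_zero] at h2
      refine Eventually.frequently ?_
      filter_upwards [h2.eventually_lt_const hr, self_mem_nhdsWithin] with y hy hxy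
      refine lt_of_le_of_lt ?_ hy
      have hpos : 0 < y - x := sub_pos.mpr hxy
      have h3 := kFun_le_add hε (v y) (v x + (y - x) • v' x)
      have h4 := kFun_add_smul_le hε hC hpos.le (hA x hx')
      have h5 : v y - (v x + (y - x) • v' x) = (y - x) • (slope v x y - v' x) := by
        rw [slope_def_module, smul_sub, smul_inv_smul₀ hpos.ne']; abel
      rw [h5, norm_smul, Real.norm_of_nonneg hpos.le] at h3
      rw [inv_mul_le_iff₀ hpos]
      calc kFun ε (v y) - kFun ε (v x) ≤
          (1 + (y - x) * C) * kFun ε (v x) + (y - x) * ‖slope v x y - v' x‖ / ε - kFun ε (v x) := by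
            linarith
        _ = _ := by ring
    have h0 : (0 : ℝ) ∈ Icc 0 T := ⟨le_rfl, ht.1.le.trans ht.2⟩
    have hlim : Tendsto (fun δ => kFun ε (v δ) * Real.exp (C * (t - δ))) (𝓝[>] 0)
        (𝓝 (kFun ε (v 0) * Real.exp (C * (t - 0)))) := by
      refine Tendsto.mul ?_ ?_
      · refine (hcont 0 h0).mono_left ?_
        rw [← nhdsWithin_Ioc_eq_nhdsGT (ht.1.trans_le ht.2)]
        exact nhdsWithin_mono _ Ioc_subset_Icc_self
      · exact (Continuous.tendsto (by fun_prop) (0 : ℝ)).mono_left nhdsWithin_le_nhds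
    have h6 := ge_of_tendsto hlim
      (by filter_upwards [Ioc_mem_nhdsGT ht.1] with δ hδ using step δ hδ)
    rw [sub_zero] at h6
    refine h6.trans (mul_le_mul_of_nonneg_right ?_ (Real.exp_nonneg _))
    have := kFun_le hε (v 0) z
    rwa [hz, sub_self, norm_zero, zero_div, add_zero] at this
  have hR : 0 ≤ ‖z‖ * Real.exp (C * T) := by positivity
  -- The added `1` makes the bound on the infimum strict, so some decomposition attains it.
  refine ⟨‖z‖ * Real.exp (C * T) + 1, by positivity, fun t ht => ?_⟩
  rcases ht.1.eq_or_lt with rfl | h0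
  · refine ⟨z, hz, ?_⟩
    have : 1 ≤ Real.exp (C * T) := Real.one_le_exp (mul_nonneg hC ht.2)
    nlinarith [norm_nonneg z]
  refine exists_fstX_of_approx (by positivity) fun ε hε => ?_
  set R := ‖z‖ * Real.exp (C * T) + 1 with hRdef
  have hRpos : 0 < R := by positivity
  -- With parameter `ε / R`, a decomposition of cost below `R` has `‖a‖ ≤ R` and an `L²` error of at
  -- most `(ε / R) R = ε`.
  have h1 : kFun (ε / R) (v t) < R := by
    refine (main (ε / R) (by positivity) t ⟨h0, ht.2⟩).trans_lt (lt_of_le_of_lt ?_ (lt_add_one _))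
    gcongr
    exact ht.2
  obtain ⟨a, ha⟩ := exists_lt_of_ciInf_lt h1
  have h2 : 0 ≤ ‖v t - fstX a‖ / (ε / R) := by positivity
  refine ⟨a, by linarith, ?_⟩
  have h3 : ‖v t - fstX a‖ / (ε / R) ≤ R := by linarith [norm_nonneg a]
  rw [div_le_iff₀ (by positivity)] at h3
  rwa [mul_div_cancel₀ _ hRpos.ne'] at h3

/-- A mean value inequality in the norm of `X` although `v` is only differentiable in `L²`: it is
applied to the scalar pairings with `xⱼφ` and `pⱼφ`. -/
theorem exists_fstX_sub_of_hasDerivAt {v v' : ℝ → L2 n} {s : Set ℝ} {R : ℝ} (hs : Convex ℝ s)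
    (hd : ∀ t ∈ s, HasDerivAt v (v' t) t)
    (hv' : ∀ t ∈ s, ∃ b : XGraph n, fstX b = v' t ∧ ‖b‖ ≤ R) {t r : ℝ} (ht : t ∈ s) (hr : r ∈ s) :
    ∃ b : XGraph n, fstX b = v r - v t ∧ ‖b‖ ≤ R * |r - t| := by
  have hR : 0 ≤ R := by
    obtain ⟨b, -, hb⟩ := hv' t ht
    exact (norm_nonneg b).trans hb
  have key : ∀ (w : L2 n) (c : ℝ), (∀ a : XGraph n, ‖inner ℂ w (fstX a)‖ ≤ c * ‖a‖) → 0 ≤ c →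
      ‖inner ℂ w (v r - v t)‖ ≤ R * |r - t| * c := by
    intro w c hw hc
    have := hs.norm_image_sub_le_of_norm_hasDerivWithin_le (f := fun x => inner ℂ w (v x))
      (f' := fun x => inner ℂ w (v' x)) (C := R * c)
      (fun x hx => ((innerSL ℂ w).restrictScalars ℝ).hasFDerivAt.comp_hasDerivAt x (hd x hx)
        |>.hasDerivWithinAt) (fun x hx => ?_) ht hr
    · rw [inner_sub_right, mul_right_comm]
      exact this
    · obtain ⟨b, hb, hbR⟩ := hv' x hx
      rw [← hb, mul_comm]
      exact (hw b).trans (mul_le_mul_of_nonneg_left hbR hc)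
  refine exists_fstX_of_weak (mul_nonneg hR (abs_nonneg _)) ?_ (fun j φ => ?_) fun j φ => ?_
  · exact hs.norm_image_sub_le_of_norm_hasDerivWithin_le
      (fun x hx => (hd x hx).hasDerivWithinAt) (fun x hx => by
        obtain ⟨b, hb, hbR⟩ := hv' x hx
        rw [← hb]
        exact (norm_fstX_le b).trans hbR) ht hr
  · refine key _ _ (fun a => ?_) (norm_nonneg _)
    rw [← weak_posX a j φ]
    exact (norm_inner_le_norm _ _).trans
      (mul_le_mul_of_nonneg_left (norm_posX_le a j) (norm_nonneg _))
  · refine key _ _ (fun a => ?_) (norm_nonneg _)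
    rw [← weak_momX a j φ]
    exact (norm_inner_le_norm _ _).trans
      (mul_le_mul_of_nonneg_left (norm_momX_le a j) (norm_nonneg _))

/-! ### Regularity of the solution -/

/-- The generator `-i e^{-itΔ} f e^{itΔ}` on `X`. -/
def interX {f : Rn n → ℝ} (hf : BoundedDiff f) (t : ℝ) : XGraph n →L[ℂ] XGraph n :=
  (-Complex.I) • (freeX (-t) ∘L mulX hf ∘L freeX t)

theorem fstX_interX {f : Rn n → ℝ} (hf : BoundedDiff f) (t : ℝ) (a : XGraph n) :
    fstX (interX hf t a) = (-Complex.I) • free (-t) (mulR f (free t (fstX a))) := rfl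

theorem norm_interX_le {f : Rn n → ℝ} (hf : BoundedDiff f) {M T : ℝ}
    (hM : ∀ x, |f x| ≤ M ∧ ‖gradient f x‖ ≤ M) {t : ℝ} (ht : |t| ≤ T) (a : XGraph n) :
    ‖interX hf t a‖ ≤ (1 + 2 * T) * (2 * M * (1 + 2 * T)) * ‖a‖ := by
  have hM0 : 0 ≤ M := (norm_nonneg _).trans (hM 0).2
  have hT0 : 0 ≤ T := (abs_nonneg t).trans ht
  have h1 := norm_freeX_le (-t) (mulX hf (freeX t a))
  have h2 := norm_mulX_le hf (freeX t a) hM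
  have h3 := norm_freeX_le t a
  rw [abs_neg] at h1
  have e : ‖interX hf t a‖ = ‖freeX (-t) (mulX hf (freeX t a))‖ := by
    change ‖(-Complex.I) • freeX (-t) (mulX hf (freeX t a))‖ = _
    rw [norm_smul, norm_neg, Complex.norm_I, one_mul]
  rw [e]
  calc _ ≤ (1 + 2 * |t|) * (2 * M * ((1 + 2 * |t|) * ‖a‖)) := by
        refine h1.trans (mul_le_mul_of_nonneg_left (h2.trans ?_) (by positivity))
        exact mul_le_mul_of_nonneg_left h3 (by positivity)
    _ ≤ (1 + 2 * T) * (2 * M * ((1 + 2 * T) * ‖a‖)) := by gcongr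
    _ = _ := by ring

section Evolves

variable {U : ℝ → Rn n → ℝ} {ψ : ℝ → L2 n}

theorem Evolves.continuousOn_free (h : Evolves U ψ) :
    ContinuousOn (fun s => free (-s) (ψ s)) (Ici 0) := fun t ht =>
  tendsto_free ((continuous_neg.tendsto t).mono_left nhdsWithin_le_nhds) (h.continuousOn t ht)

theorem Evolves.exists_bounded (h : Evolves U ψ) (h0 : ψ 0 ∈ X n) {T : ℝ} (hT : 0 ≤ T) :
    ∃ R : ℝ, 0 ≤ R ∧ ∀ t ∈ Icc 0 T, ∃ a : XGraph n, fstX a = free (-t) (ψ t) ∧ ‖a‖ ≤ R := by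
  obtain ⟨M, hM⟩ := h.potential.bounded T
  obtain ⟨z, hz⟩ := exists_fstX_eq h0
  rcases hT.eq_or_lt with rfl | hT0
  · refine ⟨‖z‖, norm_nonneg z, fun t ht => ⟨z, ?_, le_rfl⟩⟩
    obtain rfl : t = 0 := le_antisymm ht.2 ht.1
    rw [hz, neg_zero, free_zero]
  have hM0 : 0 ≤ M := (abs_nonneg _).trans (hM T hT0 le_rfl 0).1
  -- The bound of the generator on `X`: two free flows and one multiplication. It also dominates the
  -- `L²` bound `M`.
  refine exists_fstX_of_hasDerivAt (C := (1 + 2 * T) * (2 * M * (1 + 2 * T))) (by positivity)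
    (h.continuousOn_free.mono Icc_subset_Ici_self)
    (fun t ht => h.hasDerivAt_free ht.1) (fun t ht a => ?_)
    (z := z) (by rw [hz, neg_zero, free_zero])
  have hf := h.potential.boundedDiff ht.1
  have hMt : ∀ x, |U t x| ≤ M ∧ ‖gradient (U t) x‖ ≤ M := fun x =>
    ⟨(hM t ht.1 ht.2 x).1, (hM t ht.1 ht.2 x).2.1⟩
  refine ⟨interX hf t a, norm_interX_le hf hMt ((abs_of_pos ht.1).trans_le ht.2) a, ?_⟩
  have e : (-Complex.I) • free (-t) (mulR (U t) (ψ t)) - fstX (interX hf t a) =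
      (-Complex.I) • free (-t) (mulR (U t) (free t (free (-t) (ψ t) - fstX a))) := by
    rw [fstX_interX, map_sub, free_free_neg, map_sub, map_sub, smul_sub]
  rw [e, norm_smul, norm_neg, Complex.norm_I, one_mul, norm_free]
  refine (norm_mulR_le hf.bddMeas (fun x => (hMt x).1) _).trans ?_
  rw [norm_free]
  refine mul_le_mul_of_nonneg_right ?_ (norm_nonneg _)
  have h1 : 0 ≤ M * T := mul_nonneg hM0 hT
  have h2 : 0 ≤ M * T * T := mul_nonneg h1 hT
  linear_combination hM0 + 8 * h1 + 8 * h2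

/-- The solution in the interaction picture, with values in `X`. -/
theorem Evolves.exists_lift (h : Evolves U ψ) (h0 : ψ 0 ∈ X n) :
    ∃ v : ℝ → XGraph n, (∀ t ≥ 0, fstX (v t) = free (-t) (ψ t)) ∧
      ∀ T : ℝ, ∃ L : ℝ, ∀ s ∈ Ioc 0 T, ∀ t ∈ Ioc 0 T, ‖v s - v t‖ ≤ L * |s - t| := by
  have h1 : ∀ t : ℝ, ∃ a : XGraph n, 0 ≤ t → fstX a = free (-t) (ψ t) := fun t => by
    by_cases ht : 0 ≤ t
    · obtain ⟨R, -, hR⟩ := h.exists_bounded h0 ht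
      obtain ⟨a, ha, -⟩ := hR t ⟨ht, le_rfl⟩
      exact ⟨a, fun _ => ha⟩
    · exact ⟨0, fun h => absurd h ht⟩
  choose v hv using h1
  refine ⟨v, hv, fun T => ?_⟩
  obtain ⟨M, hM⟩ := h.potential.bounded T
  rcases le_or_gt T 0 with hT | hT
  · exact ⟨0, fun s hs => absurd (hs.1.trans_le hs.2) hT.not_gt⟩
  obtain ⟨R, hR0, hR⟩ := h.exists_bounded h0 hT.le
  have hM0 : 0 ≤ M := (abs_nonneg _).trans (hM T hT le_rfl 0).1
  refine ⟨(1 + 2 * T) * (2 * M * (1 + 2 * T)) * R, fun s hs t ht => ?_⟩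
  have hd : ∀ t ∈ Ioc 0 T, ∃ b : XGraph n,
      fstX b = (-Complex.I) • free (-t) (mulR (U t) (ψ t)) ∧
        ‖b‖ ≤ (1 + 2 * T) * (2 * M * (1 + 2 * T)) * R := fun t ht => by
    obtain ⟨a, ha, haR⟩ := hR t ⟨ht.1.le, ht.2⟩
    have hf := h.potential.boundedDiff ht.1
    refine ⟨interX hf t a, by rw [fstX_interX, ha, free_free_neg], ?_⟩
    refine (norm_interX_le hf (fun x => ⟨(hM t ht.1 ht.2 x).1, (hM t ht.1 ht.2 x).2.1⟩)
      ((abs_of_pos ht.1).trans_le ht.2) a).trans ?_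
    exact mul_le_mul_of_nonneg_left haR (by positivity)
  obtain ⟨b, hb, hbR⟩ := exists_fstX_sub_of_hasDerivAt (convex_Ioc 0 T)
    (fun t ht => h.hasDerivAt_free ht.1) hd ht hs
  have : v s - v t = b := fstX_injective (by rw [map_sub, hv s hs.1.le, hv t ht.1.le, hb])
  rwa [this]

end Evolves

/-! ### Derivatives of quadratic forms -/

section quadratic

variable {A : XGraph n →L[ℂ] L2 n} {k : XGraph n → ℂ}

/-- Symmetry of `A` lets each slot be differentiated through `free s φ` in `L²`, so `A (freeX s φ)`
need only be continuous in `s`. -/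
theorem hasDerivAt_form_sch (hA : ∀ z w, inner ℂ (fstX z) (A w) = inner ℂ (A z) (fstX w))
    (hk : ∀ φ, k (schX φ) = Complex.I * (inner ℂ (-sch (Δ φ)) (A (schX φ)) -
      inner ℂ (A (schX φ)) (-sch (Δ φ)))) (φ : 𝓢(Rn n, ℂ)) (t : ℝ) :
    HasDerivAt (fun s => inner ℂ (free s (sch φ)) (A (freeX s (schX φ))))
      (k (freeX t (schX φ))) t := by
  have hr : HasDerivAt (fun s => free s (sch φ) - free t (sch φ))
      (Complex.I • sch (Δ (freeS t φ))) t := (hasDerivAt_free_sch φ t).sub_const _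
  have hz : ContinuousAt (fun s => A (freeX s (schX φ))) t :=
    (A.continuous.tendsto _).comp (tendsto_freeX tendsto_id tendsto_const_nhds)
  have h1 := hasDerivAt_inner_of_eq_zero hr (sub_self _) hz
  have h2 : HasDerivAt (fun s => inner ℂ (A (freeX t (schX φ))) (free s (sch φ)))
      (inner ℂ (A (freeX t (schX φ))) (Complex.I • sch (Δ (freeS t φ)))) t :=
    ((innerSL ℂ (A (freeX t (schX φ)))).restrictScalars ℝ).hasFDerivAt.comp_hasDerivAt t
      (hasDerivAt_free_sch φ t)
  have e : (fun s => inner ℂ (free s (sch φ)) (A (freeX s (schX φ)))) =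
      (fun s => inner ℂ (free s (sch φ) - free t (sch φ)) (A (freeX s (schX φ)))) +
        fun s => inner ℂ (A (freeX t (schX φ))) (free s (sch φ)) := by
    ext s
    have := hA (freeX t (schX φ)) (freeX s (schX φ))
    simp only [fstX_freeX, fstX_schX] at this
    rw [Pi.add_apply, inner_sub_left, ← this, sub_add_cancel]
  rw [e]
  refine (h1.add h2).congr_deriv ?_
  rw [freeX_schX, hk, inner_smul_left, inner_smul_right, inner_neg_left, inner_neg_right,
    Complex.conj_I]
  ring

/-- For `z` in `X` the pairing of `-Δz` with `Az` has no direct meaning. The derivatives along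
Schwartz functions tending to `z` converge locally uniformly in time, because `k` and the flow on
`X` are jointly continuous. -/
theorem hasDerivAt_form_free (hA : ∀ z w, inner ℂ (fstX z) (A w) = inner ℂ (A z) (fstX w))
    (hk : ∀ φ, k (schX φ) = Complex.I * (inner ℂ (-sch (Δ φ)) (A (schX φ)) -
      inner ℂ (A (schX φ)) (-sch (Δ φ)))) (hkc : Continuous k) (z : XGraph n) (t : ℝ) :
    HasDerivAt (fun s => inner ℂ (free s (fstX z)) (A (freeX s z))) (k (freeX t z)) t := by
  have hne : (𝓝[range schX] z).NeBot :=
    mem_closure_iff_nhdsWithin_neBot.mp (denseRange_schX z)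
  have hK : Continuous fun p : ℝ × XGraph n => k (freeX p.1 p.2) := hkc.comp continuous_freeX
  have h1 : Tendsto (fun p : XGraph n × ℝ => (p.2, p.1)) (𝓝[range schX] z ×ˢ 𝓝 t)
      (𝓝 (t, z)) := by
    rw [nhds_prod_eq]
    exact tendsto_snd.prodMk (tendsto_fst.mono_right nhdsWithin_le_nhds)
  have h2 : Tendsto (fun p : XGraph n × ℝ => (p.2, z)) (𝓝[range schX] z ×ˢ 𝓝 t)
      (𝓝 (t, z)) := by
    rw [nhds_prod_eq]
    exact tendsto_snd.prodMk tendsto_const_nhds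
  refine hasDerivAt_of_tendstoUniformlyOnFilter (l := 𝓝[range schX] z)
    (f := fun w s => inner ℂ (free s (fstX w)) (A (freeX s w)))
    (f' := fun w s => k (freeX s w)) (g' := fun s => k (freeX s z)) ?_ ?_ ?_
  · rw [tendstoUniformlyOnFilter_iff_tendsto]
    have h3 := ((hK.tendsto (t, z)).comp h2).prodMk_nhds ((hK.tendsto (t, z)).comp h1)
    exact h3.mono_right (nhds_le_uniformity _)
  · refine (Filter.Eventually.prod_inl self_mem_nhdsWithin _).mono ?_
    rintro ⟨_, s⟩ ⟨φ, rfl⟩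
    exact hasDerivAt_form_sch hA hk φ s
  · refine Eventually.of_forall fun s => ?_
    refine Tendsto.mono_left ?_ nhdsWithin_le_nhds
    exact Continuous.tendsto (f := fun w : XGraph n => inner ℂ (free s (fstX w)) (A (freeX s w)))
      (by fun_prop) z

/-- `v s` is compared with the frozen `v t`. The frozen part is `hasDerivAt_form_free`; in the two
remaining parts `v s - v t` vanishes at `t` and is differentiable in `L²`, and it is paired with a
curve that is continuous because `v` is continuous in `X`. -/
theorem hasDerivAt_form (hA : ∀ z w, inner ℂ (fstX z) (A w) = inner ℂ (A z) (fstX w))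
    (hk : ∀ φ, k (schX φ) = Complex.I * (inner ℂ (-sch (Δ φ)) (A (schX φ)) -
      inner ℂ (A (schX φ)) (-sch (Δ φ)))) (hkc : Continuous k) {v : ℝ → XGraph n} {g : L2 n}
    {t : ℝ} (hv : ContinuousAt v t) (hd : HasDerivAt (fun s => fstX (v s))
      ((-Complex.I) • free (-t) g) t) :
    HasDerivAt (fun s => inner ℂ (free s (fstX (v s))) (A (freeX s (v s))))
      (k (freeX t (v t)) + Complex.I * (inner ℂ g (A (freeX t (v t))) -
        inner ℂ (A (freeX t (v t))) g)) t := by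
  have hr : HasDerivAt (fun s => fstX (v s) - fstX (v t)) ((-Complex.I) • free (-t) g) t :=
    hd.sub_const _
  have h1 := hasDerivAt_form_free hA hk hkc (v t) t
  have c1 : ContinuousAt (fun s => free (-s) (A (freeX s (v s)))) t :=
    tendsto_free (continuous_neg.tendsto t)
      ((A.continuous.tendsto _).comp (tendsto_freeX tendsto_id hv))
  have c2 : ContinuousAt (fun s => free (-s) (A (freeX s (v t)))) t :=
    tendsto_free (continuous_neg.tendsto t)
      ((A.continuous.tendsto _).comp (tendsto_freeX tendsto_id tendsto_const_nhds))
  have h2 := hasDerivAt_inner_of_eq_zero hr (sub_self _) c1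
  have h3 := (hasDerivAt_inner_of_eq_zero hr (sub_self _) c2)
  have h4 : HasDerivAt (fun s => conj (inner ℂ (fstX (v s) - fstX (v t))
      (free (-s) (A (freeX s (v t)))))) (conj (inner ℂ ((-Complex.I) • free (-t) g)
      (free (-t) (A (freeX t (v t)))))) t :=
    Complex.conjCLE.hasFDerivAt.comp_hasDerivAt t h3
  have e : (fun s => inner ℂ (free s (fstX (v s))) (A (freeX s (v s)))) =
      (fun s => inner ℂ (free s (fstX (v t))) (A (freeX s (v t)))) +
      (fun s => inner ℂ (fstX (v s) - fstX (v t)) (free (-s) (A (freeX s (v s))))) +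
      fun s => conj (inner ℂ (fstX (v s) - fstX (v t)) (free (-s) (A (freeX s (v t))))) := by
    ext s
    have h5 := hA (freeX s (v t)) (freeX s (v s))
    have h6 := hA (freeX s (v t)) (freeX s (v t))
    simp only [fstX_freeX] at h5 h6
    simp only [Pi.add_apply]
    rw [inner_conj_symm, inner_free_right (-s), neg_neg, ← inner_free_right s, map_sub,
      inner_sub_left, inner_sub_right, ← h5, ← h6]
    ring
  rw [e]
  refine ((h1.add h2).add h4).congr_deriv ?_
  rw [inner_conj_symm, inner_smul_left, inner_smul_right, inner_free_free, inner_free_free,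
    map_neg, Complex.conj_I]
  ring

end quadratic

/-! ### The derivative of the potential energy -/

theorem BoundedDiffTime.hasDerivAt_inner {U : ℝ → Rn n → ℝ} (hU : BoundedDiffTime U) {t : ℝ}
    (ht : 0 < t) (u : L2 n) :
    HasDerivAt (fun s => inner ℂ u (mulR (U s) u)) (inner ℂ u (mulR (dt U t) u)) t := by
  obtain ⟨M, hM⟩ := hU.bounded (t + 1)
  have hs : Ioo 0 (t + 1) ∈ 𝓝 t := Ioo_mem_nhds ht (lt_add_one t)
  have hu : Integrable (fun x => conj (u x) * u x) volume := by
    have := L2.integrable_inner (𝕜 := ℂ) u u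
    exact this.congr (by filter_upwards with x; rw [RCLike.inner_apply, mul_comm])
  have hint : ∀ f : Rn n → ℝ, BddMeas (fun x => (f x : ℂ)) →
      inner ℂ u (mulR f u) = ∫ x, (f x : ℂ) * (conj (u x) * u x) := fun f hf => by
    rw [inner_eq_integral]
    refine integral_congr_ae ?_
    filter_upwards [coeFn_mulC hf u] with x hx
    rw [hx]; ring
  have hm : ∀ f : Rn n → ℝ, BddMeas (fun x => (f x : ℂ)) →
      AEStronglyMeasurable (fun x => (f x : ℂ) * (conj (u x) * u x)) volume := fun f hf =>
    hf.meas.mul hu.aestronglyMeasurable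
  have key := (hasDerivAt_integral_of_dominated_loc_of_deriv_le (μ := volume) (s := Ioo 0 (t + 1))
    (F := fun s x => (U s x : ℂ) * (conj (u x) * u x))
    (F' := fun s x => (dt U s x : ℂ) * (conj (u x) * u x))
    (bound := fun x => M * ‖conj (u x) * u x‖) hs ?_ ?_ ?_ ?_ (hu.norm.const_mul M) ?_).2
  · rw [hint _ (hU.bddMeas_dt ht)]
    refine key.congr_of_eventuallyEq ?_
    filter_upwards [hs] with s hs
    exact hint _ (hU.boundedDiff hs.1).bddMeas
  · filter_upwards [hs] with s hs using hm _ (hU.boundedDiff hs.1).bddMeas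
  · obtain ⟨C, hC⟩ := (hU.boundedDiff ht).bddMeas.bdd
    exact hu.bdd_mul (hU.boundedDiff ht).bddMeas.meas (Eventually.of_forall hC)
  · exact hm _ (hU.bddMeas_dt ht)
  · refine Eventually.of_forall fun x s hs => ?_
    rw [norm_mul, Complex.norm_real]
    exact mul_le_mul_of_nonneg_right (hM s hs.1 hs.2.le x).2.2 (norm_nonneg _)
  · refine Eventually.of_forall fun x s hs => ?_
    exact (hU.differentiable_time s hs.1 x).hasDerivAt.ofReal_comp.mul_const _

/-- Continuity of `ψ` suffices: since `U s - U t` is of size `M|s - t|`, replacing `ψ s` by `ψ t`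
costs only `o(|s - t|)`. -/
theorem BoundedDiffTime.hasDerivAt_inner_sub {U : ℝ → Rn n → ℝ} (hU : BoundedDiffTime U) {t : ℝ}
    (ht : 0 < t) {ψ : ℝ → L2 n} (hψ : ContinuousAt ψ t) :
    HasDerivAt (fun s => inner ℂ (ψ s) (mulR (U s) (ψ s) - mulR (U t) (ψ s)))
      (inner ℂ (ψ t) (mulR (dt U t) (ψ t))) t := by
  obtain ⟨M, hM⟩ := hU.bounded (t + 1)
  have h1 := (hU.hasDerivAt_inner ht (ψ t)).sub_const (inner ℂ (ψ t) (mulR (U t) (ψ t)))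
  have h2 : HasDerivAt (fun s => inner ℂ (ψ s) (mulR (U s) (ψ s) - mulR (U t) (ψ s)) -
      inner ℂ (ψ t) (mulR (U s) (ψ t) - mulR (U t) (ψ t))) 0 t := by
    rw [hasDerivAt_iff_isLittleO, Asymptotics.isLittleO_iff]
    intro ε hε
    have h3 : Tendsto (fun s => M * (‖ψ s - ψ t‖ * (‖ψ s‖ + ‖ψ t‖))) (𝓝 t)
        (𝓝 (M * (‖ψ t - ψ t‖ * (‖ψ t‖ + ‖ψ t‖)))) :=
      ((hψ.tendsto.sub_const _).norm.mul (hψ.tendsto.norm.add_const _)).const_mul M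
    rw [sub_self, norm_zero, zero_mul, mul_zero] at h3
    filter_upwards [h3.eventually_lt_const hε, Ioo_mem_nhds ht (lt_add_one t)] with s h4 hs
    have hD : ∀ u, ‖mulR (U s) u - mulR (U t) u‖ ≤ M * |s - t| * ‖u‖ := fun u =>
      hU.norm_mulR_sub_le hM hs.1 hs.2.le ht (le_add_of_nonneg_right zero_le_one) u
    have e : inner ℂ (ψ s) (mulR (U s) (ψ s) - mulR (U t) (ψ s)) -
        inner ℂ (ψ t) (mulR (U s) (ψ t) - mulR (U t) (ψ t)) =
        inner ℂ (ψ s - ψ t) (mulR (U s) (ψ s) - mulR (U t) (ψ s)) +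
        inner ℂ (ψ t) (mulR (U s) (ψ s - ψ t) - mulR (U t) (ψ s - ψ t)) := by
      simp only [inner_sub_left, inner_sub_right, map_sub]
      ring
    rw [sub_self (mulR (U t) (ψ t)), sub_self, sub_zero, smul_zero, sub_zero, e]
    refine (norm_add_le _ _).trans ?_
    have h5 := (norm_inner_le_norm (𝕜 := ℂ) (ψ s - ψ t)
      (mulR (U s) (ψ s) - mulR (U t) (ψ s))).trans
      (mul_le_mul_of_nonneg_left (hD _) (norm_nonneg _))
    have h6 := (norm_inner_le_norm (𝕜 := ℂ) (ψ t)
      (mulR (U s) (ψ s - ψ t) - mulR (U t) (ψ s - ψ t))).trans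
      (mul_le_mul_of_nonneg_left (hD _) (norm_nonneg _))
    have h7 := mul_le_mul_of_nonneg_right h4.le (abs_nonneg (s - t))
    rw [Real.norm_eq_abs]
    calc _ ≤ _ := add_le_add h5 h6
      _ = M * (‖ψ s - ψ t‖ * (‖ψ s‖ + ‖ψ t‖)) * |s - t| := by ring
      _ ≤ _ := h7
  have h3 := h2.add h1
  rw [zero_add] at h3
  refine h3.congr_of_eventuallyEq (Eventually.of_forall fun s => ?_)
  simp only [Pi.add_apply, inner_sub_right]
  ring

/-! ### Symmetric operators defined on `X` -/

section symmetric

variable {T : L2 n →ₗ.[ℂ] L2 n}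

theorem inner_ap_of_symm (hs : T.IsFormalAdjoint T) {u v : L2 n} (hu : u ∈ T.domain)
    (hv : v ∈ T.domain) : inner ℂ u (ap T v) = inner ℂ (ap T u) v := by
  rw [ap_of_mem hu, ap_of_mem hv]
  exact (hs ⟨u, hu⟩ ⟨v, hv⟩).symm

theorem ap_add {u v : L2 n} (hu : u ∈ T.domain) (hv : v ∈ T.domain) :
    ap T (u + v) = ap T u + ap T v := by
  rw [ap_of_mem hu, ap_of_mem hv, ap_of_mem (T.domain.add_mem hu hv), ← T.map_add]
  rfl

theorem ap_smul (c : ℂ) {u : L2 n} (hu : u ∈ T.domain) : ap T (c • u) = c • ap T u := by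
  rw [ap_of_mem hu, ap_of_mem (T.domain.smul_mem c hu), ← T.map_smul]
  rfl

/-- A symmetric operator whose domain contains `X` is bounded from `X` to `L²`, by the closed
graph theorem. -/
def symX (hs : T.IsFormalAdjoint T) (hd : X n ≤ T.domain) : XGraph n →L[ℂ] L2 n :=
  ContinuousLinearMap.ofSeqClosedGraph
    (g := { toFun := fun z => ap T (fstX z)
            map_add' := fun z w => by
              rw [map_add, ap_add (hd (fstX_mem z)) (hd (fstX_mem w))]
            map_smul' := fun c z => by
              rw [map_smul, ap_smul c (hd (fstX_mem z)), RingHom.id_apply] })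
    fun w z y hw hy => by
      -- Symmetry moves `T` onto the Schwartz function, where `L²` convergence of the arguments is
      -- enough to identify the limit.
      refine eq_of_inner_sch fun φ => ?_
      have hφ : ∀ z : XGraph n, inner ℂ (sch φ) (ap T (fstX z)) =
          inner ℂ (ap T (sch φ)) (fstX z) := fun z =>
        inner_ap_of_symm hs (hd (fstX_mem (schX φ))) (hd (fstX_mem z))
      have h1 := (tendsto_const_nhds (x := sch φ)).inner (𝕜 := ℂ) hy
      have h2 := (tendsto_const_nhds (x := ap T (sch φ))).inner (𝕜 := ℂ)
        ((fstX.continuous.tendsto z).comp hw)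
      refine (tendsto_nhds_unique h1 (h2.congr fun k => ?_)).trans (hφ z).symm
      exact (hφ (w k)).symm

theorem symX_apply (hs : T.IsFormalAdjoint T) (hd : X n ≤ T.domain) (z : XGraph n) :
    symX hs hd z = ap T (fstX z) := rfl

theorem inner_symX (hs : T.IsFormalAdjoint T) (hd : X n ≤ T.domain) (z w : XGraph n) :
    inner ℂ (fstX z) (symX hs hd w) = inner ℂ (symX hs hd z) (fstX w) :=
  inner_ap_of_symm hs (hd (fstX_mem z)) (hd (fstX_mem w))

end symmetric

theorem mulOp_symm (f : Rn n → ℝ) : (mulOp f).IsFormalAdjoint (mulOp f) := by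
  intro u v
  have hu := coeFn_ap_mulOp u.2
  have hv := coeFn_ap_mulOp v.2
  rw [ap_of_mem u.2] at hu
  rw [ap_of_mem v.2] at hv
  rw [inner_eq_integral, inner_eq_integral]
  refine integral_congr_ae ?_
  filter_upwards [hu, hv] with x h1 h2
  rw [h2]
  erw [h1]
  rw [map_mul, Complex.conj_ofReal]
  ring

theorem le_domain_mulOp {f : Rn n → ℝ} {C : ℝ} (hf : Measurable f)
    (hC : ∀ x, |f x| ≤ C * (1 + ∑ j, |x j|)) : X n ≤ (mulOp f).domain := by
  intro u hu
  obtain ⟨z, rfl⟩ := exists_fstX_eq hu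
  refine memLp_of_le_coord (f := fun x => (f x : ℂ)) (C := C)
    (Complex.measurable_ofReal.comp hf).aestronglyMeasurable (fun x => ?_)
    fun j => ⟨_, weak_posX z j⟩
  rw [Complex.norm_real]
  exact hC x

theorem expect_mulOp_linear {f g : Rn n → ℝ} {u : L2 n} (hf : u ∈ (mulOp f).domain)
    (hg : u ∈ (mulOp g).domain) (a b : ℝ) :
    u ∈ (mulOp fun x => a * f x + b * g x).domain ∧
    expect (mulOp fun x => a * f x + b * g x) u =
      a * expect (mulOp f) u + b * expect (mulOp g) u := by
  have hm : u ∈ (mulOp fun x => a * f x + b * g x).domain := by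
    refine (((mulDomain_memLp hf).const_smul (a : ℂ)).add
      ((mulDomain_memLp hg).const_smul (b : ℂ))).ae_eq ?_
    filter_upwards with x
    simp only [Pi.add_apply, Pi.smul_apply, smul_eq_mul]
    push_cast
    ring
  refine ⟨hm, ?_⟩
  have e : ap (mulOp fun x => a * f x + b * g x) u =
      (a : ℂ) • ap (mulOp f) u + (b : ℂ) • ap (mulOp g) u := by
    refine L2_ext ?_
    filter_upwards [coeFn_ap_mulOp hm, coeFn_ap_mulOp hf, coeFn_ap_mulOp hg,
      Lp.coeFn_add ((a : ℂ) • ap (mulOp f) u) ((b : ℂ) • ap (mulOp g) u),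
      Lp.coeFn_smul (a : ℂ) (ap (mulOp f) u), Lp.coeFn_smul (b : ℂ) (ap (mulOp g) u)]
      with x h1 h2 h3 h4 h5 h6
    rw [h1, h4, Pi.add_apply, h5, h6, Pi.smul_apply, Pi.smul_apply, h2, h3, smul_eq_mul,
      smul_eq_mul]
    push_cast
    ring
  rw [expect, e, inner_add_right, inner_smul_right, inner_smul_right]
  rfl

/-! ### The virial -/

theorem xGrad_eq_sum (f : Rn n → ℝ) (x : Rn n) : xGrad f x = ∑ j, x j * pderiv f j x := by
  rw [xGrad, PiLp.inner_apply]
  refine Finset.sum_congr rfl fun j _ => ?_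
  rw [pderiv_eq, RCLike.inner_apply, conj_trivial, mul_comm]

theorem measurable_xGrad (f : Rn n → ℝ) : Measurable (xGrad f) := by
  have : xGrad f = fun x => ∑ j, x j * pderiv f j x := funext (xGrad_eq_sum f)
  rw [this]
  refine Finset.measurable_sum _ fun j _ => Measurable.mul ?_ (measurable_pderiv f j)
  exact Continuous.measurable (by fun_prop)

theorem abs_xGrad_le {f : Rn n → ℝ} {M : ℝ} (hM : ∀ x, ‖gradient f x‖ ≤ M) (x : Rn n) :
    |xGrad f x| ≤ M * (1 + ∑ j, |x j|) := by
  have hM0 : 0 ≤ M := (norm_nonneg _).trans (hM x)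
  calc |xGrad f x| ≤ ‖x‖ * ‖gradient f x‖ := abs_real_inner_le_norm _ _
    _ ≤ (1 + ∑ j, |x j|) * M := by
        refine mul_le_mul ((norm_le_sum_coord x).trans (le_add_of_nonneg_left zero_le_one)) (hM x)
          (norm_nonneg _) ?_
        exact add_nonneg zero_le_one (Finset.sum_nonneg fun j _ => abs_nonneg _)
    _ = _ := mul_comm _ _

theorem BoundedDiff.le_domain_xGrad {f : Rn n → ℝ} (hf : BoundedDiff f) :
    X n ≤ (mulOp (xGrad f)).domain := by
  obtain ⟨M, hM⟩ := hf.bounded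
  exact le_domain_mulOp (measurable_xGrad f) (abs_xGrad_le fun x => (hM x).2)

theorem BoundedDiff.exists_virial_le {f : Rn n → ℝ} (hf : BoundedDiff f) :
    Measurable (virial f) ∧ ∃ C : ℝ, ∀ x, |virial f x| ≤ C * (1 + ∑ j, |x j|) := by
  obtain ⟨M, hM⟩ := hf.bounded
  refine ⟨((measurable_xGrad f).const_mul 4).add
    (hf.differentiable.continuous.measurable.const_mul 4), 8 * M, fun x => ?_⟩
  have hM0 : 0 ≤ M := (norm_nonneg _).trans (hM x).2
  have h1 := abs_xGrad_le (fun x => (hM x).2) x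
  have h2 : 0 ≤ M * ∑ j, |x j| := mul_nonneg hM0 (Finset.sum_nonneg fun j _ => abs_nonneg _)
  have h3 := (hM x).1
  calc |virial f x| ≤ |4 * xGrad f x| + |4 * f x| := abs_add_le _ _
    _ = 4 * |xGrad f x| + 4 * |f x| := by rw [abs_mul, abs_mul, abs_of_pos (four_pos (α := ℝ))]
    _ ≤ 8 * M * (1 + ∑ j, |x j|) := by linarith

theorem BoundedDiff.le_domain_plus {f : Rn n → ℝ} (hf : BoundedDiff f) :
    X n ≤ (mulOp (plus (virial f))).domain := by
  obtain ⟨hm, C, hC⟩ := hf.exists_virial_le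
  refine le_domain_mulOp (hm.max measurable_const) fun x => le_trans ?_ (hC x)
  rw [plus, abs_of_nonneg (le_max_right _ _)]
  exact max_le (le_abs_self _) (abs_nonneg _)

theorem minus_eq (f : Rn n → ℝ) : minus f = fun x => (1 : ℝ) * f x + (-1 : ℝ) * plus f x := by
  ext x
  have := min_add_max (f x) 0
  simp only [minus, plus]
  linarith

/-! ### Commutators with multiplication operators -/

/-- The form `∑ⱼ ⟨pⱼ u, pⱼ f u⟩ - ⟨pⱼ f u, pⱼ u⟩`. -/
def kinComm {f : Rn n → ℝ} (hf : BoundedDiff f) (z : XGraph n) : ℂ :=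
  Complex.I * ∑ j, (inner ℂ (momX j z) (momX j (mulX hf z)) -
    inner ℂ (momX j (mulX hf z)) (momX j z))

theorem neg_laplacian_eq (φ : 𝓢(Rn n, ℂ)) : -sch (Δ φ) = ∑ j, sch (Pop j (Pop j φ)) := by
  rw [SchwartzMap.laplacian_eq_sum (EuclideanSpace.basisFun (Fin n) ℝ), ← sch_sum,
    ← neg_one_smul ℂ, ← sch_smul, Finset.smul_sum]
  congr 1
  refine Finset.sum_congr rfl fun j _ => ?_
  rw [Pop_eq, Pop_eq, LineDeriv.lineDerivOp_smul, smul_smul, EuclideanSpace.basisFun_apply, dir]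
  congr 1
  rw [neg_mul_neg, Complex.I_mul_I]

theorem inner_neg_laplacian (φ : 𝓢(Rn n, ℂ)) (z : XGraph n) :
    inner ℂ (-sch (Δ φ)) (fstX z) = ∑ j, inner ℂ (momX j (schX φ)) (momX j z) := by
  rw [neg_laplacian_eq, sum_inner]
  exact Finset.sum_congr rfl fun j _ => (weak_momX z j _).symm

theorem continuous_kinComm {f : Rn n → ℝ} (hf : BoundedDiff f) : Continuous (kinComm hf) := by
  unfold kinComm
  fun_prop

/-- Identifies `kinComm` as the extension to `X` of the form `i[-Δ, f]`, as `hasDerivAt_form`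
requires. -/
theorem kinComm_schX {f : Rn n → ℝ} (hf : BoundedDiff f) (φ : 𝓢(Rn n, ℂ)) :
    kinComm hf (schX φ) = Complex.I * (inner ℂ (-sch (Δ φ)) ((mulR f ∘L fstX) (schX φ)) -
      inner ℂ ((mulR f ∘L fstX) (schX φ)) (-sch (Δ φ))) := by
  have h1 := inner_neg_laplacian φ (mulX hf (schX φ))
  have h2 : inner ℂ (mulR f (sch φ)) (-sch (Δ φ)) =
      ∑ j, inner ℂ (momX j (mulX hf (schX φ))) (momX j (schX φ)) := by
    rw [← inner_conj_symm]
    refine (congrArg conj h1).trans ?_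
    rw [map_sum]
    exact Finset.sum_congr rfl fun j _ => inner_conj_symm _ _
  rw [kinComm, Finset.sum_sub_distrib, ← h1, ← h2]
  rfl

theorem commMul_dilation {f : Rn n → ℝ} (hf : BoundedDiff f) (z : XGraph n) :
    commMul f (fun u v => -4 * dilation u v) (fstX z) =
      -2 * Complex.I * ∑ j, (inner ℂ (posX j (mulX hf z)) (momX j z) +
        inner ℂ (momX j (mulX hf z)) (posX j z) - inner ℂ (posX j z) (momX j (mulX hf z)) -
        inner ℂ (momX j z) (posX j (mulX hf z))) := by
  have e : ap (mulOp f) (fstX z) = fstX (mulX hf z) := ap_mulOp_of_bdd hf.bddMeas _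
  simp only [commMul, dilation, e, ap_posOp, ap_momOp, Finset.sum_sub_distrib,
    Finset.sum_add_distrib]
  ring

/-- From `pⱼ f = f pⱼ - i ∂ⱼf`: the terms without a derivative cancel because `f` commutes with
`xⱼ`, and the two terms with one contribute `2 xⱼ ∂ⱼf` each. -/
theorem commMul_dilation_eq {f : Rn n → ℝ} (hf : BoundedDiff f) (z : XGraph n) :
    commMul f (fun u v => -4 * dilation u v) (fstX z) =
      4 * expect (mulOp (xGrad f)) (fstX z) := by
  have hT : ∀ j, inner ℂ (fstX z) (mulR (pderiv f j) (posX j z)) =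
      inner ℂ (mulR (pderiv f j) (posX j z)) (fstX z) := fun j => by
    have hp := hf.bddMeas_pderiv j
    rw [inner_eq_integral, inner_eq_integral]
    refine integral_congr_ae ?_
    filter_upwards [coeFn_mulC hp (posX j z), (weak_posX z j).ae_eq_coord_mul] with x h1 h2
    rw [h1, h2]
    simp only [map_mul, Complex.conj_ofReal]
    ring
  have hx : ap (mulOp (xGrad f)) (fstX z) = ∑ j, mulR (pderiv f j) (posX j z) := by
    refine L2_ext ?_
    filter_upwards [coeFn_ap_mulOp (hf.le_domain_xGrad (fstX_mem z)),
      Lp.coeFn_fun_finsetSum Finset.univ (fun j => mulR (pderiv f j) (posX j z)),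
      ae_all_iff.mpr fun j => coeFn_mulC (hf.bddMeas_pderiv j) (posX j z),
      ae_all_iff.mpr fun j => (weak_posX z j).ae_eq_coord_mul] with x h1 h2 h3 h4
    rw [h1, h2, xGrad_eq_sum]
    push_cast
    rw [Finset.sum_mul]
    refine Finset.sum_congr rfl fun j _ => ?_
    rw [h3, h4]
    ring
  rw [commMul_dilation hf, expect, hx, inner_sum, Finset.mul_sum, Finset.mul_sum]
  refine Finset.sum_congr rfl fun j _ => ?_
  have hb := hf.bddMeas
  have hp := hf.bddMeas_pderiv j
  rw [posX_mulX, momX_mulX, inner_add_left, inner_add_right, inner_smul_left, inner_smul_right,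
    map_neg, Complex.conj_I, ← inner_mulR hb, ← inner_mulR hb (momX j z),
    ← inner_mulR hp, inner_mulR hp (posX j z), ← hT]
  linear_combination (-4 * inner ℂ (fstX z) (mulR (pderiv f j) (posX j z))) * Complex.I_sq

/-! ### The derivative of the conformal energy -/

/-- The difference quotients are bounded, so their weak convergence extends from Schwartz functions
to every `w` by density. -/
theorem hasDerivAt_inner_of_lipschitz {y : ℝ → L2 n} {y' : L2 n} {t L : ℝ}
    (hL : ∀ᶠ s in 𝓝 t, ‖y s - y t‖ ≤ L * |s - t|)
    (h : ∀ φ : 𝓢(Rn n, ℂ), HasDerivAt (fun s => inner ℂ (sch φ) (y s)) (inner ℂ (sch φ) y') t)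
    (w : L2 n) : HasDerivAt (fun s => inner ℂ w (y s)) (inner ℂ w y') t := by
  rw [hasDerivAt_iff_isLittleO, Asymptotics.isLittleO_iff]
  intro ε hε
  set K := |L| + ‖y'‖ + 1 with hK
  have hK0 : 0 < K := by positivity
  obtain ⟨φ, hφ⟩ := denseRange_sch.exists_dist_lt w (ε := ε / (2 * K)) (by positivity)
  rw [dist_eq_norm] at hφ
  have h1 := (Asymptotics.isLittleO_iff.mp (hasDerivAt_iff_isLittleO.mp (h φ))) (half_pos hε)
  filter_upwards [hL, h1] with s h2 h3
  have e : ∀ u : L2 n, inner ℂ u (y s) - inner ℂ u (y t) - (s - t) • inner ℂ u y' =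
      inner ℂ u (y s - y t - (s - t) • y') := fun u => by
    rw [inner_sub_right, inner_sub_right, inner_smul_right_eq_smul]
  rw [e] at h3 ⊢
  have h4 : ‖y s - y t - (s - t) • y'‖ ≤ K * |s - t| := by
    refine (norm_sub_le _ _).trans ?_
    rw [norm_smul, Real.norm_eq_abs]
    have h5 := mul_le_mul_of_nonneg_right (le_abs_self L) (abs_nonneg (s - t))
    have h6 := abs_nonneg (s - t)
    rw [hK]
    linarith
  have h5 : inner ℂ w (y s - y t - (s - t) • y') =
      inner ℂ (w - sch φ) (y s - y t - (s - t) • y') +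
        inner ℂ (sch φ) (y s - y t - (s - t) • y') := by
    rw [inner_sub_left, sub_add_cancel]
  rw [h5]
  rw [Real.norm_eq_abs] at h3 ⊢
  have h6 : ‖inner ℂ (w - sch φ) (y s - y t - (s - t) • y')‖ ≤
      ε / (2 * K) * (K * |s - t|) :=
    (norm_inner_le_norm _ _).trans
      (mul_le_mul hφ.le h4 (norm_nonneg _) (by positivity))
  calc _ ≤ _ := norm_add_le _ _
    _ ≤ ε / (2 * K) * (K * |s - t|) + ε / 2 * |s - t| := add_le_add h6 h3
    _ = ε * |s - t| := by field_simp; ring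

/-- In `‖y s‖² = ‖y t‖² + 2 Re⟨y t, y s - y t⟩ + ‖y s - y t‖²` the linear term uses only the weak
derivative, and the Lipschitz bound makes the last term quadratic in `s - t`. -/
theorem hasDerivAt_inner_self_of_lipschitz {y : ℝ → L2 n} {y' : L2 n} {t L : ℝ}
    (hL : ∀ᶠ s in 𝓝 t, ‖y s - y t‖ ≤ L * |s - t|)
    (h : ∀ φ : 𝓢(Rn n, ℂ), HasDerivAt (fun s => inner ℂ (sch φ) (y s)) (inner ℂ (sch φ) y') t) :
    HasDerivAt (fun s => inner ℂ (y s) (y s)) (inner ℂ y' (y t) + inner ℂ (y t) y') t := by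
  have h1 := hasDerivAt_inner_of_lipschitz hL h (y t)
  have h2 : HasDerivAt (fun s => conj (inner ℂ (y t) (y s))) (conj (inner ℂ (y t) y')) t :=
    Complex.conjCLE.hasFDerivAt.comp_hasDerivAt t h1
  have h3 : HasDerivAt (fun s => inner ℂ (y s - y t) (y s - y t) - inner ℂ (y t) (y t)) 0 t := by
    refine HasDerivAt.sub_const _ ?_
    have h4 : (fun s => inner ℂ (y s - y t) (y s - y t)) =O[𝓝 t] fun s => (s - t) ^ 2 := by
      refine Asymptotics.IsBigO.of_bound (L * L) ?_
      filter_upwards [hL] with s hs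
      refine (norm_inner_le_norm _ _).trans ?_
      rw [norm_pow, Real.norm_eq_abs]
      calc _ ≤ L * |s - t| * (L * |s - t|) :=
            mul_le_mul hs hs (norm_nonneg _) ((norm_nonneg _).trans hs)
        _ = _ := by ring
    rw [hasDerivAt_iff_isLittleO]
    simp only [sub_self, inner_zero_left, sub_zero, smul_zero]
    refine h4.trans_isLittleO ?_
    have h5 : Tendsto (fun s : ℝ => s - t) (𝓝 t) (𝓝 0) := by
      have : Tendsto (fun s : ℝ => s - t) (𝓝 t) (𝓝 (t - t)) := Continuous.tendsto (by fun_prop) t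
      rwa [sub_self] at this
    exact (Asymptotics.isLittleO_pow_id one_lt_two).comp_tendsto h5
  have h6 := (h2.add h1).add h3
  rw [add_zero, inner_conj_symm] at h6
  refine h6.congr_of_eventuallyEq (Eventually.of_forall fun s => ?_)
  simp only [Pi.add_apply, inner_conj_symm, inner_sub_left, inner_sub_right]
  ring

/-- `(xⱼ - 2t pⱼ)e^{itΔ} = e^{itΔ}xⱼ`, and the flow is isometric. -/
theorem conformal_freeX (t : ℝ) (z : XGraph n) :
    conformal t (fstX (freeX t z)) = ∑ j, ‖posX j z‖ ^ 2 := by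
  rw [conformal]
  refine Finset.sum_congr rfl fun j _ => ?_
  rw [ap_posOp, ap_momOp, posX_freeX, momX_freeX, add_sub_cancel_right, norm_free]

theorem inner_posX_interX {f : Rn n → ℝ} (hf : BoundedDiff f) (t : ℝ) (z : XGraph n) (j : Fin n) :
    inner ℂ (posX j (interX hf t z)) (posX j z) =
      Complex.I * inner ℂ (posX j (mulX hf (freeX t z)) -
        ((2 * t : ℝ) : ℂ) • momX j (mulX hf (freeX t z)))
        (posX j (freeX t z) - ((2 * t : ℝ) : ℂ) • momX j (freeX t z)) := by
  have e1 : posX j (interX hf t z) = (-Complex.I) • free (-t) (posX j (mulX hf (freeX t z)) -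
      ((2 * t : ℝ) : ℂ) • momX j (mulX hf (freeX t z))) := by
    change (-Complex.I) • posX j (freeX (-t) (mulX hf (freeX t z))) = _
    rw [posX_freeX, map_sub, map_smul, mul_neg, Complex.ofReal_neg,
      neg_smul ((2 * t : ℝ) : ℂ), ← sub_eq_add_neg]
  have e2 : posX j z = free (-t) (posX j (freeX t z) -
      ((2 * t : ℝ) : ℂ) • momX j (freeX t z)) := by
    rw [posX_freeX, momX_freeX, add_sub_cancel_right, free_neg_free]
  rw [e1, e2, inner_smul_left, inner_free_free, map_neg, Complex.conj_I, neg_neg]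

theorem inner_sub_smul_comm {x p x' p' : L2 n} (τ : ℝ) :
    inner ℂ (x' - (τ : ℂ) • p') (x - (τ : ℂ) • p) = inner ℂ x' x
      - τ * (inner ℂ x' p + inner ℂ p' x) + τ ^ 2 * inner ℂ p' p := by
  simp only [inner_sub_left, inner_sub_right, inner_smul_left, inner_smul_right,
    Complex.conj_ofReal]
  ring

/-- This is `i[f, |x - 2pt|²]` expanded in `t`: order zero vanishes since `f` commutes with `xⱼ`,
order one is the dilation, order two the kinetic commutator. -/
theorem sum_inner_posX_interX {f : Rn n → ℝ} (hf : BoundedDiff f) (t : ℝ) (z : XGraph n) :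
    ∑ j, (inner ℂ (posX j (interX hf t z)) (posX j z) +
      inner ℂ (posX j z) (posX j (interX hf t z))) =
    t * commMul f (fun u v => -4 * dilation u v) (fstX (freeX t z)) -
      4 * t ^ 2 * kinComm hf (freeX t z) := by
  rw [commMul_dilation hf, kinComm]
  simp only [Finset.mul_sum]
  rw [← Finset.sum_sub_distrib]
  refine Finset.sum_congr rfl fun j _ => ?_
  have h1 := inner_posX_interX hf t z j
  have h2 : inner ℂ (posX j z) (posX j (interX hf t z)) = -(Complex.I *
      inner ℂ (posX j (freeX t z) - ((2 * t : ℝ) : ℂ) • momX j (freeX t z))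
        (posX j (mulX hf (freeX t z)) - ((2 * t : ℝ) : ℂ) • momX j (mulX hf (freeX t z)))) := by
    rw [← inner_conj_symm, h1, map_mul, inner_conj_symm, Complex.conj_I, neg_mul]
  have h3 : inner ℂ (posX j (mulX hf (freeX t z))) (posX j (freeX t z)) =
      inner ℂ (posX j (freeX t z)) (posX j (mulX hf (freeX t z))) :=
    (inner_mulR hf.bddMeas _ _).symm
  rw [h1, h2, inner_sub_smul_comm, inner_sub_smul_comm, h3]
  push_cast
  ring

section Evolves

variable {U : ℝ → Rn n → ℝ} {ψ : ℝ → L2 n} {v : ℝ → XGraph n}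

/-- `v` is a lift to `X` of the solution `ψ` in the interaction picture. -/
structure IsLift (U : ℝ → Rn n → ℝ) (ψ : ℝ → L2 n) (v : ℝ → XGraph n) : Prop where
  evolves : Evolves U ψ
  eq : ∀ t ≥ 0, fstX (v t) = free (-t) (ψ t)
  lipschitz : ∀ T : ℝ, ∃ L : ℝ, ∀ s ∈ Ioc 0 T, ∀ t ∈ Ioc 0 T, ‖v s - v t‖ ≤ L * |s - t|

theorem IsLift.fstX_freeX (h : IsLift U ψ v) {t : ℝ} (ht : 0 ≤ t) :
    fstX (freeX t (v t)) = ψ t := by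
  rw [AdaptedConformal.fstX_freeX, h.eq t ht, free_free_neg]

theorem IsLift.eventually_norm_sub_le (h : IsLift U ψ v) {t : ℝ} (ht : 0 < t) :
    ∃ L : ℝ, ∀ᶠ s in 𝓝 t, ‖v s - v t‖ ≤ L * |s - t| := by
  obtain ⟨L, hL⟩ := h.lipschitz (t + 1)
  refine ⟨L, ?_⟩
  filter_upwards [Ioo_mem_nhds ht (lt_add_one t)] with s hs
  exact hL s ⟨hs.1, hs.2.le⟩ t ⟨ht, le_add_of_nonneg_right zero_le_one⟩

theorem IsLift.continuousAt (h : IsLift U ψ v) {t : ℝ} (ht : 0 < t) : ContinuousAt v t := by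
  obtain ⟨L, hL⟩ := h.eventually_norm_sub_le ht
  have h1 : Tendsto (fun s => L * |s - t|) (𝓝 t) (𝓝 (L * |t - t|)) :=
    Continuous.tendsto (by fun_prop) t
  rw [sub_self, abs_zero, mul_zero] at h1
  exact tendsto_iff_norm_sub_tendsto_zero.mpr (squeeze_zero' (Eventually.of_forall fun _ =>
    norm_nonneg _) hL h1)

theorem IsLift.hasDerivAt (h : IsLift U ψ v) {t : ℝ} (ht : 0 < t) :
    HasDerivAt (fun s => fstX (v s)) ((-Complex.I) • free (-t) (mulR (U t) (ψ t))) t := by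
  refine (h.evolves.hasDerivAt_free ht).congr_of_eventuallyEq ?_
  filter_upwards [Ioi_mem_nhds ht] with s hs using h.eq s hs.le

theorem IsLift.hasDerivAt_conformal (h : IsLift U ψ v) {t : ℝ} (ht : 0 < t) :
    HasDerivAt (fun s => (conformal s (ψ s) : ℂ))
      (t * commMul (U t) (fun u v => -4 * dilation u v) (ψ t) -
        4 * t ^ 2 * kinComm (h.evolves.potential.boundedDiff ht) (freeX t (v t))) t := by
  have hf := h.evolves.potential.boundedDiff ht
  obtain ⟨L, hL⟩ := h.eventually_norm_sub_le ht
  -- The `L²` derivative of `v` lies in `X`, so its position components exist and serve as the weak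
  -- derivatives of `xⱼ v`.
  have hd : (-Complex.I) • free (-t) (mulR (U t) (ψ t)) = fstX (interX hf t (v t)) := by
    rw [fstX_interX, h.eq t ht.le, free_free_neg]
  have h1 : ∀ j, HasDerivAt (fun s => inner ℂ (posX j (v s)) (posX j (v s)))
      (inner ℂ (posX j (interX hf t (v t))) (posX j (v t)) +
        inner ℂ (posX j (v t)) (posX j (interX hf t (v t)))) t := fun j => by
    refine hasDerivAt_inner_self_of_lipschitz (y := fun s => posX j (v s)) (L := L) ?_ fun φ => ?_
    · filter_upwards [hL] with s hs
      rw [← map_sub]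
      exact (norm_posX_le _ j).trans hs
    -- `xⱼ` moves to the test function, which leaves `v`, differentiable in `L²`.
    · rw [weak_posX _ j φ]
      have h2 := ((innerSL ℂ (sch (Xop j φ))).restrictScalars ℝ).hasFDerivAt.comp_hasDerivAt t
        (h.hasDerivAt ht)
      rw [hd] at h2
      exact h2.congr_of_eventuallyEq (Eventually.of_forall fun s => weak_posX (v s) j φ)
  have h2 := HasDerivAt.fun_sum (u := Finset.univ) fun j _ => h1 j
  rw [sum_inner_posX_interX hf, h.fstX_freeX ht.le] at h2
  refine h2.congr_of_eventuallyEq ?_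
  filter_upwards [Ioi_mem_nhds ht] with s hs
  rw [← h.fstX_freeX hs.le, conformal_freeX, Complex.ofReal_sum]
  refine Finset.sum_congr rfl fun j _ => ?_
  rw [inner_self_eq_norm_sq_to_K, Complex.ofReal_pow]
  rfl

/-- `U s` is split into the frozen `U t` and the increment `U s - U t`. For the frozen part the
potential commutes with itself, so only the kinetic commutator remains. -/
theorem IsLift.hasDerivAt_potential (h : IsLift U ψ v) {t : ℝ} (ht : 0 < t) :
    HasDerivAt (fun s => expect (mulOp (U s)) (ψ s))
      (kinComm (h.evolves.potential.boundedDiff ht) (freeX t (v t)) +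
        expect (mulOp (dt U t)) (ψ t)) t := by
  have hU := h.evolves.potential
  have hf := hU.boundedDiff ht
  have h1 := hasDerivAt_form (A := mulR (U t) ∘L fstX) (k := kinComm hf)
    (fun z w => inner_mulR hf.bddMeas _ _) (kinComm_schX hf) (continuous_kinComm hf)
    (h.continuousAt ht) (h.hasDerivAt ht)
  have h2 := hU.hasDerivAt_inner_sub ht (h.evolves.continuousAt ht)
  have e : (mulR (U t) ∘L fstX) (freeX t (v t)) = mulR (U t) (ψ t) := by
    rw [ContinuousLinearMap.comp_apply, h.fstX_freeX ht.le]
  rw [e, sub_self, mul_zero, add_zero] at h1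
  rw [expect, ap_mulOp_of_bdd (hU.bddMeas_dt ht)]
  refine (h1.add h2).congr_of_eventuallyEq ?_
  filter_upwards [Ioi_mem_nhds ht] with s hs
  have h3 : (mulR (U t) ∘L fstX) (freeX s (v s)) = mulR (U t) (ψ s) := by
    rw [ContinuousLinearMap.comp_apply, h.fstX_freeX hs.le]
  rw [Pi.add_apply, h3, h.eq s hs.le, free_free_neg, inner_sub_right, add_sub_cancel, expect,
    ap_mulOp_of_bdd (hU.boundedDiff hs).bddMeas]

end Evolves

/-! ### The expectation of the adaptor -/

section Adaptor

variable {V : Rn n → ℝ} {B : L2 n →ₗ.[ℂ] L2 n}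

/-- The expectation of `-[4 x·∇V + 4V]₊`. -/
def commValue (hV : BoundedDiff V) (z : XGraph n) : ℂ :=
  -inner ℂ (fstX z) (symX (mulOp_symm _) hV.le_domain_plus z)

theorem continuous_commValue (hV : BoundedDiff V) : Continuous (commValue hV) := by
  unfold commValue
  fun_prop

theorem IsAdaptor.commHam_eq (hB : IsAdaptor V B) (hV : BoundedDiff V) (φ : 𝓢(Rn n, ℂ)) :
    commHam V B φ φ = commValue hV (schX φ) := hB.commutator φ φ

theorem IsAdaptor.extendsTo (hB : IsAdaptor V B) (hV : BoundedDiff V) (z : XGraph n) :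
    ExtendsTo (fun φ => commHam V B φ φ) (fstX z) (commValue hV z) := by
  have h1 : Tendsto schX (comap (fun φ => xNorm (sch φ - fstX z)) (𝓝 0)) (𝓝 z) := by
    refine tendsto_iff_norm_sub_tendsto_zero.mpr
      (squeeze_zero (fun _ => norm_nonneg _) (fun φ => ?_) tendsto_comap)
    have := norm_le_xNorm (schX φ - z)
    rwa [map_sub, fstX_schX] at this
  exact (((continuous_commValue hV).tendsto z).comp h1).congr fun φ =>
    (hB.commHam_eq hV φ).symm

/-- The expectation of `i[-Δ, B]`. -/
def kinValue (hV : BoundedDiff V) (hB : IsAdaptor V B) (z : XGraph n) : ℂ :=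
  commValue hV z - Complex.I * (inner ℂ (mulR V (fstX z)) (symX hB.symmetric hB.domain z) -
    inner ℂ (symX hB.symmetric hB.domain z) (mulR V (fstX z)))

theorem continuous_kinValue (hV : BoundedDiff V) (hB : IsAdaptor V B) :
    Continuous (kinValue hV hB) := by
  have := continuous_commValue hV
  unfold kinValue
  fun_prop

/-- The adaptor equation rewrites `i[-Δ, B]` as the value of `i[-Δ + V, B]` minus `i[V, B]`, and
both of these are continuous on `X`. -/
theorem kinValue_schX (hV : BoundedDiff V) (hB : IsAdaptor V B) (φ : 𝓢(Rn n, ℂ)) :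
    kinValue hV hB (schX φ) = Complex.I *
      (inner ℂ (-sch (Δ φ)) (symX hB.symmetric hB.domain (schX φ)) -
      inner ℂ (symX hB.symmetric hB.domain (schX φ)) (-sch (Δ φ))) := by
  rw [kinValue, ← hB.commHam_eq hV, commHam, ham, ap_mulOp_of_bdd hV.bddMeas, symX_apply, fstX_schX,
    inner_add_left, inner_add_right]
  ring

/-- The `i[V, B]` subtracted in `kinValue` is restored by the potential part `i[V + W, B]`, which
leaves `i[W, B]`. -/
theorem IsLift.hasDerivAt_adaptor {W : ℝ → Rn n → ℝ} {ψ : ℝ → L2 n} {v : ℝ → XGraph n}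
    (h : IsLift (fun t => V + W t) ψ v) (hV : BoundedDiff V) (hW : BoundedDiffTime W)
    (hB : IsAdaptor V B) {t : ℝ} (ht : 0 < t) :
    HasDerivAt (fun s => expect B (ψ s))
      (commValue hV (freeX t (v t)) + commMul (W t) (fun u v => inner ℂ u (ap B v)) (ψ t)) t := by
  have hWt := hW.boundedDiff ht
  have h1 := hasDerivAt_form (inner_symX hB.symmetric hB.domain) (kinValue_schX hV hB)
    (continuous_kinValue hV hB) (h.continuousAt ht) (h.hasDerivAt ht)
  have hB' : ∀ s ≥ 0, symX hB.symmetric hB.domain (freeX s (v s)) = ap B (ψ s) := fun s hs => by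
    rw [symX_apply, h.fstX_freeX hs]
  have e1 : (fun s => inner ℂ (free s (fstX (v s))) (symX hB.symmetric hB.domain
      (freeX s (v s)))) =ᶠ[𝓝 t] fun s => expect B (ψ s) := by
    filter_upwards [Ioi_mem_nhds ht] with s hs
    rw [hB' s hs.le, h.eq s hs.le, free_free_neg, expect]
  have e2 : mulR (V + W t) (ψ t) = mulR V (ψ t) + mulR (W t) (ψ t) := by
    rw [← mulC_add hV.bddMeas hWt.bddMeas]
    simp only [mulR, Pi.add_apply, Complex.ofReal_add]
  have e3 : inner ℂ (ψ t) (ap B (mulR (W t) (ψ t))) = inner ℂ (ap B (ψ t)) (mulR (W t) (ψ t)) := by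
    rw [← h.fstX_freeX ht.le, ← fstX_mulX hWt]
    exact inner_symX hB.symmetric hB.domain _ _
  refine (h1.congr_of_eventuallyEq e1.symm).congr_deriv ?_
  rw [kinValue, hB' t ht.le, h.fstX_freeX ht.le, e2, commMul, ap_mulOp_of_bdd hWt.bddMeas, e3,
    inner_add_left, inner_add_right]
  ring

theorem commMul_add_dilation {W : Rn n → ℝ} (hV : BoundedDiff V) (hW : BoundedDiff W)
    {u : L2 n} (hu : u ∈ X n) :
    commMul (V + W) (fun u v => -4 * dilation u v) u =
      commMul V (fun u v => -4 * dilation u v) u +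
        commMul W (fun u v => -4 * dilation u v) u := by
  obtain ⟨z, rfl⟩ := exists_fstX_eq hu
  have e : mulX (hV.add hW) z = mulX hV z + mulX hW z := by
    refine fstX_injective ?_
    rw [map_add, fstX_mulX, fstX_mulX, fstX_mulX, ← mulC_add hV.bddMeas hW.bddMeas]
    simp only [mulR, Pi.add_apply, Complex.ofReal_add]
  rw [commMul_dilation (hV.add hW), commMul_dilation hV, commMul_dilation hW, e, ← mul_add,
    ← Finset.sum_add_distrib]
  congr 1
  refine Finset.sum_congr rfl fun j _ => ?_
  simp only [map_add, inner_add_left, inner_add_right]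
  ring

theorem commMul_add (f : Rn n → ℝ) (p q : L2 n → L2 n → ℂ) (u : L2 n) :
    commMul f (fun u v => p u v + q u v) u = commMul f p u + commMul f q u := by
  simp only [commMul]
  ring

theorem IsLift.hasDerivAt_observable {W : ℝ → Rn n → ℝ} {ψ : ℝ → L2 n} {v : ℝ → XGraph n}
    (h : IsLift (fun t => V + W t) ψ v) (hV : BoundedDiff V) (hW : BoundedDiffTime W)
    (hB : IsAdaptor V B) {t : ℝ} (ht : 0 < t) :
    HasDerivAt (fun s => observable V W B s (ψ s))
      (-(1 / (t : ℂ)) * ((conformal t (ψ t) : ℂ) / t - 4 * t * expect (mulOp (V + W t)) (ψ t))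
        + commMul V (fun u v => -4 * dilation u v) (ψ t)
        + commMul (W t) (fun u v => -4 * dilation u v + inner ℂ u (ap B v)) (ψ t)
        + 4 * t * expect (mulOp (dt W t)) (ψ t) + commValue hV (freeX t (v t))) t := by
  have ht0 : (t : ℂ) ≠ 0 := Complex.ofReal_ne_zero.mpr ht.ne'
  have hu : ψ t ∈ X n := by
    rw [← h.fstX_freeX ht.le]
    exact fstX_mem _
  have h0 : HasDerivAt (fun s : ℝ => (s : ℂ)) 1 t := (hasDerivAt_id t).ofReal_comp
  have h1 := (h.hasDerivAt_conformal ht).div h0 ht0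
  have h2 := (h0.const_mul (4 : ℂ)).mul (h.hasDerivAt_potential ht)
  have h3 := (h1.add h2).add (h.hasDerivAt_adaptor hV hW hB ht)
  refine h3.congr_deriv ?_
  rw [commMul_add, commMul_add_dilation hV (hW.boundedDiff ht) hu, dt_const_add]
  -- The terms `-4t kinComm` from the conformal energy and `+4t kinComm` from the potential cancel
  -- here.
  field_simp
  ring

/-- The virial identity makes the `V` terms `4x·∇V + 4V`; adding `-[4x·∇V + 4V]₊` leaves the
negative part. -/
theorem observable_deriv_eq {W : ℝ → Rn n → ℝ} (hV : BoundedDiff V) (hW : BoundedDiffTime W)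
    {t : ℝ} (ht : 0 < t) (z : XGraph n) (b : L2 n → L2 n → ℂ) :
    -(1 / (t : ℂ)) * ((conformal t (fstX z) : ℂ) / t
          - 4 * t * expect (mulOp (V + W t)) (fstX z))
        + commMul V (fun u v => -4 * dilation u v) (fstX z)
        + commMul (W t) (fun u v => -4 * dilation u v + b u v) (fstX z)
        + 4 * t * expect (mulOp (dt W t)) (fstX z) + commValue hV z =
      -(1 / (t : ℂ) ^ 2) * (conformal t (fstX z) : ℂ)
        + expect (mulOp (minus (virial V))) (fstX z) + expect (mulOp (wTerm W t)) (fstX z)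
        + commMul (W t) b (fstX z) := by
  have ht0 : (t : ℂ) ≠ 0 := Complex.ofReal_ne_zero.mpr ht.ne'
  have hWt := hW.boundedDiff ht
  have hz := fstX_mem z
  have dV := mem_mulOp_of_bdd hV.bddMeas (fstX z)
  have dW := mem_mulOp_of_bdd hWt.bddMeas (fstX z)
  have h1 := expect_mulOp_linear dV dW 1 1
  have h2 := expect_mulOp_linear (hV.le_domain_xGrad hz) dV 4 4
  have h3 := expect_mulOp_linear h2.1 (hV.le_domain_plus hz) 1 (-1)
  have h4 := expect_mulOp_linear (hWt.le_domain_xGrad hz) dW 4 4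
  have h5 := expect_mulOp_linear h4.1 (mem_mulOp_of_bdd (hW.bddMeas_dt ht) (fstX z)) 1 (4 * t)
  have e1 : V + W t = fun x => (1 : ℝ) * V x + (1 : ℝ) * W t x := by ext x; simp
  have e3 : minus (virial V) = fun x => (1 : ℝ) * (4 * xGrad V x + 4 * V x) +
      (-1 : ℝ) * plus (virial V) x := minus_eq _
  have e5 : wTerm W t = fun x => (1 : ℝ) * (4 * xGrad (W t) x + 4 * W t x) +
      4 * t * dt W t x := by ext x; simp [wTerm]
  rw [commMul_add, commMul_dilation_eq hV, commMul_dilation_eq hWt, e1, h1.2, e3, h3.2, h2.2, e5,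
    h5.2, h4.2, commValue, symX_apply]
  simp only [expect]
  push_cast
  field_simp
  ring

end Adaptor

end AdaptedConformal

end

/-! ### Assembly of the theorem. -/

theorem mainTheorem1 (n : ℕ)
    (V : AdaptedConformal.Rn n → ℝ) (W : ℝ → AdaptedConformal.Rn n → ℝ)
    (hV : AdaptedConformal.BoundedDiff V) (hW : AdaptedConformal.BoundedDiffTime W)
    (B : AdaptedConformal.L2 n →ₗ.[ℂ] AdaptedConformal.L2 n)
    (hB : AdaptedConformal.IsAdaptor V B)
    (ψ : ℝ → AdaptedConformal.L2 n) (hψ : AdaptedConformal.IsSolution V W ψ)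
    (hψ0 : ψ 0 ∈ AdaptedConformal.X n) :
    (∀ t ≥ 0, ψ t ∈ AdaptedConformal.X n) ∧
    ∀ t > 0,
      -- all expressions below are meaningful
      (∀ f ∈ ({V, W t, V + W t, AdaptedConformal.dt W t,
          AdaptedConformal.minus (AdaptedConformal.virial V),
          AdaptedConformal.wTerm W t} : Set (AdaptedConformal.Rn n → ℝ)),
        ψ t ∈ (AdaptedConformal.mulOp f).domain) ∧
      AdaptedConformal.ap (AdaptedConformal.mulOp V) (ψ t) ∈ AdaptedConformal.X n ∧
      AdaptedConformal.ap (AdaptedConformal.mulOp (W t)) (ψ t) ∈ AdaptedConformal.X n ∧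
      -- `c` is the expectation of `i[-Δ + V, B]` in the state `ψ t`
      ∃ c : ℂ, AdaptedConformal.ExtendsTo
          (fun φ => AdaptedConformal.commHam V B φ φ) (ψ t) c ∧
        HasDerivAt (fun s => AdaptedConformal.observable V W B s (ψ s))
          (-(1 / (t : ℂ)) * ((AdaptedConformal.conformal t (ψ t) : ℂ) / t
              - 4 * t * AdaptedConformal.expect (AdaptedConformal.mulOp (V + W t)) (ψ t))
            + AdaptedConformal.commMul V
                (fun u v => -4 * AdaptedConformal.dilation u v) (ψ t)
            + AdaptedConformal.commMul (W t)
                (fun u v => -4 * AdaptedConformal.dilation u v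
                  + inner ℂ u (AdaptedConformal.ap B v)) (ψ t)
            + 4 * t * AdaptedConformal.expect
                (AdaptedConformal.mulOp (AdaptedConformal.dt W t)) (ψ t)
            + c) t ∧
        HasDerivAt (fun s => AdaptedConformal.observable V W B s (ψ s))
          (-(1 / (t : ℂ) ^ 2) * (AdaptedConformal.conformal t (ψ t) : ℂ)
            + AdaptedConformal.expect (AdaptedConformal.mulOp
                (AdaptedConformal.minus (AdaptedConformal.virial V))) (ψ t)
            + AdaptedConformal.expect
                (AdaptedConformal.mulOp (AdaptedConformal.wTerm W t)) (ψ t)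
            + AdaptedConformal.commMul (W t)
                (fun u v => inner ℂ u (AdaptedConformal.ap B v)) (ψ t)) t := by
  have hE : AdaptedConformal.Evolves (fun t => V + W t) ψ :=
    ⟨hW.const_add hV, hψ.continuousOn, hψ.equation⟩
  obtain ⟨v, hv, hL⟩ := hE.exists_lift hψ0
  have h : AdaptedConformal.IsLift (fun t => V + W t) ψ v := ⟨hE, hv, hL⟩
  have hX : ∀ t ≥ 0, ψ t ∈ AdaptedConformal.X n := fun t ht => by
    rw [← h.fstX_freeX ht]
    exact AdaptedConformal.fstX_mem _
  refine ⟨hX, fun t ht => ?_⟩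
  have hWt := hW.boundedDiff ht
  have hz := h.fstX_freeX ht.le
  have hu := hX t ht.le
  have hmul : ∀ f, AdaptedConformal.BoundedDiff f →
      AdaptedConformal.ap (AdaptedConformal.mulOp f) (ψ t) ∈ AdaptedConformal.X n := fun f hf => by
    rw [AdaptedConformal.ap_mulOp_of_bdd hf.bddMeas, ← hz, ← AdaptedConformal.fstX_mulX hf]
    exact AdaptedConformal.fstX_mem _
  have h1 := h.hasDerivAt_observable hV hW hB ht
  -- The witness `c` is `commValue` at `freeX t (v t)`, the element of `XGraph n` lying over `ψ t`.
  refine ⟨?_, hmul V hV, hmul (W t) hWt, AdaptedConformal.commValue hV _, ?_, h1, ?_⟩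
  · have dV := AdaptedConformal.mem_mulOp_of_bdd hV.bddMeas (ψ t)
    have dW := AdaptedConformal.mem_mulOp_of_bdd hWt.bddMeas (ψ t)
    have dD := AdaptedConformal.mem_mulOp_of_bdd (hW.bddMeas_dt ht) (ψ t)
    have dvir := (AdaptedConformal.expect_mulOp_linear (hV.le_domain_xGrad hu) dV 4 4).1
    rintro f (rfl | rfl | rfl | rfl | rfl | rfl)
    · exact dV
    · exact dW
    · exact AdaptedConformal.mem_mulOp_of_bdd (hV.add hWt).bddMeas _
    · exact dD
    · rw [AdaptedConformal.minus_eq]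
      exact (AdaptedConformal.expect_mulOp_linear dvir (hV.le_domain_plus hu) 1 (-1)).1
    · have h2 := (AdaptedConformal.expect_mulOp_linear
        (AdaptedConformal.expect_mulOp_linear (hWt.le_domain_xGrad hu) dW 4 4).1 dD 1 (4 * t)).1
      simp only [one_mul] at h2
      exact h2
  · have h2 := hB.extendsTo hV (AdaptedConformal.freeX t (v t))
    rwa [hz] at h2
  · have h2 := AdaptedConformal.observable_deriv_eq hV hW ht (AdaptedConformal.freeX t (v t))
      fun u v => inner ℂ u (AdaptedConformal.ap B v)
    rw [hz] at h2
    exact h1.congr_deriv h2
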